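/- **Model.** There are $m$ resources and $n$ customer types. In each period $t=1,\dots,T$ one customer arrives; the types $j(t)$ are i.i.d., equal to $j$ with probability $\lambda_j$ ($\sum_j\lambda_j=1$). Accepting a type-$j$ customer earns $r_j\ge 0$ and uses $a_{ij}\ge0$ units of resource $i$; every type uses at least one resource ($A_j=(a_{ij})_i\ne0$). Capacities are proportional to the horizon: $C_i=T\varrho_i$ with fixed $\varrho_i>0$. Let $\Lambda_j(T)$ be the number of type-$j$ arrivals in periods $1,\dots,T$ and $V^{\mathsf{HO}}=\max\{\sum_j r_jz_j:\ \sum_jA_jz_j\le C,\ 0\le z_j\le\Lambda_j(T)\}$ the hindsight optimum. **General position.** For every $p\in\mathbb R^m$ at most $m$ of the $n+m$ equations $p^\top A_j=r_j$ $(j\le n)$, $p_i=0$ $(i\le m)$ hold. **Subroutine $\mathsf{FF}(t_1,B,L)$** (started in period $t_1$ with capacity vector $B$ meant for $L$ periods). Put $\bar\alpha_i=\max_{j:a_{ij}\ne0}r_j/a_{ij}$ (zero if resource $i$ is not used by any type), $\bar a=\max_{i,j}a_{ij}$, $\bar\theta=\frac{\max_iB_i}{\min_iB_i}\sum_i\bar\alpha_i$,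 $D=\bar\theta\sqrt m$, $G=\frac{\max_iB_i}{L}\sqrt m+\bar a\sqrt m$, $\theta^{(t_1)}=0$, $B(t_1)=B$. A capacity vector is called sufficient if it is $\ge A_j$ for all $j$. In period $t$, if $B(t)$ is sufficient, the decision is $y_t=\mathbf 1\{r_{j(t)}>\sum_i\theta_i^{(t)}a_{i,j(t)}\}$, then $B(t+1)=B(t)-y_tA_{j(t)}$ and $\theta^{(t+1)}_i$ is $\theta^{(t)}_i-\frac{D}{G\sqrt{t-t_1+1}}\big(\frac{B_i}{L}-y_ta_{i,j(t)}\big)$ projected onto $[0,\bar\theta]$; once $B(t)$ is not sufficient, the subroutine stops and $y_t=0$ from then on. **Algorithm $\mathsf{FD}$** with parameters $\alpha,\beta,\gamma$: let $a=\alpha$, $b=\frac12+\beta$, $c=\frac\alpha2+\gamma$, $l_1=\lceil T^a\rceil$, $l_2=\lceil T-T^a-T^b\rceil$. *Phase I* (periods $1,\dots,l_1$): follow $\mathsf{FF}(1,C\,l_1/T,l_1)$; let $x_j$ be the number of accepted type-$j$ customers. Put $j\in\mathcal R$ if $x_j<\lambda_jT^c$, otherwise $j\in\mathcal A$ if $x_j>\lambda_j(T^a-T^c)$.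 *Phase II* (periods $l_1+1,\dots,l_1+l_2$): start with real capacity $C(T-l_1)/T$ and run $\mathsf{FF}(l_1+1,C(T-l_1)/T,T-l_1)$ on a virtual copy of it over all arrivals, with decisions $y_t$. While the real remaining capacity is sufficient, reject if $j(t)\in\mathcal R$, accept if $j(t)\in\mathcal A$, and otherwise follow $y_t$; once the real remaining capacity is not sufficient, reject until the end of the phase. *Phase III* (periods $l_1+l_2+1,\dots,T$): with $B_i$ the real remaining capacity at its beginning, run $\mathsf{FF}(l_1+l_2+1,B'',T-l_1-l_2)$ on the virtual capacity $B''_i=\max\{T^{3b/4},\min\{B_i,\bar aT^b\}\}$, and accept if it accepts and $A_{j(t)}$ fits in the real remaining capacity. Let $V^{\mathsf{FD}}$ be the total revenue. (The algorithm solves no linear program.) **Theorem.** Assume general position, and let $\varepsilon=\varepsilon(T)=\frac{\log\log T}{\log T}$. All $O(\cdot)$ are for $T\to\infty$ with $\lambda,r,A,\varrho$ fixed. 1. For all fixed $\alpha,\beta,\gamma$ with $0<\alpha<\frac12$, $\frac\alpha2\le\beta<\frac12$, $0<\gamma<\frac\alpha2$, $$\mathbf E[V^{\mathsf{HO}}-V^{\mathsf{FD}}]=O(T^\alpha)+O\big(Te^{-T^\varepsilon}\big)+O\big(T^{\frac38+\frac34\beta+\frac12\varepsilon}\big).$$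 2. For $\alpha=\frac{3\log\log T}{2\log T}$, $\beta=\frac{\log\log T}{\log T}$, $\gamma=\frac{2\log\log T}{3\log T}$ (which satisfy these inequalities for all large $T$), $$\mathbf E[V^{\mathsf{HO}}-V^{\mathsf{FD}}]=O\big(T^{3/8}(\log T)^{5/4}\big),$$ and $\mathsf{FD}$ is optimal on the diffusion scale: for horizons $T=k\bar T$ with $\bar T\ge1$ a fixed integer, $\mathbf E[V^{\mathsf{HO}}-V^{\mathsf{FD}}]/\sqrt k\to0$ as $k\to\infty$. -/

import Mathlib

open MeasureTheory ProbabilityTheory Filter Asymptotics Topology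

noncomputable section

/-- Primitive data of a quantity-based network revenue management problem with `m` resources and
`n` customer types, in the proportional regime: with horizon `T`, resource `i` has initial capacity
`T * rate i`. -/
structure NRM (m n : ℕ) where
  /-- arrival probability of each type -/
  lam : Fin n → ℝ
  /-- revenue of each type -/
  rev : Fin n → ℝ
  /-- bill-of-materials matrix: `bom i j` units of resource `i` are used by a type-`j` customer -/
  bom : Matrix (Fin m) (Fin n) ℝ
  /-- capacity per period of the horizon -/
  rate : Fin m → ℝ
  lam_nonneg : ∀ j, 0 ≤ lam j
  lam_sum : ∑ j, lam j = 1
  rev_nonneg : ∀ j, 0 ≤ rev j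
  bom_nonneg : ∀ i j, 0 ≤ bom i j
  /-- every customer type consumes something -/
  bom_ne_zero : ∀ j, ∃ i, bom i j ≠ 0
  rate_pos : ∀ i, 0 < rate i

namespace NRM

variable {m n : ℕ}

/-- Initial capacities when the horizon is `T`. -/
def capacity (I : NRM m n) (T : ℕ) : Fin m → ℝ := fun i => T * I.rate i

/-- General position: a price vector `p` satisfies at most `m` of the `n + m` equations
`pᵀ Ā_l = r̄_l`, where `Ā = [A, Id]` and `r̄ = (r, 0)`. -/
def GeneralPosition (I : NRM m n) : Prop :=
  ∀ p : Fin m → ℝ,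
    {l : Fin n ⊕ Fin m | Matrix.vecMul p (Matrix.fromCols I.bom 1) l
      = Sum.elim I.rev (fun _ => 0) l}.ncard ≤ m

/-! ### Arrivals and the hindsight optimum

A sample path is `arr : ℕ → Fin n`; `arr t` is the type of the customer of period `t`, and the
periods of the horizon are `1, …, T`. -/

/-- Number of type-`j` arrivals in periods `1, …, T`. -/
def arrivals (arr : ℕ → Fin n) (T : ℕ) (j : Fin n) : ℕ :=
  ((Finset.Icc 1 T).filter fun t => arr t = j).card

/-- Value of the hindsight linear program. -/
def hindsight (I : NRM m n) (T : ℕ) (arr : ℕ → Fin n) : ℝ :=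
  sSup {v : ℝ | ∃ z : Fin n → ℝ, (∀ i, ∑ j, I.bom i j * z j ≤ I.capacity T i) ∧
    (∀ j, 0 ≤ z j ∧ z j ≤ arrivals arr T j) ∧ v = ∑ j, I.rev j * z j}

/-! ### The primal-dual subroutine (bid prices updated by online gradient descent) -/

/-- Largest entry of the bill-of-materials matrix. -/
def aBar (I : NRM m n) : ℝ := ⨆ i, ⨆ j, I.bom i j

/-- Largest revenue per unit of resource `i` (zero if no type uses resource `i`). -/
def alphaBar (I : NRM m n) (i : Fin m) : ℝ :=
  ⨆ j : {j : Fin n // I.bom i j ≠ 0}, I.rev j / I.bom i j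

/-- Upper end of the bid-price interval for initial capacity `B`. -/
def thetaBar (I : NRM m n) (B : Fin m → ℝ) : ℝ :=
  ((⨆ i, B i) / (⨅ i, B i)) * ∑ i, I.alphaBar i

/-- Bound on the diameter of the bid-price box. -/
def diamBound (I : NRM m n) (B : Fin m → ℝ) : ℝ := I.thetaBar B * √(m : ℝ)

/-- Bound on the gradients, for initial capacity `B` meant for `L` periods. -/
def gradBound (I : NRM m n) (B : Fin m → ℝ) (L : ℝ) : ℝ :=
  (⨆ i, B i) / L * √(m : ℝ) + I.aBar * √(m : ℝ)

/-- Every customer type could be served from the remaining capacity `B`. -/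
def Sufficient (I : NRM m n) (B : Fin m → ℝ) : Prop := ∀ j i, I.bom i j ≤ B i

open Classical in
/-- Bid-price decision: one if the revenue exceeds the total bid price, else zero. -/
def bidDecision (I : NRM m n) (θ : Fin m → ℝ) (j : Fin n) : ℝ :=
  if I.rev j > ∑ i, θ i * I.bom i j then 1 else 0

/-- Projected gradient step in the `s`-th period of a run (`s ≥ 1`), after decision `y` on a
type-`j` customer. -/
def dualStep (I : NRM m n) (B : Fin m → ℝ) (L : ℝ) (s : ℕ) (θ : Fin m → ℝ) (y : ℝ) (j : Fin n) :
    Fin m → ℝ := fun i =>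
  min (max 0 (θ i - I.diamBound B / (I.gradBound B L * √(s : ℝ)) * (B i / L - y * I.bom i j)))
    (I.thetaBar B)

/-- Bid prices and remaining capacity at the beginning of a period. -/
structure FFState (m : ℕ) where
  price : Fin m → ℝ
  cap : Fin m → ℝ

open Classical in
/-- State of the subroutine at the beginning of period `t₁ + s`, when it is started in period `t₁`
with capacity `B` that is meant for `L` periods. Once the capacity is not sufficient the state
never changes again: the subroutine has stopped. -/
def ffRun (I : NRM m n) (arr : ℕ → Fin n) (t₁ : ℕ) (B : Fin m → ℝ) (L : ℝ) : ℕ → FFState m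
  | 0 => ⟨fun _ => 0, B⟩
  | s + 1 =>
    let S := I.ffRun arr t₁ B L s
    let j := arr (t₁ + s)
    let y := I.bidDecision S.price j
    if I.Sufficient S.cap then
      ⟨I.dualStep B L (s + 1) S.price y j, fun i => S.cap i - y * I.bom i j⟩
    else S

open Classical in
/-- Decision of the subroutine in period `t₁ + s` (zero after it has stopped). -/
def ffDecision (I : NRM m n) (arr : ℕ → Fin n) (t₁ : ℕ) (B : Fin m → ℝ) (L : ℝ) (s : ℕ) : ℝ :=
  let S := I.ffRun arr t₁ B L s
  if I.Sufficient S.cap then I.bidDecision S.price (arr (t₁ + s)) else 0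

/-! ### The three-phase thresholding algorithm -/

/-- Length of phase I: `⌈T ^ a⌉` with `a = α`. -/
def len₁ (T : ℕ) (α : ℝ) : ℕ := ⌈(T : ℝ) ^ α⌉₊

/-- Length of phase II: `⌈T - T ^ a - T ^ b⌉` with `a = α`, `b = 1/2 + β`. -/
def len₂ (T : ℕ) (α β : ℝ) : ℕ := ⌈(T : ℝ) - (T : ℝ) ^ α - (T : ℝ) ^ (1 / 2 + β)⌉₊

/-- Capacity handed to phase I, proportional to its length. -/
def cap₁ (I : NRM m n) (T : ℕ) (α : ℝ) : Fin m → ℝ :=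
  fun i => I.capacity T i * (len₁ T α / T)

/-- Decision in period `1 + s` of phase I: the subroutine, as a problem of horizon `len₁`. -/
def dec₁ (I : NRM m n) (arr : ℕ → Fin n) (T : ℕ) (α : ℝ) (s : ℕ) : ℝ :=
  I.ffDecision arr 1 (I.cap₁ T α) (len₁ T α) s

open Classical in
/-- Number of type-`j` customers accepted in phase I. -/
def count₁ (I : NRM m n) (arr : ℕ → Fin n) (T : ℕ) (α : ℝ) (j : Fin n) : ℝ :=
  ∑ s ∈ Finset.range (len₁ T α), if arr (1 + s) = j then I.dec₁ arr T α s else 0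

/-- Type `j` is put in the reject class, with threshold exponent `c = α/2 + γ`. -/
def InReject (I : NRM m n) (arr : ℕ → Fin n) (T : ℕ) (α γ : ℝ) (j : Fin n) : Prop :=
  I.count₁ arr T α j < I.lam j * (T : ℝ) ^ (α / 2 + γ)

/-- Type `j` is put in the accept class. -/
def InAccept (I : NRM m n) (arr : ℕ → Fin n) (T : ℕ) (α γ : ℝ) (j : Fin n) : Prop :=
  ¬ I.InReject arr T α γ j ∧
    I.count₁ arr T α j > I.lam j * ((T : ℝ) ^ α - (T : ℝ) ^ (α / 2 + γ))

/-- Real and virtual capacity at the beginning of phase II. -/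
def cap₂ (I : NRM m n) (T : ℕ) (α : ℝ) : Fin m → ℝ :=
  fun i => I.capacity T i * (((T : ℝ) - len₁ T α) / T)

open Classical in
/-- Decision in period `1 + len₁ + s` of phase II when the real remaining capacity is `B`. The
subroutine runs on its own virtual capacity, over all arrivals; the types of the two classes
override its decision. If `B` is not sufficient, phase II has stopped. -/
def dec₂ (I : NRM m n) (arr : ℕ → Fin n) (T : ℕ) (α γ : ℝ) (B : Fin m → ℝ) (s : ℕ) : ℝ :=
  let j := arr (1 + len₁ T α + s)
  if I.Sufficient B then
    if I.InReject arr T α γ j then 0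
    else if I.InAccept arr T α γ j then 1
    else I.ffDecision arr (1 + len₁ T α) (I.cap₂ T α) ((T : ℝ) - len₁ T α) s
  else 0

/-- Real remaining capacity at the beginning of period `1 + len₁ + s` of phase II. -/
def real₂ (I : NRM m n) (arr : ℕ → Fin n) (T : ℕ) (α γ : ℝ) : ℕ → Fin m → ℝ
  | 0 => I.cap₂ T α
  | s + 1 => fun i => I.real₂ arr T α γ s i
      - I.dec₂ arr T α γ (I.real₂ arr T α γ s) s * I.bom i (arr (1 + len₁ T α + s))

/-- Virtual capacity at the beginning of phase III. -/
def cap₃ (I : NRM m n) (arr : ℕ → Fin n) (T : ℕ) (α β γ : ℝ) : Fin m → ℝ := fun i =>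
  max ((T : ℝ) ^ (3 * (1 / 2 + β) / 4))
    (min (I.real₂ arr T α γ (len₂ T α β) i) (I.aBar * (T : ℝ) ^ (1 / 2 + β)))

open Classical in
/-- Decision in period `1 + len₁ + len₂ + s` of phase III when the real remaining capacity is `B`:
the decision of the subroutine on the virtual capacity, whenever the arriving customer fits. -/
def dec₃ (I : NRM m n) (arr : ℕ → Fin n) (T : ℕ) (α β γ : ℝ) (B : Fin m → ℝ) (s : ℕ) : ℝ :=
  let t₁ := 1 + len₁ T α + len₂ T α β
  if ∀ i, I.bom i (arr (t₁ + s)) ≤ B i then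
    I.ffDecision arr t₁ (I.cap₃ arr T α β γ) ((T : ℝ) - len₁ T α - len₂ T α β) s
  else 0

/-- Real remaining capacity at the beginning of period `1 + len₁ + len₂ + s` of phase III. -/
def real₃ (I : NRM m n) (arr : ℕ → Fin n) (T : ℕ) (α β γ : ℝ) : ℕ → Fin m → ℝ
  | 0 => I.real₂ arr T α γ (len₂ T α β)
  | s + 1 => fun i => I.real₃ arr T α β γ s i
      - I.dec₃ arr T α β γ (I.real₃ arr T α β γ s) s
        * I.bom i (arr (1 + len₁ T α + len₂ T α β + s))

/-- Total revenue of the three-phase algorithm on a sample path. -/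
def fdRevenue (I : NRM m n) (T : ℕ) (α β γ : ℝ) (arr : ℕ → Fin n) : ℝ :=
  (∑ s ∈ Finset.range (len₁ T α), I.rev (arr (1 + s)) * I.dec₁ arr T α s)
  + (∑ s ∈ Finset.range (len₂ T α β), I.rev (arr (1 + len₁ T α + s))
      * I.dec₂ arr T α γ (I.real₂ arr T α γ s) s)
  + ∑ s ∈ Finset.range (T - (len₁ T α + len₂ T α β)),
      I.rev (arr (1 + len₁ T α + len₂ T α β + s))
        * I.dec₃ arr T α β γ (I.real₃ arr T α β γ s) s

/-- Regret of one sample path: hindsight optimum minus revenue of the algorithm. -/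
def pathRegret (I : NRM m n) (T : ℕ) (α β γ : ℝ) (arr : ℕ → Fin n) : ℝ :=
  I.hindsight T arr - I.fdRevenue T α β γ arr

/-- Expected regret, for customer types `J t` on a probability space. -/
def regret (I : NRM m n) {Ω : Type*} [MeasurableSpace Ω] (P : Measure Ω) (J : ℕ → Ω → Fin n)
    (T : ℕ) (α β γ : ℝ) : ℝ :=
  ∫ ω, I.pathRegret T α β γ (fun t => J t ω) ∂P

end NRM

/-- `log log T / log T`. -/
def epsScale (T : ℕ) : ℝ := Real.log (Real.log T) / Real.log T

/-- The choice `α = 3 log log T / (2 log T)`. -/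
def alphaStar (T : ℕ) : ℝ := 3 * Real.log (Real.log T) / (2 * Real.log T)

/-- The choice `β = log log T / log T`. -/
def betaStar (T : ℕ) : ℝ := Real.log (Real.log T) / Real.log T

/-- The choice `γ = 2 log log T / (3 log T)`. -/
def gammaStar (T : ℕ) : ℝ := 2 * Real.log (Real.log T) / (3 * Real.log T)

end

namespace NRM

variable {m n : ℕ}

/-! ### Elementary bounds on the data -/

/-! Everything is measured against the fluid program max r·x, Ax ≤ ϱ, 0 ≤ x ≤ λ, with an optimal
primal-dual pair (x*, p). General position makes the columns of [A, Id] that are active at p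
linearly independent (`GeneralPosition.linearIndepOn`). Hence the fluid optimum is sharp: a vector
that exceeds the bounds sλ by at most E and whose reduced-cost and resource gaps total at most E
lies within O(E) of s x* (`OptPair.exists_dist_le`).

The subroutine is greedy at its current prices, and the prices perform online gradient descent. So
for every fixed θ in the price box, its revenue plus θ times its unused resources is at least the
fluid value up to the descent regret and sampling errors (`GoodRun.revenue_ge`). Choosing θ at the
corner given by the signs of the resource slacks turns this into a gap bound, so on typical paths
the acceptance counts follow s x* with error of order √(N log T) over N periods
(`OptPair.exists_acc_dist_le`).

Phase I therefore separates the types with x*_j = 0, x*_j = λ_j and 0 < x*_j < λ_j, because √(T^α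
log T) ≪ T^c ≪ T^α (`SlackBound.classified`); it costs at most its length. In phase II only the
third kind follows the virtual prices. Its acceptance counts w, and an optimal packing z of the
arrivals of phases II and III, differ by O(√(T log T)) from their fluid values. Phase III has length
about T^(1/2+β), which is much longer than that error, so z - w is nonnegative and fits the arrivals
and capacities of phase III. Phase II thus loses nothing (`Completable`,
`GeneralPosition.exists_completable`).

Phase III only has to compete with the packing z - w (`GeneralPosition.exists_lastPhase_le`). With q
= T^(b/4) its virtual capacities lie between q³ and a multiple of q⁴. The price interval then has
length O(q), the descent over at most q⁴ periods costs O(q · q²), sampling errors add a factor √(log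
T), and the artificial capacity floor costs O(q³). The total is T^α + T^(3/8 + 3β/4) √(log T), where
√(log T) = T^(ε/2).

One configuration escapes the corner argument: a dual price equal to the upper end θ̄ of the box,
which leaves no room to penalise overuse. General position then forces a single used resource with
only one type at zero reduced revenue. If that type is fully accepted, a smaller price is optimal as
well; otherwise this is `SingleResource`, treated by hand with the capacity constraint replacing the
missing bound.

Typicality comes from an exponential-moment bound for sums with predictable weights
(`integral_exp_weightedDev_le`). Atypical paths have probability O(1/T) and regret O(T), so they
contribute O(1) (`GeneralPosition.exists_abs_regret_le`). -/

lemma nonempty_types (I : NRM m n) : Nonempty (Fin n) := by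
  by_contra h
  rw [not_nonempty_iff] at h
  have := I.lam_sum
  simp at this

lemma nonempty_resources (I : NRM m n) : Nonempty (Fin m) := by
  obtain ⟨j⟩ := I.nonempty_types
  exact ⟨(I.bom_ne_zero j).choose⟩

lemma bom_le_aBar (I : NRM m n) (i : Fin m) (j : Fin n) : I.bom i j ≤ I.aBar :=
  (le_ciSup (f := fun j => I.bom i j) (Set.finite_range _).bddAbove j).trans
    (le_ciSup (f := fun i => ⨆ j, I.bom i j) (Set.finite_range _).bddAbove i)

lemma aBar_pos (I : NRM m n) : 0 < I.aBar := by
  obtain ⟨j⟩ := I.nonempty_types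
  obtain ⟨i, hi⟩ := I.bom_ne_zero j
  exact ((I.bom_nonneg i j).lt_of_ne' hi).trans_le (I.bom_le_aBar i j)

lemma lam_le_one (I : NRM m n) (j : Fin n) : I.lam j ≤ 1 := by
  rw [← I.lam_sum]
  exact Finset.single_le_sum (fun k _ => I.lam_nonneg k) (Finset.mem_univ j)

lemma alphaBar_nonneg (I : NRM m n) (i : Fin m) : 0 ≤ I.alphaBar i :=
  Real.iSup_nonneg fun _ => div_nonneg (I.rev_nonneg _) (I.bom_nonneg _ _)

lemma rev_le_alphaBar_mul (I : NRM m n) {i : Fin m} {j : Fin n} (h : I.bom i j ≠ 0) :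
    I.rev j ≤ I.alphaBar i * I.bom i j := by
  have hp : 0 < I.bom i j := (I.bom_nonneg i j).lt_of_ne' h
  rw [← div_le_iff₀ hp]
  exact le_ciSup (f := fun j : {j : Fin n // I.bom i j ≠ 0} => I.rev j / I.bom i j)
    (Set.finite_range _).bddAbove ⟨j, h⟩

lemma rev_le_sum_alphaBar_mul (I : NRM m n) (j : Fin n) :
    I.rev j ≤ ∑ i, I.alphaBar i * I.bom i j := by
  obtain ⟨i, hi⟩ := I.bom_ne_zero j
  exact (I.rev_le_alphaBar_mul hi).trans
    (Finset.single_le_sum (f := fun i => I.alphaBar i * I.bom i j)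
      (fun k _ => mul_nonneg (I.alphaBar_nonneg k) (I.bom_nonneg k j)) (Finset.mem_univ i))

/-- The zero price vector satisfies the `m` equations `p i = 0`, so no revenue can vanish. -/
lemma GeneralPosition.rev_pos {I : NRM m n} (h : I.GeneralPosition) (j : Fin n) :
    0 < I.rev j := by
  refine (I.rev_nonneg j).lt_of_ne' fun h0 => ?_
  have h1 := h 0
  have hsub : insert (Sum.inl j) (Set.range (Sum.inr : Fin m → Fin n ⊕ Fin m)) ⊆
      {l : Fin n ⊕ Fin m | Matrix.vecMul 0 (Matrix.fromCols I.bom 1) l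
      = Sum.elim I.rev (fun _ => 0) l} := by
    rintro l (rfl | ⟨i, rfl⟩) <;> simp [h0]
  have h2 := (Set.ncard_le_ncard hsub (Set.toFinite _)).trans h1
  rw [Set.ncard_insert_of_notMem (by simp) (Set.toFinite _), ← Set.image_univ,
    Set.ncard_image_of_injective _ Sum.inr_injective, Set.ncard_univ, Nat.card_fin] at h2
  omega

lemma GeneralPosition.sum_alphaBar_pos {I : NRM m n} (h : I.GeneralPosition) :
    0 < ∑ i, I.alphaBar i := by
  obtain ⟨j⟩ := I.nonempty_types
  obtain ⟨i, hi⟩ := I.bom_ne_zero j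
  have h1 := (h.rev_pos j).trans_le (I.rev_le_alphaBar_mul hi)
  have h2 : 0 < I.alphaBar i := pos_of_mul_pos_left h1 (I.bom_nonneg i j)
  exact h2.trans_le (Finset.single_le_sum (fun k _ => I.alphaBar_nonneg k) (Finset.mem_univ i))

lemma exists_pos_le_bom (I : NRM m n) :
    ∃ κ > 0, ∀ i j, I.bom i j ≠ 0 → κ ≤ I.bom i j := by
  have h : ∀ p : Fin m × Fin n, ∀ᶠ κ in 𝓝[>] (0 : ℝ), I.bom p.1 p.2 ≠ 0 → κ ≤ I.bom p.1 p.2 := by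
    intro p
    by_cases hp : I.bom p.1 p.2 = 0
    · simp [hp]
    · have hp' : 0 < I.bom p.1 p.2 := (I.bom_nonneg _ _).lt_of_ne' hp
      filter_upwards [nhdsWithin_le_nhds (eventually_le_nhds hp')] with κ hκ _ using hκ
  obtain ⟨κ, h1, h2⟩ := ((eventually_all.2 h).and self_mem_nhdsWithin).exists
  exact ⟨κ, h2, fun i j => h1 (i, j)⟩

/-! ### The bid-price interval -/

section Capacity

variable (I : NRM m n) {B : Fin m → ℝ}

lemma le_iSup_cap (B : Fin m → ℝ) (i : Fin m) : B i ≤ ⨆ i, B i :=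
  le_ciSup (Set.finite_range _).bddAbove i

lemma iInf_cap_le (B : Fin m → ℝ) (i : Fin m) : ⨅ i, B i ≤ B i :=
  ciInf_le (Set.finite_range _).bddBelow i

lemma iInf_cap_pos (I : NRM m n) (hB : ∀ i, 0 < B i) : 0 < ⨅ i, B i := by
  have := I.nonempty_resources
  obtain ⟨i, hi⟩ := exists_eq_ciInf_of_finite (f := B)
  rw [← hi]; exact hB i

lemma iSup_cap_pos (I : NRM m n) (hB : ∀ i, 0 < B i) : 0 < ⨆ i, B i := by
  obtain ⟨i⟩ := I.nonempty_resources
  exact (hB i).trans_le (le_iSup_cap B i)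

lemma one_le_capRatio (I : NRM m n) (hB : ∀ i, 0 < B i) : 1 ≤ (⨆ i, B i) / (⨅ i, B i) := by
  obtain ⟨i⟩ := I.nonempty_resources
  rw [one_le_div (I.iInf_cap_pos hB)]
  exact (iInf_cap_le B i).trans (le_iSup_cap B i)

lemma sum_alphaBar_nonneg : 0 ≤ ∑ i, I.alphaBar i :=
  Finset.sum_nonneg fun i _ => I.alphaBar_nonneg i

lemma sum_alphaBar_le_thetaBar (hB : ∀ i, 0 < B i) : ∑ i, I.alphaBar i ≤ I.thetaBar B :=
  le_mul_of_one_le_left I.sum_alphaBar_nonneg (I.one_le_capRatio hB)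

lemma thetaBar_nonneg (hB : ∀ i, 0 < B i) : 0 ≤ I.thetaBar B :=
  I.sum_alphaBar_nonneg.trans (I.sum_alphaBar_le_thetaBar hB)

variable {I} in
lemma GeneralPosition.thetaBar_pos (h : I.GeneralPosition) (hB : ∀ i, 0 < B i) :
    0 < I.thetaBar B :=
  h.sum_alphaBar_pos.trans_le (I.sum_alphaBar_le_thetaBar hB)

/-- This is what the factor max B / min B in θ̄ buys: at price θ̄, the capacity of whichever
resource runs out is worth at least everything that all capacities together could earn. -/
lemma sum_alphaBar_mul_le (hB : ∀ i, 0 < B i) (i : Fin m) :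
    ∑ k, I.alphaBar k * B k ≤ I.thetaBar B * B i := by
  have h1 : ∑ k, I.alphaBar k * B k ≤ (∑ k, I.alphaBar k) * ⨆ i, B i := by
    rw [Finset.sum_mul]
    exact Finset.sum_le_sum fun k _ =>
      mul_le_mul_of_nonneg_left (le_iSup_cap B k) (I.alphaBar_nonneg k)
  have h2 : (⨆ i, B i) ≤ (⨆ i, B i) / (⨅ i, B i) * B i := by
    rw [div_mul_eq_mul_div, le_div_iff₀ (I.iInf_cap_pos hB)]
    exact mul_le_mul_of_nonneg_left (iInf_cap_le B i) (I.iSup_cap_pos hB).le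
  calc _ ≤ _ := h1
    _ ≤ (∑ k, I.alphaBar k) * ((⨆ i, B i) / (⨅ i, B i) * B i) :=
        mul_le_mul_of_nonneg_left h2 I.sum_alphaBar_nonneg
    _ = _ := by rw [thetaBar]; ring

/-- Runs with capacity proportional to the rates therefore share one price interval, whatever their
length. -/
lemma thetaBar_smul {c : ℝ} (hc : 0 < c) :
    I.thetaBar (fun i => c * B i) = I.thetaBar B := by
  rw [thetaBar, thetaBar, ← Real.mul_iSup_of_nonneg hc.le, ← Real.mul_iInf_of_nonneg hc.le,
    mul_div_mul_left _ _ hc.ne']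

lemma gradBound_pos {L : ℝ} (hB : ∀ i, 0 < B i) (hL : 0 < L) : 0 < I.gradBound B L := by
  have := I.nonempty_resources
  have hm : (0 : ℝ) < √(m : ℝ) := Real.sqrt_pos.2 (by exact_mod_cast Fin.pos_iff_nonempty.2 this)
  have := I.iSup_cap_pos hB
  have := I.aBar_pos
  rw [gradBound]; positivity

lemma one_le_sqrt_card (I : NRM m n) : 1 ≤ √(m : ℝ) := by
  have := I.nonempty_resources
  rw [Real.one_le_sqrt]
  exact_mod_cast Fin.pos_iff_nonempty.2 this

lemma abs_grad_le {L : ℝ} (hB : ∀ i, 0 < B i) (hL : 0 < L) {y : ℝ} (hy : 0 ≤ y) (hy' : y ≤ 1)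
    (i : Fin m) (j : Fin n) : |B i / L - y * I.bom i j| ≤ I.gradBound B L := by
  have h1 : 0 ≤ B i / L := div_nonneg (hB i).le hL.le
  have h2 : 0 ≤ y * I.bom i j := mul_nonneg hy (I.bom_nonneg i j)
  have h3 : B i / L ≤ (⨆ i, B i) / L := by gcongr; exact le_iSup_cap B i
  have h4 : y * I.bom i j ≤ I.aBar :=
    (mul_le_of_le_one_left (I.bom_nonneg i j) hy').trans (I.bom_le_aBar i j)
  have h5 : (⨆ i, B i) / L ≤ (⨆ i, B i) / L * √(m : ℝ) :=
    le_mul_of_one_le_right (h1.trans h3) I.one_le_sqrt_card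
  have h6 : I.aBar ≤ I.aBar * √(m : ℝ) := le_mul_of_one_le_right I.aBar_pos.le I.one_le_sqrt_card
  rw [gradBound, abs_le]
  constructor <;> linarith

end Capacity

/-! ### Counting along a sequence of arrivals -/

/-- Weighted number of occurrences of type `j` among `k 0, …, k (s - 1)`. -/
noncomputable def acc (k : ℕ → Fin n) (y : ℕ → ℝ) (s : ℕ) (j : Fin n) : ℝ :=
  ∑ t ∈ Finset.range s, if k t = j then y t else 0

lemma sum_mul_acc (k : ℕ → Fin n) (y : ℕ → ℝ) (f : Fin n → ℝ) (s : ℕ) :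
    ∑ j, f j * acc k y s j = ∑ t ∈ Finset.range s, f (k t) * y t := by
  simp_rw [acc, Finset.mul_sum]
  rw [Finset.sum_comm]
  refine Finset.sum_congr rfl fun t _ => ?_
  rw [Finset.sum_eq_single (k t)] <;> simp +contextual [eq_comm]

lemma acc_mono {k : ℕ → Fin n} {y y' : ℕ → ℝ} {s : ℕ} (h : ∀ t < s, y t ≤ y' t) (j : Fin n) :
    acc k y s j ≤ acc k y' s j := by
  refine Finset.sum_le_sum fun t ht => ?_
  split_ifs
  exacts [h t (Finset.mem_range.1 ht), le_rfl]

lemma acc_nonneg {k : ℕ → Fin n} {y : ℕ → ℝ} {s : ℕ} (h : ∀ t < s, 0 ≤ y t) (j : Fin n) :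
    0 ≤ acc k y s j := by
  refine Finset.sum_nonneg fun t ht => ?_
  split_ifs
  exacts [h t (Finset.mem_range.1 ht), le_rfl]

lemma acc_congr {k : ℕ → Fin n} {y y' : ℕ → ℝ} {s : ℕ} {j : Fin n}
    (h : ∀ t < s, k t = j → y t = y' t) : acc k y s j = acc k y' s j := by
  refine Finset.sum_congr rfl fun t ht => ?_
  split_ifs with hj
  exacts [h t (Finset.mem_range.1 ht) hj, rfl]

/-! ### The fluid linear program -/

/-- Optimal primal and dual solutions of `max rev·x`, `bom x ≤ rate`, `0 ≤ x ≤ lam`, described by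
feasibility and complementary slackness; the prices are at most the largest revenues per unit. -/
structure OptPair (I : NRM m n) (x : Fin n → ℝ) (p : Fin m → ℝ) : Prop where
  nonneg : ∀ j, 0 ≤ x j
  le_lam : ∀ j, x j ≤ I.lam j
  feas : ∀ i, ∑ j, I.bom i j * x j ≤ I.rate i
  price_nonneg : ∀ i, 0 ≤ p i
  price_le : ∀ i, p i ≤ I.alphaBar i
  full : ∀ j, ∑ i, p i * I.bom i j < I.rev j → x j = I.lam j
  empty : ∀ j, I.rev j < ∑ i, p i * I.bom i j → x j = 0
  tight : ∀ i, 0 < p i → ∑ j, I.bom i j * x j = I.rate i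

/-- Lagrangian of the fluid linear program. -/
noncomputable def lagrangian (I : NRM m n) (p : Fin m → ℝ) (x : Fin n → ℝ) : ℝ :=
  ∑ j, I.rev j * x j + ∑ i, p i * (I.rate i - ∑ j, I.bom i j * x j)

lemma lagrangian_eq (I : NRM m n) (p : Fin m → ℝ) (x : Fin n → ℝ) :
    I.lagrangian p x =
      ∑ j, (I.rev j - ∑ i, p i * I.bom i j) * x j + ∑ i, p i * I.rate i := by
  have : ∑ i, p i * ∑ j, I.bom i j * x j = ∑ j, (∑ i, p i * I.bom i j) * x j := by
    simp_rw [Finset.mul_sum, Finset.sum_mul]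
    rw [Finset.sum_comm]
    simp_rw [mul_assoc]
  simp_rw [lagrangian, mul_sub, Finset.sum_sub_distrib, this, sub_mul, Finset.sum_sub_distrib]
  ring

lemma lagrangian_comb_left (I : NRM m n) (p q : Fin m → ℝ) (x : Fin n → ℝ) {a b : ℝ}
    (h : a + b = 1) :
    I.lagrangian (a • p + b • q) x = a * I.lagrangian p x + b * I.lagrangian q x := by
  have e : ∀ R : Fin m → ℝ, ∑ i, (a • p + b • q) i * R i
      = a * ∑ i, p i * R i + b * ∑ i, q i * R i := fun R => by
    simp [add_mul, mul_assoc, Finset.mul_sum, Finset.sum_add_distrib]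
  rw [lagrangian, e, lagrangian, lagrangian]
  linear_combination (-∑ j, I.rev j * x j) * h

lemma lagrangian_comb_right (I : NRM m n) (p : Fin m → ℝ) (x y : Fin n → ℝ) {a b : ℝ}
    (h : a + b = 1) :
    I.lagrangian p (a • x + b • y) = a * I.lagrangian p x + b * I.lagrangian p y := by
  have e : ∀ R : Fin n → ℝ, ∑ j, R j * (a • x + b • y) j
      = a * ∑ j, R j * x j + b * ∑ j, R j * y j := fun R => by
    simp [mul_add, mul_left_comm, Finset.mul_sum, Finset.sum_add_distrib]
  rw [lagrangian_eq, e, lagrangian_eq, lagrangian_eq]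
  linear_combination (-∑ i, p i * I.rate i) * h

/-- A saddle point of the Lagrangian on compact boxes exists by Sion's theorem. Testing it in one
coordinate at a time yields complementary slackness, and feasibility follows because the upper end
of the price box is never binding. -/
lemma exists_optPair (I : NRM m n) : ∃ x p, I.OptPair x p := by
  -- The extra unit puts the artificial upper end strictly above `alphaBar`, where no type wants the
  -- resource any more.
  let X : Set (Fin m → ℝ) := Set.Icc 0 (fun i => I.alphaBar i + 1)
  let Y : Set (Fin n → ℝ) := Set.Icc 0 I.lam
  have hX0 : (0 : Fin m → ℝ) ∈ X :=
    ⟨le_rfl, fun i => by simpa using add_nonneg (I.alphaBar_nonneg i) zero_le_one⟩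
  have hY0 : (0 : Fin n → ℝ) ∈ Y := ⟨le_rfl, fun j => I.lam_nonneg j⟩
  obtain ⟨p, hp, x, hx, hs⟩ := Sion.exists_isSaddlePointOn (X := X) (Y := Y) (f := I.lagrangian)
    ⟨0, hX0⟩ (convex_Icc _ _) isCompact_Icc
    (fun y _ => (by unfold lagrangian; fun_prop :
      Continuous fun p => I.lagrangian p y).lowerSemicontinuous.lowerSemicontinuousOn _)
    (fun y _ => ConvexOn.quasiconvexOn ⟨convex_Icc _ _, fun p _ q _ a b _ _ hab =>
      (I.lagrangian_comb_left p q y hab).le⟩)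
    (convex_Icc _ _) ⟨0, hY0⟩ isCompact_Icc
    (fun p _ => (by unfold lagrangian; fun_prop :
      Continuous fun y => I.lagrangian p y).upperSemicontinuous.upperSemicontinuousOn _)
    (fun p _ => ConcaveOn.quasiconcaveOn ⟨convex_Icc _ _, fun x _ y _ a b _ _ hab =>
      (I.lagrangian_comb_right p x y hab).ge⟩)
  have hxmax : ∀ j v, 0 ≤ v → v ≤ I.lam j →
      (I.rev j - ∑ i, p i * I.bom i j) * v ≤ (I.rev j - ∑ i, p i * I.bom i j) * x j := by
    intro j v hv hv'
    have h1 := hs p hp (Function.update x j v) ⟨fun k => by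
      by_cases hk : k = j
      · subst hk; simpa using hv
      · simpa [hk] using hx.1 k, fun k => by
      by_cases hk : k = j
      · subst hk; simpa using hv'
      · simpa [hk] using hx.2 k⟩
    rw [lagrangian_eq, lagrangian_eq, add_le_add_iff_right,
      ← Finset.add_sum_erase _ _ (Finset.mem_univ j),
      ← Finset.add_sum_erase _ _ (Finset.mem_univ j)] at h1
    rw [Finset.sum_congr rfl (g := fun k => (I.rev k - ∑ i, p i * I.bom i k) * x k)
      (fun k hk => by rw [Function.update_of_ne (Finset.ne_of_mem_erase hk)])] at h1
    rw [Function.update_self] at h1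
    linarith
  have hpmin : ∀ i v, 0 ≤ v → v ≤ I.alphaBar i + 1 →
      p i * (I.rate i - ∑ j, I.bom i j * x j) ≤ v * (I.rate i - ∑ j, I.bom i j * x j) := by
    intro i v hv hv'
    have h1 := hs (Function.update p i v) ⟨fun k => by
      by_cases hk : k = i
      · subst hk; simpa using hv
      · simpa [hk] using hp.1 k, fun k => by
      by_cases hk : k = i
      · subst hk; simpa using hv'
      · simpa [hk] using hp.2 k⟩ x hx
    rw [lagrangian, lagrangian, add_le_add_iff_left,
      ← Finset.add_sum_erase _ _ (Finset.mem_univ i),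
      ← Finset.add_sum_erase _ _ (Finset.mem_univ i)] at h1
    rw [Finset.sum_congr rfl (s₁ := Finset.univ.erase i)
      (f := fun k => Function.update p i v k * (I.rate k - ∑ j, I.bom k j * x j))
      (g := fun k => p k * (I.rate k - ∑ j, I.bom k j * x j))
      (fun k hk => by rw [Function.update_of_ne (Finset.ne_of_mem_erase hk)])] at h1
    rw [Function.update_self] at h1
    linarith
  have hp0 : ∀ i, 0 ≤ p i := fun i => hp.1 i
  have hx0 : ∀ j, 0 ≤ x j := fun j => hx.1 j
  have hempty : ∀ j, I.rev j < ∑ i, p i * I.bom i j → x j = 0 := by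
    intro j hj
    have h1 := hxmax j 0 le_rfl (I.lam_nonneg j)
    have h2 := hx0 j
    nlinarith
  -- Above `alphaBar i`, resource i alone costs each of its users more than the revenue, so all of
  -- them are rejected.
  have hunused : ∀ i, I.alphaBar i < p i → ∑ j, I.bom i j * x j = 0 := by
    intro i hi
    refine Finset.sum_eq_zero fun j _ => ?_
    by_cases hj : I.bom i j = 0
    · simp [hj]
    rw [hempty j, mul_zero]
    have h3 : 0 < I.bom i j := (I.bom_nonneg i j).lt_of_ne' hj
    calc I.rev j ≤ I.alphaBar i * I.bom i j := I.rev_le_alphaBar_mul hj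
      _ < p i * I.bom i j := by gcongr
      _ ≤ _ := Finset.single_le_sum (f := fun i => p i * I.bom i j)
        (fun k _ => mul_nonneg (hp0 k) (I.bom_nonneg k j)) (Finset.mem_univ i)
  -- Overuse would push the minimising price to the top of the box, where the resource is not used
  -- at all.
  have hfeas : ∀ i, ∑ j, I.bom i j * x j ≤ I.rate i := by
    intro i
    by_contra! hlt
    have h1 := hpmin i (I.alphaBar i + 1) (by linarith [I.alphaBar_nonneg i]) le_rfl
    have h2 : I.alphaBar i + 1 ≤ p i := by nlinarith
    have h3 := hunused i (by linarith)
    have h4 := I.rate_pos i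
    linarith
  refine ⟨x, p, hx0, fun j => hx.2 j, hfeas, hp0, ?_, ?_, hempty, ?_⟩
  -- An unused resource has slack equal to its positive rate, so lowering its price to zero would
  -- strictly decrease the Lagrangian.
  · intro i
    by_contra! hlt
    have h3 := hunused i hlt
    have h1 := hpmin i 0 le_rfl (by linarith [I.alphaBar_nonneg i])
    rw [h3] at h1
    have := mul_pos ((I.alphaBar_nonneg i).trans_lt hlt) (I.rate_pos i)
    linarith
  · intro j hj
    have h1 := hxmax j _ (I.lam_nonneg j) le_rfl
    have h2 : x j ≤ I.lam j := hx.2 j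
    nlinarith
  · intro i hi
    have h1 := hpmin i 0 le_rfl (by linarith [I.alphaBar_nonneg i])
    have h2 := hfeas i
    nlinarith

/-! ### General position gives independent active constraints -/

/-- Columns of the matrix `[bom, 1]`. -/
def column (I : NRM m n) : Fin n ⊕ Fin m → Fin m → ℝ :=
  Sum.elim (fun j i => I.bom i j) fun i => Pi.single i 1

/-- Indices of the equations `p·A_j = rev j`, `p i = 0` satisfied by `p`. -/
def activeSet (I : NRM m n) (p : Fin m → ℝ) : Set (Fin n ⊕ Fin m) :=
  {l | ∑ i, p i * I.column l i = Sum.elim I.rev (fun _ => 0) l}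

lemma GeneralPosition.ncard_activeSet_le {I : NRM m n} (h : I.GeneralPosition) (p : Fin m → ℝ) :
    (I.activeSet p).ncard ≤ m := by
  convert h p using 3
  ext l
  simp only [activeSet, Set.mem_ofPred_eq]
  rcases l with j | i
  · simp [column, Matrix.vecMul, dotProduct]
  · simp [column, Matrix.vecMul, dotProduct, Matrix.one_apply, Pi.single_apply]

lemma span_range_column (I : NRM m n) : Submodule.span ℝ (Set.range I.column) = ⊤ := by
  rw [eq_top_iff, ← (Pi.basisFun ℝ (Fin m)).span_eq]
  refine Submodule.span_mono ?_
  rintro _ ⟨i, rfl⟩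
  exact ⟨Sum.inr i, by simp [column]⟩

/-- Extend a maximal independent set of active columns to a basis and let q solve the m equations of
that basis. Then q satisfies these m equations and also all those active at p. As at most m can
hold, the active columns already belong to the basis. -/
lemma GeneralPosition.linearIndepOn {I : NRM m n} (h : I.GeneralPosition) (p : Fin m → ℝ) :
    LinearIndepOn ℝ I.column (I.activeSet p) := by
  obtain ⟨B, hBS, -, hspan, hB⟩ :=
    exists_linearIndepOn_extension (linearIndepOn_empty ℝ I.column)
      (Set.empty_subset (I.activeSet p))
  obtain ⟨B', -, hBB', hspan', hB'⟩ :=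
    exists_linearIndepOn_extension hB (Set.subset_univ B)
  have htop : ⊤ ≤ Submodule.span ℝ (Set.range fun l : B' => I.column l) := by
    have h1 : (Set.range fun l : B' => I.column l) = I.column '' B' := by
      ext; simp
    rw [h1, ← I.span_range_column, Submodule.span_le, ← Set.image_univ]
    exact hspan'
  let b : Module.Basis B' ℝ (Fin m → ℝ) := Module.Basis.mk hB' htop
  have hcard : B'.ncard = m := by
    have h1 := Module.finrank_eq_nat_card_basis b
    rw [Module.finrank_fin_fun] at h1
    exact h1.symm
  -- The linear functional prescribed on the basis columns; its values on the unit vectors form the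
  -- price vector q.
  let φ : (Fin m → ℝ) →ₗ[ℝ] ℝ := b.constr ℝ fun l => Sum.elim I.rev (fun _ => 0) (l : Fin n ⊕ Fin m)
  let q : Fin m → ℝ := fun i => φ (Pi.single i 1)
  have hφq : ∀ w, φ w = ∑ i, q i * w i := by
    intro w
    conv_lhs => rw [← Finset.univ_sum_single w]
    rw [map_sum]
    refine Finset.sum_congr rfl fun i _ => ?_
    rw [show Pi.single i (w i) = w i • (Pi.single i (1 : ℝ) : Fin m → ℝ) by
      rw [← Pi.single_smul, smul_eq_mul, mul_one], map_smul, smul_eq_mul, mul_comm]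
  have hφB' : ∀ l ∈ B', φ (I.column l) = Sum.elim I.rev (fun _ => 0) l := by
    intro l hl
    have : I.column l = b ⟨l, hl⟩ := (Module.Basis.mk_apply hB' htop ⟨l, hl⟩).symm
    rw [this, Module.Basis.constr_basis]
  let ψ : (Fin m → ℝ) →ₗ[ℝ] ℝ := ∑ i, p i • LinearMap.proj i
  have hψ : ∀ w, ψ w = ∑ i, p i * w i := fun w => by simp [ψ]
  -- The columns indexed by B span all columns active at p, so p and q give the same value to each
  -- of these.
  have heq : ∀ w ∈ Submodule.span ℝ (I.column '' B), φ w = ψ w := by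
    intro w hw
    induction hw using Submodule.span_induction with
    | mem w hw =>
      obtain ⟨l, hl, rfl⟩ := hw
      rw [hφB' l (hBB' hl), hψ]
      exact (hBS hl).symm
    | zero => simp
    | add x y _ _ hx hy => rw [map_add, map_add, hx, hy]
    | smul a x _ hx => rw [map_smul, map_smul, hx]
  have hsub : I.activeSet p ∪ B' ⊆ I.activeSet q := by
    rintro l (hl | hl)
    · have h1 := heq _ (hspan ⟨l, hl, rfl⟩)
      rw [hφq, hψ] at h1
      rw [activeSet, Set.mem_ofPred_eq, h1]
      exact hl
    · rw [activeSet, Set.mem_ofPred_eq, ← hφq]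
      exact hφB' l hl
  have hle := (Set.ncard_le_ncard hsub (Set.toFinite _)).trans (h.ncard_activeSet_le q)
  have hunion : I.activeSet p ∪ B' = B' := by
    refine (Set.eq_of_subset_of_ncard_le Set.subset_union_right ?_ (Set.toFinite _)).symm
    rw [hcard]; exact hle
  exact hB'.mono (Set.union_eq_right.1 hunion)

/-- Writing Ay as a combination of columns A_j and as a combination of unit vectors gives a linear
relation among the columns of [A, Id]; the hypotheses say that only active columns occur in it. -/
lemma GeneralPosition.eq_zero_of_active {I : NRM m n} (h : I.GeneralPosition) (p : Fin m → ℝ)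
    (y : Fin n → ℝ) (h1 : ∀ j, ∑ i, p i * I.bom i j ≠ I.rev j → y j = 0)
    (h2 : ∀ i, p i ≠ 0 → ∑ j, I.bom i j * y j = 0) : y = 0 := by
  classical
  have hli := h.linearIndepOn p
  rw [linearIndepOn_iff] at hli
  let g : Fin n ⊕ Fin m → ℝ := Sum.elim y fun i => -∑ j, I.bom i j * y j
  have hg := hli (Finsupp.equivFunOnFinite.symm g) ?_ ?_
  · funext j
    have := DFunLike.congr_fun hg (Sum.inl j)
    simpa [g] using this
  · rw [Finsupp.mem_supported]
    intro l hl
    have hl' : g l ≠ 0 := by simpa using hl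
    rcases l with j | i
    · by_contra hj
      refine hl' (h1 j fun h3 => hj ?_)
      simpa [activeSet, column] using h3
    · by_contra hj
      refine hl' ?_
      have : ∑ j, I.bom i j * y j = 0 := h2 i fun h3 => hj (by
        simp [activeSet, column, h3, Pi.single_apply])
      simp [g, this]
  · rw [Finsupp.linearCombination_apply, Finsupp.sum_fintype _ _ (by simp)]
    funext i
    simp [g, column, Finset.sum_apply, Pi.single_apply, mul_comm]

/-- Reduced revenue of type `j` at prices `p`. -/
noncomputable def reduced (I : NRM m n) (p : Fin m → ℝ) (j : Fin n) : ℝ :=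
  I.rev j - ∑ i, p i * I.bom i j

/-- Quantitative form of `eq_zero_of_active`: an injective linear map between finite-dimensional
spaces is bounded below. -/
lemma GeneralPosition.exists_stability {I : NRM m n} (h : I.GeneralPosition) (p : Fin m → ℝ) :
    ∃ K > 0, ∀ (y : Fin n → ℝ) (E : ℝ), 0 ≤ E → (∀ j, I.reduced p j ≠ 0 → |y j| ≤ E) →
      (∀ i, p i ≠ 0 → |∑ j, I.bom i j * y j| ≤ E) → ∀ j, |y j| ≤ K * E := by
  classical
  let Φ : (Fin n → ℝ) →ₗ[ℝ] (Fin n → ℝ) × (Fin m → ℝ) :=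
    { toFun := fun y => (fun j => if I.reduced p j = 0 then 0 else y j,
        fun i => if p i = 0 then 0 else ∑ j, I.bom i j * y j)
      map_add' := by
        intro x y
        ext k
        · simp only [Pi.add_apply, Prod.mk_add_mk]; split_ifs <;> simp
        · simp only [Pi.add_apply, Prod.mk_add_mk, mul_add, Finset.sum_add_distrib]
          split_ifs <;> simp
      map_smul' := by
        intro c y
        ext k
        · simp
        · simp only [Pi.smul_apply, smul_eq_mul, mul_left_comm _ c, ← Finset.mul_sum,
            RingHom.id_apply, Prod.smul_mk, mul_ite, mul_zero] }
  have hker : LinearMap.ker Φ = ⊥ := by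
    rw [LinearMap.ker_eq_bot']
    intro y hy
    have hy1 := congrArg Prod.fst hy
    have hy2 := congrArg Prod.snd hy
    refine h.eq_zero_of_active p y (fun j hj => ?_) fun i hi => ?_
    · have := congrFun hy1 j
      have hne : I.reduced p j ≠ 0 := fun h0 => hj (by rw [reduced] at h0; linarith)
      simpa [Φ, hne] using this
    · have := congrFun hy2 i
      simpa [Φ, hi] using this
  obtain ⟨K, hK, hanti⟩ := Φ.exists_antilipschitzWith hker
  refine ⟨K, hK, fun y E hE h1 h2 j => ?_⟩
  have h3 : ‖y‖ ≤ K * ‖Φ y‖ := by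
    simpa [dist_eq_norm] using hanti.le_mul_dist y 0
  have h4 : ‖Φ y‖ ≤ E := by
    refine max_le ((pi_norm_le_iff_of_nonneg hE).2 fun j => ?_)
      ((pi_norm_le_iff_of_nonneg hE).2 fun i => ?_)
    · by_cases hj : I.reduced p j = 0
      · simpa [Φ, hj] using hE
      · simpa [Φ, hj] using h1 j hj
    · by_cases hi : p i = 0
      · simpa [Φ, hi] using hE
      · simpa [Φ, hi] using h2 i hi
  exact (norm_le_pi_norm y j).trans (h3.trans (by gcongr))

/-! ### Near-optimal solutions are close to the optimal one -/

lemma sum_rev_mul_eq (I : NRM m n) (p : Fin m → ℝ) (x : Fin n → ℝ) :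
    ∑ j, I.rev j * x j = ∑ j, I.reduced p j * x j + ∑ i, p i * ∑ j, I.bom i j * x j := by
  have : ∑ i, p i * ∑ j, I.bom i j * x j = ∑ j, (∑ i, p i * I.bom i j) * x j := by
    simp_rw [Finset.mul_sum, Finset.sum_mul]
    rw [Finset.sum_comm]
    simp_rw [mul_assoc]
  rw [this, ← Finset.sum_add_distrib]
  exact Finset.sum_congr rfl fun j _ => by rw [reduced]; ring

/-- Complementary slackness turns the revenue gap into reduced-cost terms and priced slacks, with no
inequality lost; x need not be feasible. -/
lemma OptPair.gap_eq {I : NRM m n} {xs : Fin n → ℝ} {p : Fin m → ℝ} (h : I.OptPair xs p)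
    (s : ℝ) (x : Fin n → ℝ) :
    s * ∑ j, I.rev j * xs j - ∑ j, I.rev j * x j =
      ∑ j, I.reduced p j * (s * xs j - x j)
        + ∑ i, p i * (s * I.rate i - ∑ j, I.bom i j * x j) := by
  have h1 : ∑ i, p i * ∑ j, I.bom i j * xs j = ∑ i, p i * I.rate i := by
    refine Finset.sum_congr rfl fun i _ => ?_
    rcases (h.price_nonneg i).eq_or_lt with h0 | h0
    · simp [← h0]
    · rw [h.tight i h0]
  rw [I.sum_rev_mul_eq p xs, I.sum_rev_mul_eq p x, h1, mul_add, Finset.mul_sum, Finset.mul_sum]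
  simp_rw [mul_sub, Finset.sum_sub_distrib, mul_left_comm s]
  ring

/-- By complementary slackness x* sits at the end of [0, λ_j] favoured by the sign of the reduced
revenue, so only an excess of x over the upper bound can make the term negative. -/
lemma OptPair.reduced_mul_ge {I : NRM m n} {xs : Fin n → ℝ} {p : Fin m → ℝ} (h : I.OptPair xs p)
    {s E : ℝ} {x : Fin n → ℝ} (hE : 0 ≤ E) {j : Fin n} (hx : 0 ≤ x j)
    (hx' : x j ≤ s * I.lam j + E) :
    0 ≤ I.reduced p j * (s * xs j - x j) + |I.reduced p j| * E := by
  rcases lt_trichotomy (I.reduced p j) 0 with hd | hd | hd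
  · rw [h.empty j (by rw [reduced] at hd; linarith), abs_of_neg hd]
    nlinarith
  · simp [hd]
  · rw [h.full j (by rw [reduced] at hd; linarith), abs_of_pos hd]
    nlinarith

/-- After a shift by |reduced| E all terms of the gap are nonnegative, so each is O(E) on its own.
This controls precisely the coordinates needed in `exists_stability`. The weights c stay free:
applications use p itself, or the distance of p from both ends of the price interval. -/
lemma OptPair.exists_dist_le {I : NRM m n} {xs : Fin n → ℝ} {p : Fin m → ℝ} (h : I.OptPair xs p)
    (hgp : I.GeneralPosition) {c : Fin m → ℝ} (hc0 : ∀ i, 0 ≤ c i) (hc : ∀ i, p i ≠ 0 → 0 < c i) :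
    ∃ K > 0, ∀ (x : Fin n → ℝ) (s E : ℝ), 0 ≤ E → (∀ j, 0 ≤ x j) →
      (∀ j, x j ≤ s * I.lam j + E) →
      ∑ j, I.reduced p j * (s * xs j - x j)
        + ∑ i, c i * |s * I.rate i - ∑ j, I.bom i j * x j| ≤ E →
      ∀ j, |x j - s * xs j| ≤ K * E := by
  obtain ⟨K, hK, hstab⟩ := hgp.exists_stability p
  -- D E bounds the gap plus all shifts; dividing it by the nonzero reduced revenues and weights
  -- gives the coordinate bounds collected in K₀.
  set D : ℝ := 1 + ∑ j, |I.reduced p j| with hD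
  have hDpos : 0 < D := by positivity
  set K₀ : ℝ := 1 + ∑ j, D / |I.reduced p j| + ∑ i, D / c i with hK₀
  have hs1 : 0 ≤ ∑ j, D / |I.reduced p j| := Finset.sum_nonneg fun j _ => by positivity
  have hs2 : 0 ≤ ∑ i, D / c i := Finset.sum_nonneg fun i _ => div_nonneg hDpos.le (hc0 i)
  have hK1 : 0 < K₀ := by positivity
  refine ⟨K * K₀, by positivity, fun x s E hE hx hx' hgap => ?_⟩
  have hterm : ∀ j, 0 ≤ I.reduced p j * (s * xs j - x j) + |I.reduced p j| * E :=
    fun j => h.reduced_mul_ge hE (hx j) (hx' j)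
  have htot : ∑ j, (I.reduced p j * (s * xs j - x j) + |I.reduced p j| * E)
      + ∑ i, c i * |s * I.rate i - ∑ j, I.bom i j * x j| ≤ D * E := by
    rw [Finset.sum_add_distrib, ← Finset.sum_mul, hD]
    linarith
  have hci : ∀ i, 0 ≤ c i * |s * I.rate i - ∑ j, I.bom i j * x j| :=
    fun i => mul_nonneg (hc0 i) (abs_nonneg _)
  have hj : ∀ j, I.reduced p j * (s * xs j - x j) + |I.reduced p j| * E ≤ D * E := fun j =>
    (Finset.single_le_sum (fun k _ => hterm k) (Finset.mem_univ j)).trans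
      (by linarith [Finset.sum_nonneg fun i (_ : i ∈ Finset.univ) => hci i])
  have hi : ∀ i, c i * |s * I.rate i - ∑ j, I.bom i j * x j| ≤ D * E := fun i =>
    (Finset.single_le_sum (fun k _ => hci k) (Finset.mem_univ i)).trans
      (by linarith [Finset.sum_nonneg fun j (_ : j ∈ Finset.univ) => hterm j])
  have hKj : ∀ j, D / |I.reduced p j| ≤ K₀ - 1 := fun j => by
    have := Finset.single_le_sum (f := fun j => D / |I.reduced p j|)
      (fun k _ => by positivity) (Finset.mem_univ j)
    linarith
  have hKi : ∀ i, D / c i ≤ K₀ := fun i => by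
    have := Finset.single_le_sum (f := fun i => D / c i)
      (fun k _ => div_nonneg hDpos.le (hc0 k)) (Finset.mem_univ i)
    linarith
  have key := hstab (fun j => x j - s * xs j) (K₀ * E) (by positivity) ?_ ?_
  · intro j
    rw [mul_assoc]
    exact key j
  · intro j hd
    have h1 : D / |I.reduced p j| * E ≤ (K₀ - 1) * E := by gcongr; exact hKj j
    have h2 : 0 < |I.reduced p j| := abs_pos.2 hd
    have h0 : 0 ≤ D / |I.reduced p j| * E := by positivity
    rw [div_mul_eq_mul_div] at h1 h0
    rcases lt_or_gt_of_ne hd with hd' | hd'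
    · have he := h.empty j (by rw [reduced] at hd'; linarith)
      have h3 := hj j
      have h4 : |I.reduced p j| * (x j) ≤ D * E := by
        rw [he] at h3
        rw [abs_of_neg hd'] at h3 ⊢
        nlinarith
      have h5 : x j ≤ D * E / |I.reduced p j| := by
        rw [le_div_iff₀ h2]; linarith
      simp only [he, mul_zero, sub_zero, abs_of_nonneg (hx j)]
      linarith
    · have he := h.full j (by rw [reduced] at hd'; linarith)
      have h3 := hj j
      have h4 : |I.reduced p j| * (s * I.lam j - x j) ≤ D * E := by
        rw [he] at h3
        rw [abs_of_pos hd'] at h3 ⊢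
        nlinarith
      have h5 : s * I.lam j - x j ≤ D * E / |I.reduced p j| := by
        rw [le_div_iff₀ h2]; linarith
      have h6 := hx' j
      simp only [he, abs_le]
      constructor <;> linarith
  · intro i hp
    have h1 : |s * I.rate i - ∑ j, I.bom i j * x j| ≤ K₀ * E := by
      have h2 : |s * I.rate i - ∑ j, I.bom i j * x j| ≤ D * E / c i := by
        rw [le_div_iff₀ (hc i hp)]; linarith [hi i]
      rw [mul_div_right_comm] at h2
      exact h2.trans (by gcongr; exact hKi i)
    have h2 : ∑ j, I.bom i j * (x j - s * xs j)
        = -(s * I.rate i - ∑ j, I.bom i j * x j) := by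
      rw [← h.tight i ((h.price_nonneg i).lt_of_ne' hp)]
      simp_rw [mul_sub, Finset.sum_sub_distrib, Finset.mul_sum, mul_left_comm]
      ring
    rw [h2, abs_neg]
    exact h1

/-- The situation in which the largest admissible bid price is the only optimal dual price: a
single resource is used, one type is accepted in part and all others are rejected. -/
structure SingleResource (I : NRM m n) (xs : Fin n → ℝ) (p : Fin m → ℝ) (i₀ : Fin m)
    (j₀ : Fin n) : Prop where
  opt : I.OptPair xs p
  unused : ∀ i, i ≠ i₀ → ∀ j, I.bom i j = 0
  price_eq_zero : ∀ i, i ≠ i₀ → p i = 0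
  price_pos : 0 < p i₀
  bom_pos : 0 < I.bom i₀ j₀
  rev_eq : I.rev j₀ = p i₀ * I.bom i₀ j₀
  rev_lt : ∀ j, j ≠ j₀ → I.rev j < p i₀ * I.bom i₀ j
  partly : xs j₀ < I.lam j₀

lemma OptPair.single_sum {p : Fin m → ℝ} {i₀ : Fin m} (h0 : ∀ i, i ≠ i₀ → p i = 0)
    (f : Fin m → ℝ) : ∑ i, p i * f i = p i₀ * f i₀ :=
  Finset.sum_eq_single i₀ (fun i _ hi => by rw [h0 i hi, zero_mul])
    fun h => absurd (Finset.mem_univ _) h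

/-- The corner argument needs every dual price strictly below θ̄. If some price reaches θ̄, the
bound p i₀ ≤ `alphaBar i₀` and θ̄ ≥ Σ `alphaBar` leave no value for the other resources. -/
lemma GeneralPosition.exists_optPair_cases {I : NRM m n} (hgp : I.GeneralPosition) :
    (∃ xs p, I.OptPair xs p ∧ ∀ i, p i < I.thetaBar I.rate) ∨
      ∃ xs p i₀ j₀, I.SingleResource xs p i₀ j₀ := by
  obtain ⟨xs, p, h⟩ := I.exists_optPair
  by_cases hall : ∀ i, p i < I.thetaBar I.rate
  · exact Or.inl ⟨xs, p, h, hall⟩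
  push Not at hall
  obtain ⟨i₀, hi₀⟩ := hall
  have hθ := I.sum_alphaBar_le_thetaBar I.rate_pos
  have hsum : I.alphaBar i₀ + ∑ i ∈ Finset.univ.erase i₀, I.alphaBar i = ∑ i, I.alphaBar i :=
    Finset.add_sum_erase _ _ (Finset.mem_univ i₀)
  have hple := h.price_le i₀
  -- Squeeze: Σ `alphaBar` ≤ θ̄ ≤ p i₀ ≤ `alphaBar i₀`.
  have hrest : ∀ i ∈ Finset.univ.erase i₀, I.alphaBar i = 0 := by
    rw [← Finset.sum_eq_zero_iff_of_nonneg fun i _ => I.alphaBar_nonneg i]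
    refine le_antisymm (by linarith) (Finset.sum_nonneg fun i _ => I.alphaBar_nonneg i)
  have hα0 : ∀ i, i ≠ i₀ → I.alphaBar i = 0 := fun i hi =>
    hrest i (Finset.mem_erase.2 ⟨hi, Finset.mem_univ i⟩)
  have hp0 : ∀ i, i ≠ i₀ → p i = 0 := fun i hi =>
    le_antisymm ((h.price_le i).trans_eq (hα0 i hi)) (h.price_nonneg i)
  have hunused : ∀ i, i ≠ i₀ → ∀ j, I.bom i j = 0 := by
    intro i hi j
    by_contra hb
    have h1 := I.rev_le_alphaBar_mul hb
    rw [hα0 i hi, zero_mul] at h1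
    exact absurd (hgp.rev_pos j) h1.not_gt
  have hθpos : 0 < I.thetaBar I.rate := hgp.thetaBar_pos I.rate_pos
  have hppos : 0 < p i₀ := hθpos.trans_le hi₀
  have hpα : p i₀ = I.alphaBar i₀ := by
    have : ∑ i ∈ Finset.univ.erase i₀, I.alphaBar i = 0 := Finset.sum_eq_zero hrest
    linarith
  have hused : ∀ j, I.bom i₀ j ≠ 0 := by
    intro j hj
    obtain ⟨i, hi⟩ := I.bom_ne_zero j
    by_cases hii : i = i₀
    · exact hi (hii ▸ hj)
    · exact hi (hunused i hii j)
  have hrevle : ∀ j, I.rev j ≤ p i₀ * I.bom i₀ j := fun j => by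
    rw [hpα]; exact I.rev_le_alphaBar_mul (hused j)
  have hps : ∀ j, ∑ i, p i * I.bom i j = p i₀ * I.bom i₀ j := fun j =>
    OptPair.single_sum hp0 fun i => I.bom i j
  have htight := h.tight i₀ hppos
  -- some type is accepted
  obtain ⟨j₀, hj₀⟩ : ∃ j, xs j ≠ 0 := by
    by_contra! hx
    rw [Finset.sum_eq_zero (fun j _ => by rw [hx j, mul_zero])] at htight
    exact (I.rate_pos i₀).ne htight
  have hrev0 : I.rev j₀ = p i₀ * I.bom i₀ j₀ := by
    refine le_antisymm (hrevle j₀) ?_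
    by_contra! hlt
    exact hj₀ (h.empty j₀ (by rw [hps]; exact hlt))
  have hrevlt : ∀ j, j ≠ j₀ → I.rev j < p i₀ * I.bom i₀ j := by
    intro j hj
    refine (hrevle j).lt_of_ne fun heq => ?_
    -- If j and j₀ both had reduced revenue zero, trading one against the other at constant use of
    -- i₀ would be a nonzero direction supported on active columns.
    have hz := hgp.eq_zero_of_active p
      (Pi.single j (I.bom i₀ j₀) - Pi.single j₀ (I.bom i₀ j)) ?_ ?_
    · have := congrFun hz j
      simp [hj, hused j₀] at this
    · intro k hk
      have hkj : k ≠ j := fun e => hk (by rw [hps, e, heq])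
      have hkj₀ : k ≠ j₀ := fun e => hk (by rw [hps, e, hrev0])
      simp [hkj, hkj₀]
    · intro i hi
      have : i = i₀ := by
        by_contra hne; exact hi (hp0 i hne)
      subst this
      simp [Pi.single_apply, sub_mul, Finset.sum_sub_distrib, mul_comm]
  by_cases hfull : xs j₀ < I.lam j₀
  · exact Or.inr ⟨xs, p, i₀, j₀, h, hunused, hp0, hppos,
      (I.bom_nonneg i₀ j₀).lt_of_ne' (hused j₀), hrev0, hrevlt, hfull⟩
  -- otherwise a slightly smaller price is optimal too
  have hxfull : xs j₀ = I.lam j₀ := le_antisymm (h.le_lam j₀) (not_lt.1 hfull)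
  left
  have hev : ∀ᶠ q in 𝓝[<] (p i₀), 0 < q ∧ ∀ j, j ≠ j₀ → I.rev j < q * I.bom i₀ j := by
    refine nhdsWithin_le_nhds ((eventually_gt_nhds hppos).and (eventually_all.2 fun j => ?_))
    by_cases hj : j = j₀
    · simp [hj]
    · have : Tendsto (fun q => q * I.bom i₀ j) (𝓝 (p i₀)) (𝓝 (p i₀ * I.bom i₀ j)) :=
        (continuous_id.mul continuous_const).tendsto _
      filter_upwards [this.eventually_const_lt (hrevlt j hj)] with q hq _ using hq
  obtain ⟨q, ⟨hq0, hq⟩, hqlt⟩ := (hev.and self_mem_nhdsWithin).exists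
  have hqlt : q < p i₀ := hqlt
  have hne : ∀ i, i ≠ i₀ → (Pi.single i₀ q : Fin m → ℝ) i = 0 := fun i hi => by simp [hi]
  have hqs : ∀ j, ∑ i, (Pi.single i₀ q : Fin m → ℝ) i * I.bom i j = q * I.bom i₀ j := fun j => by
    rw [OptPair.single_sum hne fun i => I.bom i j, Pi.single_eq_same]
  refine ⟨xs, Pi.single i₀ q, ⟨h.nonneg, h.le_lam, h.feas, ?_, ?_, ?_, ?_, ?_⟩, ?_⟩
  · intro i
    by_cases hi : i = i₀
    · subst hi; simpa using hq0.le
    · simp [hi]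
  · intro i
    by_cases hi : i = i₀
    · subst hi; simpa using hqlt.le.trans hple
    · simpa [hi] using I.alphaBar_nonneg i
  · intro j hj
    rw [hqs] at hj
    by_cases hjj : j = j₀
    · rw [hjj, hxfull]
    · exact absurd hj (hq j hjj).not_gt
  · intro j hj
    rw [hqs] at hj
    by_cases hjj : j = j₀
    · rw [hjj, hrev0] at hj
      have := mul_lt_mul_of_pos_right hqlt ((I.bom_nonneg i₀ j₀).lt_of_ne' (hused j₀))
      exact absurd hj this.not_gt
    · exact h.empty j (by rw [hps]; exact hrevlt j hjj)
  · intro i hi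
    by_cases hii : i = i₀
    · rw [hii]; exact htight
    · simp [hii] at hi
  · intro i
    by_cases hi : i = i₀
    · subst hi; simp only [Pi.single_eq_same]; linarith [Finset.sum_eq_zero hrest]
    · simpa [hi] using hθpos

lemma SingleResource.xs_eq_zero {I : NRM m n} {xs : Fin n → ℝ} {p : Fin m → ℝ} {i₀ : Fin m}
    {j₀ : Fin n} (h : I.SingleResource xs p i₀ j₀) {j : Fin n} (hj : j ≠ j₀) : xs j = 0 :=
  h.opt.empty j (by
    rw [OptPair.single_sum h.price_eq_zero fun i => I.bom i j]; exact h.rev_lt j hj)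

lemma SingleResource.bom_mul_xs {I : NRM m n} {xs : Fin n → ℝ} {p : Fin m → ℝ} {i₀ : Fin m}
    {j₀ : Fin n} (h : I.SingleResource xs p i₀ j₀) : I.bom i₀ j₀ * xs j₀ = I.rate i₀ := by
  rw [← h.opt.tight i₀ h.price_pos]
  rw [Finset.sum_eq_single j₀ (fun j _ hj => by rw [h.xs_eq_zero hj, mul_zero])
    fun h => absurd (Finset.mem_univ _) h]

/-! ### Packing programs -/

/-- Feasible solutions of the packing program with capacity `B` and bounds `N`. -/
def feasible (I : NRM m n) (B : Fin m → ℝ) (N : Fin n → ℝ) : Set (Fin n → ℝ) :=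
  {z | (∀ i, ∑ j, I.bom i j * z j ≤ B i) ∧ ∀ j, 0 ≤ z j ∧ z j ≤ N j}

lemma exists_optimal (I : NRM m n) {B : Fin m → ℝ} {N : Fin n → ℝ} (hB : ∀ i, 0 ≤ B i)
    (hN : ∀ j, 0 ≤ N j) :
    ∃ z ∈ I.feasible B N, ∀ u ∈ I.feasible B N, ∑ j, I.rev j * u j ≤ ∑ j, I.rev j * z j := by
  have hc : IsCompact (I.feasible B N) := by
    refine isCompact_Icc.of_isClosed_subset (s := Set.Icc 0 N) ?_ fun z hz =>
      ⟨fun j => (hz.2 j).1, fun j => (hz.2 j).2⟩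
    have : I.feasible B N = (⋂ i, {z | ∑ j, I.bom i j * z j ≤ B i}) ∩ Set.Icc 0 N := by
      ext z
      simp only [feasible, Set.mem_ofPred_eq, Set.mem_inter_iff, Set.mem_iInter, Set.mem_Icc,
        Pi.le_def, Pi.zero_apply, forall_and]
    rw [this]
    refine IsClosed.inter (isClosed_iInter fun i => isClosed_le (by fun_prop) continuous_const)
      isClosed_Icc
  exact hc.exists_isMaxOn ⟨0, fun i => by simpa using hB i, fun j => by simpa using hN j⟩
    (by fun_prop : Continuous fun z : Fin n → ℝ => ∑ j, I.rev j * z j).continuousOn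

lemma hindsight_eq_sSup (I : NRM m n) (T : ℕ) (arr : ℕ → Fin n) :
    I.hindsight T arr = sSup ((fun z => ∑ j, I.rev j * z j) ''
      I.feasible (I.capacity T) fun j => arrivals arr T j) := by
  rw [hindsight]
  congr 1
  ext v
  simp only [feasible, Set.mem_ofPred_eq, Set.mem_image]
  constructor
  · rintro ⟨z, h1, h2, rfl⟩; exact ⟨z, ⟨h1, h2⟩, rfl⟩
  · rintro ⟨z, ⟨h1, h2⟩, rfl⟩; exact ⟨z, h1, h2, rfl⟩

lemma capacity_nonneg (I : NRM m n) (T : ℕ) (i : Fin m) : 0 ≤ I.capacity T i :=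
  mul_nonneg (Nat.cast_nonneg _) (I.rate_pos i).le

lemma zero_mem_feasible (I : NRM m n) (T : ℕ) (arr : ℕ → Fin n) :
    (0 : Fin n → ℝ) ∈ I.feasible (I.capacity T) fun j => arrivals arr T j :=
  ⟨fun i => by simpa using I.capacity_nonneg T i, fun j => by simp⟩

lemma hindsight_le (I : NRM m n) {T : ℕ} {arr : ℕ → Fin n} {v : ℝ}
    (h : ∀ z ∈ I.feasible (I.capacity T) fun j => arrivals arr T j, ∑ j, I.rev j * z j ≤ v) :
    I.hindsight T arr ≤ v := by
  rw [hindsight_eq_sSup]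
  refine csSup_le ⟨_, 0, I.zero_mem_feasible T arr, rfl⟩ ?_
  rintro _ ⟨z, hz, rfl⟩
  exact h z hz

lemma le_hindsight (I : NRM m n) {T : ℕ} {arr : ℕ → Fin n} {z : Fin n → ℝ}
    (hz : z ∈ I.feasible (I.capacity T) fun j => arrivals arr T j) :
    ∑ j, I.rev j * z j ≤ I.hindsight T arr := by
  rw [hindsight_eq_sSup]
  refine le_csSup ?_ ⟨z, hz, rfl⟩
  refine ⟨∑ j, I.rev j * arrivals arr T j, ?_⟩
  rintro _ ⟨u, hu, rfl⟩
  exact Finset.sum_le_sum fun j _ => mul_le_mul_of_nonneg_left (hu.2 j).2 (I.rev_nonneg j)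

/-! ### Online gradient descent on an interval -/

lemma sq_clip_sub_le {b c u : ℝ} (hc0 : 0 ≤ c) (hcb : c ≤ b) :
    (min (max 0 u) b - c) ^ 2 ≤ (u - c) ^ 2 := by
  rw [sq_le_sq]
  rcases le_total 0 u with h | h
  · rw [max_eq_right h]
    rcases le_total u b with h' | h'
    · rw [min_eq_left h']
    · rw [min_eq_right h', abs_of_nonneg (by linarith), abs_of_nonneg (by linarith)]
      linarith
  · rw [max_eq_left h, min_eq_left (hc0.trans hcb), abs_of_nonpos (by linarith),
      abs_of_nonpos (by linarith)]
    linarith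

/-- Standard potential argument: the weighted squared distance κ√S/2 (θ_S - c)² is kept on the left,
and the change of the weight from √S to √(S+1) is paid for by the diameter b. -/
lemma gradient_descent_bound {θ g : ℕ → ℝ} {b c G κ : ℝ} {S : ℕ} (hκ : 0 < κ) (hc0 : 0 ≤ c)
    (hcb : c ≤ b) (hθ : ∀ s ≤ S, 0 ≤ θ s ∧ θ s ≤ b) (hg : ∀ s < S, |g s| ≤ G)
    (hstep : ∀ s < S, θ (s + 1) = min (max 0 (θ s - g s / (κ * √((s + 1 : ℕ) : ℝ)))) b) :
    ∑ s ∈ Finset.range S, g s * (θ s - c) + κ * √(S : ℝ) / 2 * (θ S - c) ^ 2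
      ≤ √(S : ℝ) * (κ * b ^ 2 / 2 + G ^ 2 / κ) := by
  induction S with
  | zero => simp
  | succ S ih =>
    specialize ih (fun s hs => hθ s (hs.trans S.le_succ)) (fun s hs => hg s (hs.trans S.lt_succ_self))
      (fun s hs => hstep s (hs.trans S.lt_succ_self))
    set r := √((S + 1 : ℕ) : ℝ) with hr
    set q := √(S : ℝ) with hq
    have hr0 : 0 < r := Real.sqrt_pos.2 (by positivity)
    have hq0 : 0 ≤ q := Real.sqrt_nonneg _
    have hr2 : r ^ 2 = S + 1 := by rw [hr, Real.sq_sqrt (by positivity)]; push_cast; ring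
    have hq2 : q ^ 2 = S := by rw [hq, Real.sq_sqrt (by positivity)]
    have hqr : q ≤ r := Real.sqrt_le_sqrt (by push_cast; linarith)
    -- From (r - q)(r + q) = 1 and q ≤ r; thus the terms of order 1/√s telescope.
    have hgap : 1 / (2 * r) ≤ r - q := by
      rw [div_le_iff₀ (by positivity)]; nlinarith
    have h1 := sq_clip_sub_le (u := θ S - g S / (κ * r)) hc0 hcb
    rw [← hstep S S.lt_succ_self] at h1
    have h2 : κ * r / 2 * (θ S - g S / (κ * r) - c) ^ 2 = κ * r / 2 * (θ S - c) ^ 2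
        - g S * (θ S - c) + g S ^ 2 / κ * (1 / (2 * r)) := by
      field_simp; ring
    have h3 := mul_le_mul_of_nonneg_left h1 (show 0 ≤ κ * r / 2 by positivity)
    rw [h2] at h3
    have h4 : (θ S - c) ^ 2 ≤ b ^ 2 := by
      obtain ⟨ha, hb⟩ := hθ S S.le_succ
      rw [sq_le_sq, abs_of_nonneg (hc0.trans hcb), abs_le]
      constructor <;> linarith
    have h5 : g S ^ 2 ≤ G ^ 2 := sq_le_sq' (by linarith [(abs_le.1 (hg S S.lt_succ_self)).1])
      (abs_le.1 (hg S S.lt_succ_self)).2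
    have h6 : g S ^ 2 / κ * (1 / (2 * r)) ≤ G ^ 2 / κ * (r - q) := by gcongr
    have h7 : κ * (r - q) / 2 * (θ S - c) ^ 2 ≤ κ * (r - q) / 2 * b ^ 2 :=
      mul_le_mul_of_nonneg_left h4 (by have := sub_nonneg.2 hqr; positivity)
    rw [Finset.sum_range_succ]
    nlinarith

/-! ### The primal-dual subroutine -/

section Subroutine

variable (I : NRM m n) (arr : ℕ → Fin n) (t₁ : ℕ) (B : Fin m → ℝ) (L : ℝ)

lemma bidDecision_eq (θ : Fin m → ℝ) (j : Fin n) :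
    I.bidDecision θ j = 0 ∨ I.bidDecision θ j = 1 := by
  unfold bidDecision; split_ifs <;> simp

lemma ffDecision_eq (s : ℕ) :
    I.ffDecision arr t₁ B L s = 0 ∨ I.ffDecision arr t₁ B L s = 1 := by
  simp only [ffDecision]
  split_ifs
  exacts [I.bidDecision_eq _ _, Or.inl rfl]

lemma ffDecision_nonneg (s : ℕ) : 0 ≤ I.ffDecision arr t₁ B L s := by
  rcases I.ffDecision_eq arr t₁ B L s with h | h <;> simp [h]

lemma ffDecision_le_one (s : ℕ) : I.ffDecision arr t₁ B L s ≤ 1 := by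
  rcases I.ffDecision_eq arr t₁ B L s with h | h <;> simp [h]

lemma ffRun_succ_of_sufficient {s : ℕ} (h : I.Sufficient (I.ffRun arr t₁ B L s).cap) :
    I.ffRun arr t₁ B L (s + 1) =
      ⟨I.dualStep B L (s + 1) (I.ffRun arr t₁ B L s).price (I.ffDecision arr t₁ B L s)
          (arr (t₁ + s)),
        fun i => (I.ffRun arr t₁ B L s).cap i
          - I.ffDecision arr t₁ B L s * I.bom i (arr (t₁ + s))⟩ := by
  simp only [ffRun, ffDecision, if_pos h]

lemma ffRun_succ_of_not_sufficient {s : ℕ} (h : ¬ I.Sufficient (I.ffRun arr t₁ B L s).cap) :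
    I.ffRun arr t₁ B L (s + 1) = I.ffRun arr t₁ B L s := by
  simp only [ffRun, if_neg h]

lemma ffDecision_of_not_sufficient {s : ℕ} (h : ¬ I.Sufficient (I.ffRun arr t₁ B L s).cap) :
    I.ffDecision arr t₁ B L s = 0 := by
  simp only [ffDecision, if_neg h]

lemma ffRun_of_stopped {s s' : ℕ} (h : ¬ I.Sufficient (I.ffRun arr t₁ B L s).cap)
    (hs : s ≤ s') : I.ffRun arr t₁ B L s' = I.ffRun arr t₁ B L s := by
  induction s', hs using Nat.le_induction with
  | base => rfl
  | succ k _ ih => rw [ffRun_succ_of_not_sufficient _ _ _ _ _ (by rwa [ih]), ih]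

lemma ffDecision_of_stopped {s s' : ℕ} (h : ¬ I.Sufficient (I.ffRun arr t₁ B L s).cap)
    (hs : s ≤ s') : I.ffDecision arr t₁ B L s' = 0 :=
  I.ffDecision_of_not_sufficient _ _ _ _ (by rwa [I.ffRun_of_stopped _ _ _ _ h hs])

lemma ffRun_cap_succ (s : ℕ) (i : Fin m) :
    (I.ffRun arr t₁ B L (s + 1)).cap i = (I.ffRun arr t₁ B L s).cap i
      - I.ffDecision arr t₁ B L s * I.bom i (arr (t₁ + s)) := by
  by_cases h : I.Sufficient (I.ffRun arr t₁ B L s).cap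
  · rw [ffRun_succ_of_sufficient _ _ _ _ _ h]
  · rw [ffRun_succ_of_not_sufficient _ _ _ _ _ h, ffDecision_of_not_sufficient _ _ _ _ _ h]
    simp

lemma ffRun_cap (s : ℕ) (i : Fin m) :
    (I.ffRun arr t₁ B L s).cap i = B i
      - ∑ j, I.bom i j * acc (fun t => arr (t₁ + t)) (I.ffDecision arr t₁ B L) s j := by
  rw [sum_mul_acc]
  induction s with
  | zero => simp [ffRun]
  | succ s ih => rw [ffRun_cap_succ, ih, Finset.sum_range_succ]; ring

variable {B} in
lemma ffRun_cap_nonneg (hB : ∀ i, 0 ≤ B i) (s : ℕ) (i : Fin m) :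
    0 ≤ (I.ffRun arr t₁ B L s).cap i := by
  induction s with
  | zero => exact hB i
  | succ s ih =>
    rw [ffRun_cap_succ]
    by_cases h : I.Sufficient (I.ffRun arr t₁ B L s).cap
    · have h1 := h (arr (t₁ + s)) i
      have h2 := mul_le_of_le_one_left (I.bom_nonneg i (arr (t₁ + s)))
        (I.ffDecision_le_one arr t₁ B L s)
      linarith
    · rw [ffDecision_of_not_sufficient _ _ _ _ _ h]; simpa using ih

variable {B} in
lemma ff_consumption_le (hB : ∀ i, 0 ≤ B i) (s : ℕ) (i : Fin m) :
    ∑ j, I.bom i j * acc (fun t => arr (t₁ + t)) (I.ffDecision arr t₁ B L) s j ≤ B i := by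
  have h1 := I.ffRun_cap arr t₁ B L s i
  have h2 := I.ffRun_cap_nonneg arr t₁ L hB s i
  linarith

variable {B} in
lemma ffRun_price_mem (hB : ∀ i, 0 < B i) (s : ℕ) (i : Fin m) :
    0 ≤ (I.ffRun arr t₁ B L s).price i ∧ (I.ffRun arr t₁ B L s).price i ≤ I.thetaBar B := by
  have hθ := I.thetaBar_nonneg hB
  induction s with
  | zero => simpa [ffRun] using hθ
  | succ s ih =>
    by_cases h : I.Sufficient (I.ffRun arr t₁ B L s).cap
    · rw [ffRun_succ_of_sufficient _ _ _ _ _ h]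
      exact ⟨le_min (le_max_left _ _) hθ, min_le_right _ _⟩
    · rwa [ffRun_succ_of_not_sufficient _ _ _ _ _ h]

variable {B L} in
/-- Regret bound of the bid prices, as long as the subroutine has not stopped. -/
lemma ff_dual_regret (hgp : I.GeneralPosition) (hB : ∀ i, 0 < B i) (hL : 0 < L) {s : ℕ}
    (hs : ∀ t < s, I.Sufficient (I.ffRun arr t₁ B L t).cap) (θ : Fin m → ℝ)
    (hθ : ∀ i, 0 ≤ θ i ∧ θ i ≤ I.thetaBar B) :
    ∑ i, ∑ t ∈ Finset.range s, (B i / L - I.ffDecision arr t₁ B L t * I.bom i (arr (t₁ + t)))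
        * ((I.ffRun arr t₁ B L t).price i - θ i)
      ≤ 2 * m * √(m : ℝ) * (I.gradBound B L * I.thetaBar B * √(s : ℝ)) := by
  have hG := I.gradBound_pos hB hL
  have hθ0 := hgp.thetaBar_pos hB
  have hm := I.one_le_sqrt_card
  have hD : 0 < I.diamBound B := by rw [diamBound]; positivity
  -- With this κ the step 1/(κ√s) is D/(G√s). Projection onto a box acts coordinatewise, so each
  -- price is a separate one-dimensional descent.
  set κ := I.gradBound B L / I.diamBound B with hκ
  have hκ0 : 0 < κ := div_pos hG hD
  have hone : ∀ i, ∑ t ∈ Finset.range s,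
      (B i / L - I.ffDecision arr t₁ B L t * I.bom i (arr (t₁ + t)))
        * ((I.ffRun arr t₁ B L t).price i - θ i)
      ≤ 2 * √(m : ℝ) * (I.gradBound B L * I.thetaBar B * √(s : ℝ)) := by
    intro i
    have h1 := gradient_descent_bound (θ := fun t => (I.ffRun arr t₁ B L t).price i)
      (g := fun t => B i / L - I.ffDecision arr t₁ B L t * I.bom i (arr (t₁ + t)))
      (S := s) (G := I.gradBound B L) hκ0 (hθ i).1 (hθ i).2
      (fun t _ => I.ffRun_price_mem arr t₁ L hB t i)
      (fun t _ => I.abs_grad_le hB hL (I.ffDecision_nonneg _ _ _ _ _)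
        (I.ffDecision_le_one _ _ _ _ _) _ _)
      (fun t ht => by
        rw [ffRun_succ_of_sufficient _ _ _ _ _ (hs t ht)]
        simp only [dualStep, hκ]
        congr 3
        field_simp)
    have h2 : 0 ≤ κ * √(s : ℝ) / 2 * ((I.ffRun arr t₁ B L s).price i - θ i) ^ 2 := by positivity
    have h3 : κ * I.thetaBar B ^ 2 / 2 + I.gradBound B L ^ 2 / κ
        ≤ 2 * √(m : ℝ) * (I.gradBound B L * I.thetaBar B) := by
      have e1 : I.gradBound B L ^ 2 / κ = I.gradBound B L * I.thetaBar B * √(m : ℝ) := by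
        rw [hκ, diamBound]; field_simp
      have e2 : κ * I.thetaBar B ^ 2 = I.gradBound B L * I.thetaBar B / √(m : ℝ) := by
        rw [hκ, diamBound]; field_simp
      have e3 : I.gradBound B L * I.thetaBar B / √(m : ℝ) ≤ I.gradBound B L * I.thetaBar B :=
        div_le_self (by positivity) hm
      have e4 : I.gradBound B L * I.thetaBar B
          ≤ I.gradBound B L * I.thetaBar B * √(m : ℝ) :=
        le_mul_of_one_le_right (by positivity) hm
      have e5 : 0 ≤ I.gradBound B L * I.thetaBar B * √(m : ℝ) := by positivity
      rw [e1, e2]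
      linarith
    have h4 := mul_le_mul_of_nonneg_left h3 (Real.sqrt_nonneg (s : ℝ))
    linarith
  calc _ ≤ ∑ _i : Fin m, 2 * √(m : ℝ) * (I.gradBound B L * I.thetaBar B * √(s : ℝ)) :=
        Finset.sum_le_sum fun i _ => hone i
    _ = _ := by simp; ring

end Subroutine

/-- The arrivals of the first `N` periods of a run are typical: the counts, and the counts weighted
with the bid prices, are within `E` of their compensators. -/
structure GoodRun (I : NRM m n) (arr : ℕ → Fin n) (t₁ : ℕ) (B : Fin m → ℝ) (L : ℝ) (N : ℕ)
    (E : ℝ) : Prop where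
  count : ∀ s ≤ N, ∀ j, |acc (fun t => arr (t₁ + t)) 1 s j - s * I.lam j| ≤ E
  price : ∀ s ≤ N, ∀ i j, |∑ t ∈ Finset.range s, (I.ffRun arr t₁ B L t).price i
    * ((if arr (t₁ + t) = j then 1 else 0) - I.lam j)| ≤ I.thetaBar B * E

lemma GoodRun.nonneg {I : NRM m n} {arr : ℕ → Fin n} {t₁ : ℕ} {B : Fin m → ℝ} {L : ℝ} {N : ℕ}
    {E : ℝ} (h : I.GoodRun arr t₁ B L N E) : 0 ≤ E := by
  obtain ⟨j⟩ := I.nonempty_types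
  exact (abs_nonneg _).trans (h.count 0 (Nat.zero_le _) j)

/-- Error term in the comparison of the subroutine with a fluid solution. -/
noncomputable def ffError (I : NRM m n) (B : Fin m → ℝ) (L : ℝ) (s : ℕ) (E : ℝ) : ℝ :=
  2 * m * √(m : ℝ) * (I.gradBound B L * I.thetaBar B * √(s : ℝ)) + (∑ j, I.rev j) * E
    + I.thetaBar B * E * ∑ i, ∑ j, I.bom i j

/-- The greedy decisions beat, at the current prices, the policy that accepts type j with
probability x_j/λ_j. Typicality replaces that policy by its fluid value, and the descent regret
replaces the moving prices by the fixed θ. -/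
lemma GoodRun.revenue_ge {I : NRM m n} {arr : ℕ → Fin n} {t₁ : ℕ} {B : Fin m → ℝ} {L : ℝ} {N : ℕ}
    {E : ℝ} (h : I.GoodRun arr t₁ B L N E) (hgp : I.GeneralPosition) (hB : ∀ i, 0 < B i)
    (hL : 0 < L) {s : ℕ} (hsN : s ≤ N)
    (hs : ∀ t < s, I.Sufficient (I.ffRun arr t₁ B L t).cap) {θ : Fin m → ℝ}
    (hθ : ∀ i, 0 ≤ θ i ∧ θ i ≤ I.thetaBar B) {x : Fin n → ℝ} (hx0 : ∀ j, 0 ≤ x j)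
    (hx : ∀ j, x j ≤ I.lam j) (hxB : ∀ i, ∑ j, I.bom i j * x j ≤ B i / L) :
    s * ∑ j, I.rev j * x j ≤
      ∑ j, I.rev j * acc (fun t => arr (t₁ + t)) (I.ffDecision arr t₁ B L) s j
      + ∑ i, θ i * (s * (B i / L)
        - ∑ j, I.bom i j * acc (fun t => arr (t₁ + t)) (I.ffDecision arr t₁ B L) s j)
      + I.ffError B L s E := by
  set k : ℕ → Fin n := fun t => arr (t₁ + t) with hk
  set y := I.ffDecision arr t₁ B L with hy
  set P : ℕ → Fin m → ℝ := fun t => (I.ffRun arr t₁ B L t).price with hP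
  have hE := h.nonneg
  have hPmem : ∀ t i, 0 ≤ P t i ∧ P t i ≤ I.thetaBar B := fun t i => I.ffRun_price_mem arr t₁ L hB t i
  -- Acceptance fractions of the fluid policy; for λ_j = 0 the default value 0 is right because then
  -- x_j = 0.
  let v : Fin n → ℝ := fun j => x j / I.lam j
  have hv0 : ∀ j, 0 ≤ v j := fun j => div_nonneg (hx0 j) (I.lam_nonneg j)
  have hv1 : ∀ j, v j ≤ 1 := fun j => div_le_one_of_le₀ (hx j) (I.lam_nonneg j)
  have hvx : ∀ j, v j * I.lam j = x j := fun j => by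
    rcases (I.lam_nonneg j).eq_or_lt with h0 | h0
    · have := hx j
      rw [← h0] at this
      rw [← h0, mul_zero]; exact le_antisymm (hx0 j) this
    · exact div_mul_cancel₀ _ h0.ne'
  -- the decisions are greedy for the current prices
  have hgreedy : ∑ t ∈ Finset.range s, I.rev (k t) * v (k t)
      - ∑ t ∈ Finset.range s, ∑ i, P t i * I.bom i (k t) * v (k t)
      ≤ ∑ t ∈ Finset.range s, I.rev (k t) * y t
        - ∑ t ∈ Finset.range s, ∑ i, P t i * I.bom i (k t) * y t := by
    rw [← Finset.sum_sub_distrib, ← Finset.sum_sub_distrib]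
    refine Finset.sum_le_sum fun t ht => ?_
    rw [← Finset.sum_mul, ← Finset.sum_mul, ← sub_mul, ← sub_mul]
    have hyt : y t = I.bidDecision (P t) (k t) := by
      simp only [hy, ffDecision, if_pos (hs t (Finset.mem_range.1 ht)), hP, hk]
    rw [hyt, bidDecision]
    split_ifs with hr
    · nlinarith [hv1 (k t)]
    · nlinarith [hv0 (k t)]
  have hrev : s * ∑ j, I.rev j * x j - (∑ j, I.rev j) * E
      ≤ ∑ t ∈ Finset.range s, I.rev (k t) * v (k t) := by
    have h1 : ∑ t ∈ Finset.range s, I.rev (k t) * v (k t)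
        = ∑ j, I.rev j * v j * acc k 1 s j := by
      rw [sum_mul_acc]; simp
    rw [h1, Finset.mul_sum, Finset.sum_mul, ← Finset.sum_sub_distrib]
    refine Finset.sum_le_sum fun j _ => ?_
    have h2 := (abs_le.1 (h.count s hsN j)).1
    have h3 : v j * (s * I.lam j - E) ≤ v j * acc k 1 s j :=
      mul_le_mul_of_nonneg_left (by linarith) (hv0 j)
    have h4 : v j * E ≤ E := mul_le_of_le_one_left hE (hv1 j)
    have h5 : s * x j - E ≤ v j * acc k 1 s j := by
      rw [← hvx j]; linarith
    have := mul_le_mul_of_nonneg_left h5 (I.rev_nonneg j)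
    linarith
  -- The price deviations in `GoodRun` enter here: prices are set before the arrival, so the cost of
  -- the fluid policy is close to its compensator, which the capacity rate bounds.
  have hcost : ∑ t ∈ Finset.range s, ∑ i, P t i * I.bom i (k t) * v (k t)
      ≤ ∑ i, B i / L * ∑ t ∈ Finset.range s, P t i + I.thetaBar B * E * ∑ i, ∑ j, I.bom i j := by
    rw [Finset.sum_comm, Finset.mul_sum, ← Finset.sum_add_distrib]
    refine Finset.sum_le_sum fun i _ => ?_
    have h1 : ∑ t ∈ Finset.range s, P t i * I.bom i (k t) * v (k t)
        = ∑ j, I.bom i j * v j * ∑ t ∈ Finset.range s, P t i * (if k t = j then 1 else 0) := by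
      simp_rw [Finset.mul_sum]
      rw [Finset.sum_comm]
      refine Finset.sum_congr rfl fun t _ => ?_
      rw [Finset.sum_eq_single (k t)] <;> simp +contextual [eq_comm]
      ring
    have h2 : ∀ j, ∑ t ∈ Finset.range s, P t i * (if k t = j then 1 else 0)
        ≤ I.lam j * ∑ t ∈ Finset.range s, P t i + I.thetaBar B * E := fun j => by
      have h3 := (abs_le.1 (h.price s hsN i j)).2
      simp_rw [mul_sub, Finset.sum_sub_distrib, ← Finset.sum_mul] at h3
      linarith
    have hθE : 0 ≤ I.thetaBar B * E := mul_nonneg (I.thetaBar_nonneg hB) hE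
    have hPs : 0 ≤ ∑ t ∈ Finset.range s, P t i := Finset.sum_nonneg fun t _ => (hPmem t i).1
    calc _ ≤ ∑ j, (I.bom i j * x j * ∑ t ∈ Finset.range s, P t i
            + I.thetaBar B * E * I.bom i j) := by
          rw [h1]
          refine Finset.sum_le_sum fun j _ => ?_
          have h4 := mul_le_mul_of_nonneg_left (h2 j) (mul_nonneg (I.bom_nonneg i j) (hv0 j))
          have h5 : I.bom i j * v j * (I.thetaBar B * E) ≤ I.bom i j * (I.thetaBar B * E) :=
            mul_le_mul_of_nonneg_right (mul_le_of_le_one_right (I.bom_nonneg i j) (hv1 j)) hθE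
          rw [← hvx j]
          linarith
      _ = (∑ j, I.bom i j * x j) * ∑ t ∈ Finset.range s, P t i
            + I.thetaBar B * E * ∑ j, I.bom i j := by
          rw [Finset.sum_add_distrib, ← Finset.sum_mul, ← Finset.mul_sum]
      _ ≤ _ := by
          gcongr
          exact hxB i
  have hdual := I.ff_dual_regret arr t₁ hgp hB hL hs θ hθ
  have hexp : ∑ i, ∑ t ∈ Finset.range s, (B i / L - y t * I.bom i (k t)) * (P t i - θ i)
      = ∑ i, B i / L * ∑ t ∈ Finset.range s, P t i
        - ∑ t ∈ Finset.range s, ∑ i, P t i * I.bom i (k t) * y t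
        - ∑ i, θ i * (s * (B i / L) - ∑ j, I.bom i j * acc k y s j) := by
    rw [Finset.sum_comm (s := Finset.range s), ← Finset.sum_sub_distrib, ← Finset.sum_sub_distrib]
    refine Finset.sum_congr rfl fun i _ => ?_
    rw [sum_mul_acc, mul_sub, Finset.mul_sum, Finset.mul_sum,
      show θ i * (s * (B i / L)) = ∑ t ∈ Finset.range s, θ i * (B i / L) by simp; ring,
      ← Finset.sum_sub_distrib, ← Finset.sum_sub_distrib, ← Finset.sum_sub_distrib]
    exact Finset.sum_congr rfl fun t _ => by ring
  rw [sum_mul_acc, ffError]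
  have hdual' : ∑ i, ∑ t ∈ Finset.range s, (B i / L - y t * I.bom i (k t)) * (P t i - θ i)
    ≤ 2 * m * √(m : ℝ) * (I.gradBound B L * I.thetaBar B * √(s : ℝ)) := hdual
  rw [hexp] at hdual'
  linarith

/-! ### Consequences for complete runs of the subroutine -/

/-- A run has either not stopped, or it has a first period without sufficient capacity. -/
lemma ff_stopped_cases (I : NRM m n) (arr : ℕ → Fin n) (t₁ : ℕ) (B : Fin m → ℝ) (L : ℝ) (s : ℕ) :
    (∀ t < s, I.Sufficient (I.ffRun arr t₁ B L t).cap) ∨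
      ∃ τ < s, (∀ t < τ, I.Sufficient (I.ffRun arr t₁ B L t).cap) ∧
        (∃ i j, (I.ffRun arr t₁ B L τ).cap i < I.bom i j) ∧
        ∀ j, acc (fun t => arr (t₁ + t)) (I.ffDecision arr t₁ B L) s j
          = acc (fun t => arr (t₁ + t)) (I.ffDecision arr t₁ B L) τ j := by
  classical
  by_cases h : ∀ t < s, I.Sufficient (I.ffRun arr t₁ B L t).cap
  · exact Or.inl h
  right
  push Not at h
  obtain ⟨τ, ⟨hτs, hτ⟩, hmin⟩ : ∃ τ, (τ < s ∧ ¬ I.Sufficient (I.ffRun arr t₁ B L τ).cap) ∧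
      ∀ t < τ, ¬ (t < s ∧ ¬ I.Sufficient (I.ffRun arr t₁ B L t).cap) :=
    ⟨Nat.find h, Nat.find_spec h, fun t => Nat.find_min h⟩
  refine ⟨τ, hτs, fun t ht => ?_, ?_, fun j => ?_⟩
  · by_contra hc
    exact hmin t ht ⟨ht.trans hτs, hc⟩
  · unfold Sufficient at hτ
    push Not at hτ
    obtain ⟨j, i, hij⟩ := hτ
    exact ⟨i, j, hij⟩
  · rw [acc, acc, ← Finset.sum_range_add_sum_Ico _ hτs.le, add_eq_left]
    refine Finset.sum_eq_zero fun t ht => ?_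
    rw [I.ffDecision_of_stopped _ _ _ _ hτ (Finset.mem_Ico.1 ht).1, ite_self]

lemma ffError_mono (I : NRM m n) {B : Fin m → ℝ} {L E : ℝ} {s s' : ℕ} (hB : ∀ i, 0 < B i)
    (hL : 0 < L) (hs : s ≤ s') : I.ffError B L s E ≤ I.ffError B L s' E := by
  have h1 := I.gradBound_pos hB hL
  have h2 := I.thetaBar_nonneg hB
  unfold ffError
  gcongr

/-- A complete run earns as much as any fluid solution, up to the error term. -/
lemma GoodRun.fluid_le {I : NRM m n} {arr : ℕ → Fin n} {t₁ : ℕ} {B : Fin m → ℝ} {N : ℕ}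
    {E : ℝ} (h : I.GoodRun arr t₁ B N N E) (hgp : I.GeneralPosition) (hB : ∀ i, 0 < B i)
    (hN : 0 < N) {x : Fin n → ℝ} (hx0 : ∀ j, 0 ≤ x j)
    (hx : ∀ j, x j ≤ I.lam j) (hxB : ∀ i, ∑ j, I.bom i j * x j ≤ B i / N) :
    N * ∑ j, I.rev j * x j ≤
      ∑ j, I.rev j * acc (fun t => arr (t₁ + t)) (I.ffDecision arr t₁ B N) N j
      + I.ffError B N N E + I.thetaBar B * I.aBar := by
  have hθ0 := I.thetaBar_nonneg hB
  have hN' : (0 : ℝ) < N := by exact_mod_cast hN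
  have hā := I.aBar_pos
  -- Without a stop compare at θ = 0. After a stop caused by resource i compare at θ̄ on i and 0
  -- elsewhere, so that the exhausted resource pays for the missed periods.
  rcases I.ff_stopped_cases arr t₁ B N N with hs | ⟨τ, hτN, hs, ⟨i, j₁, hij⟩, hacc⟩
  · have h1 := h.revenue_ge hgp hB hN' le_rfl hs (θ := 0) (fun i => ⟨le_rfl, hθ0⟩) hx0 hx hxB
    have h2 : 0 ≤ I.thetaBar B * I.aBar := by positivity
    simp only [Pi.zero_apply, zero_mul, Finset.sum_const_zero] at h1
    linarith
  · simp_rw [hacc]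
    have h1 := h.revenue_ge hgp hB hN' hτN.le hs (θ := Pi.single i (I.thetaBar B)) (fun k => by
      by_cases hk : k = i
      · subst hk; simpa using hθ0
      · simpa [hk] using hθ0) hx0 hx hxB
    rw [OptPair.single_sum (i₀ := i) (fun k hk => by simp [hk]), Pi.single_eq_same] at h1
    have h2 := I.ffRun_cap arr t₁ B N τ i
    have h3 := I.bom_le_aBar i j₁
    -- Each missed period has fluid value at most θ̄ B i / N, exactly the rate at which the
    -- exhausted resource was overused at price θ̄.
    have h4 : ∑ j, I.rev j * x j ≤ I.thetaBar B * (B i / N) := by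
      calc ∑ j, I.rev j * x j ≤ ∑ j, (∑ k, I.alphaBar k * I.bom k j) * x j :=
            Finset.sum_le_sum fun j _ =>
              mul_le_mul_of_nonneg_right (I.rev_le_sum_alphaBar_mul j) (hx0 j)
        _ = ∑ k, I.alphaBar k * ∑ j, I.bom k j * x j := by
            simp_rw [Finset.sum_mul, Finset.mul_sum]
            rw [Finset.sum_comm]
            simp_rw [mul_assoc]
        _ ≤ ∑ k, I.alphaBar k * (B k / N) :=
            Finset.sum_le_sum fun k _ => mul_le_mul_of_nonneg_left (hxB k) (I.alphaBar_nonneg k)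
        _ = (∑ k, I.alphaBar k * B k) / N := by
            rw [Finset.sum_div]; exact Finset.sum_congr rfl fun k _ => by ring
        _ ≤ I.thetaBar B * B i / N := by
            gcongr; exact I.sum_alphaBar_mul_le hB i
        _ = _ := by ring
    have h5 : ((N : ℝ) - τ) * ∑ j, I.rev j * x j ≤ (N - τ) * (I.thetaBar B * (B i / N)) :=
      mul_le_mul_of_nonneg_left h4 (by
        have : (τ : ℝ) ≤ N := by exact_mod_cast hτN.le
        linarith)
    have h6 : I.thetaBar B * (τ * (B i / N) - ∑ j, I.bom i j *
        acc (fun t => arr (t₁ + t)) (I.ffDecision arr t₁ B N) τ j)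
        ≤ I.thetaBar B * (τ * (B i / N) - B i + I.aBar) :=
      mul_le_mul_of_nonneg_left (by linarith) hθ0
    have h7 : I.thetaBar B * B i = N * (I.thetaBar B * (B i / N)) := by field_simp
    have h8 := I.ffError_mono (E := E) hB hN' hτN.le
    linarith

/-- A complete run earns as much as any packing of the arrivals, up to the error terms. -/
lemma GoodRun.packing_le {I : NRM m n} {arr : ℕ → Fin n} {t₁ : ℕ} {B : Fin m → ℝ} {N : ℕ}
    {E : ℝ} (h : I.GoodRun arr t₁ B N N E) (hgp : I.GeneralPosition) (hB : ∀ i, 0 < B i)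
    (hN : 0 < N) {u : Fin n → ℝ}
    (hu : u ∈ I.feasible B (acc (fun t => arr (t₁ + t)) 1 N)) :
    ∑ j, I.rev j * u j ≤
      ∑ j, I.rev j * acc (fun t => arr (t₁ + t)) (I.ffDecision arr t₁ B N) N j
      + I.ffError B N N E + I.thetaBar B * I.aBar + (∑ j, I.rev j) * E := by
  have hN' : (0 : ℝ) < N := by exact_mod_cast hN
  have hE := h.nonneg
  -- A packing becomes a fluid solution after division by N and truncation at λ; typical counts make
  -- the truncation cost at most E per type.
  have h1 := h.fluid_le hgp hB hN (x := fun j => min (I.lam j) (u j / N))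
    (fun j => le_min (I.lam_nonneg j) (div_nonneg (hu.2 j).1 hN'.le))
    (fun j => min_le_left _ _) (fun i => by
      rw [le_div_iff₀ hN', Finset.sum_mul]
      refine le_trans (Finset.sum_le_sum fun j _ => ?_) (hu.1 i)
      rw [mul_assoc]
      refine mul_le_mul_of_nonneg_left ?_ (I.bom_nonneg i j)
      rw [← le_div_iff₀ hN']
      exact min_le_right _ _)
  have h2 : ∑ j, I.rev j * u j
      ≤ N * ∑ j, I.rev j * min (I.lam j) (u j / N) + (∑ j, I.rev j) * E := by
    rw [Finset.mul_sum, Finset.sum_mul, ← Finset.sum_add_distrib]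
    refine Finset.sum_le_sum fun j _ => ?_
    have h3 : u j ≤ N * min (I.lam j) (u j / N) + E := by
      rcases min_choice (I.lam j) (u j / N) with hm | hm
      · rw [hm]
        have h4 := (abs_le.1 (h.count N le_rfl j)).2
        have h5 := (hu.2 j).2
        linarith
      · rw [hm, mul_div_cancel₀ _ hN'.ne']; linarith
    have := mul_le_mul_of_nonneg_left h3 (I.rev_nonneg j)
    linarith
  linarith

lemma acc_ff_le (I : NRM m n) (arr : ℕ → Fin n) (t₁ : ℕ) (B : Fin m → ℝ) (L : ℝ) (s : ℕ)
    (j : Fin n) : acc (fun t => arr (t₁ + t)) (I.ffDecision arr t₁ B L) s j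
      ≤ acc (fun t => arr (t₁ + t)) 1 s j :=
  acc_mono (fun t _ => I.ffDecision_le_one arr t₁ B L t) j

lemma acc_ff_nonneg (I : NRM m n) (arr : ℕ → Fin n) (t₁ : ℕ) (B : Fin m → ℝ) (L : ℝ) (s : ℕ)
    (j : Fin n) : 0 ≤ acc (fun t => arr (t₁ + t)) (I.ffDecision arr t₁ B L) s j :=
  acc_nonneg (fun t _ => I.ffDecision_nonneg arr t₁ B L t) j

/-! ### Runs with capacity proportional to their length -/

/-- For proportional capacities the gradient bound and the price interval do not depend on L, so one
constant serves phases I and II. -/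
lemma exists_ffError_le (I : NRM m n) :
    ∃ C ≥ 1, ∀ (L : ℝ) (s : ℕ) (E : ℝ), 0 < L → √(s : ℝ) ≤ E →
      I.ffError (fun i => L * I.rate i) L s E ≤ C * E := by
  set θ := I.thetaBar I.rate
  set G := (⨆ i, I.rate i) * √(m : ℝ) + I.aBar * √(m : ℝ) with hG
  have hθ : 0 ≤ θ := I.thetaBar_nonneg I.rate_pos
  have hsup := I.iSup_cap_pos I.rate_pos
  have hā := I.aBar_pos
  have hr : 0 ≤ ∑ j, I.rev j := Finset.sum_nonneg fun j _ => I.rev_nonneg j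
  have ha : 0 ≤ ∑ i, ∑ j, I.bom i j :=
    Finset.sum_nonneg fun i _ => Finset.sum_nonneg fun j _ => I.bom_nonneg i j
  have hG0 : 0 ≤ G := by positivity
  refine ⟨1 + 2 * m * √(m : ℝ) * (G * θ) + ∑ j, I.rev j + θ * ∑ i, ∑ j, I.bom i j, ?_,
    fun L s E hL hE => ?_⟩
  · have : 0 ≤ 2 * m * √(m : ℝ) * (G * θ) + ∑ j, I.rev j + θ * ∑ i, ∑ j, I.bom i j := by
      positivity
    linarith
  · have h1 : I.gradBound (fun i => L * I.rate i) L = G := by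
      rw [gradBound, ← Real.mul_iSup_of_nonneg hL.le, mul_div_cancel_left₀ _ hL.ne']
    have h2 : 2 * m * √(m : ℝ) * (G * θ * √(s : ℝ)) ≤ 2 * m * √(m : ℝ) * (G * θ * E) := by
      gcongr
    have h3 : 0 ≤ E := (Real.sqrt_nonneg _).trans hE
    rw [ffError, h1, I.thetaBar_smul hL]
    linarith

/-- The revenue bound rewritten through `gap_eq`; the free θ is later chosen from the signs of the
slacks. -/
lemma GoodRun.gap_le {I : NRM m n} {arr : ℕ → Fin n} {t₁ : ℕ} {L : ℝ} {N : ℕ} {E : ℝ}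
    (h : I.GoodRun arr t₁ (fun i => L * I.rate i) L N E) (hgp : I.GeneralPosition) (hL : 0 < L)
    {xs : Fin n → ℝ} {p : Fin m → ℝ} (hopt : I.OptPair xs p) {s : ℕ} (hsN : s ≤ N)
    (hs : ∀ t < s, I.Sufficient (I.ffRun arr t₁ (fun i => L * I.rate i) L t).cap)
    {θ : Fin m → ℝ} (hθ : ∀ i, 0 ≤ θ i ∧ θ i ≤ I.thetaBar I.rate) :
    ∑ j, I.reduced p j * (s * xs j - acc (fun t => arr (t₁ + t))
        (I.ffDecision arr t₁ (fun i => L * I.rate i) L) s j)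
      + ∑ i, (p i - θ i) * (s * I.rate i - ∑ j, I.bom i j * acc (fun t => arr (t₁ + t))
        (I.ffDecision arr t₁ (fun i => L * I.rate i) L) s j)
      ≤ I.ffError (fun i => L * I.rate i) L s E := by
  have hB : ∀ i, 0 < L * I.rate i := fun i => mul_pos hL (I.rate_pos i)
  have hdiv : ∀ i, L * I.rate i / L = I.rate i := fun i => mul_div_cancel_left₀ _ hL.ne'
  have h1 := h.revenue_ge hgp hB hL hsN hs (θ := θ) (fun i => by
    rw [I.thetaBar_smul hL]; exact hθ i) hopt.nonneg hopt.le_lam (fun i => by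
    rw [hdiv]; exact hopt.feas i)
  have h2 := hopt.gap_eq s (acc (fun t => arr (t₁ + t))
        (I.ffDecision arr t₁ (fun i => L * I.rate i) L) s)
  simp only [hdiv] at h1
  simp_rw [sub_mul _ _ (s * I.rate _ - _), Finset.sum_sub_distrib (f := fun i => p i * _)]
  linarith

/-- If the dual prices are smaller than the largest bid price, then the numbers of accepted
customers stay close to the fluid solution throughout the run. -/
lemma OptPair.exists_acc_dist_le {I : NRM m n} {xs : Fin n → ℝ} {p : Fin m → ℝ}
    (hopt : I.OptPair xs p) (hgp : I.GeneralPosition) (hp : ∀ i, p i < I.thetaBar I.rate) :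
    ∃ K > 0, ∀ (arr : ℕ → Fin n) (t₁ : ℕ) (L : ℝ) (N : ℕ) (E : ℝ), 0 < L → N ≤ L → √L ≤ E →
      1 ≤ E → I.GoodRun arr t₁ (fun i => L * I.rate i) L N E → ∀ s ≤ N, ∀ j,
      |acc (fun t => arr (t₁ + t)) (I.ffDecision arr t₁ (fun i => L * I.rate i) L) s j
        - s * xs j| ≤ K * E := by
  -- The weight is the room of p i on either side: p i penalises unused capacity and θ̄ - p i
  -- penalises overuse. Strict positivity for nonzero prices is where p < θ̄ enters.
  obtain ⟨K, hK, hdist⟩ := hopt.exists_dist_le hgp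
    (c := fun i => min (p i) (I.thetaBar I.rate - p i))
    (fun i => le_min (hopt.price_nonneg i) (sub_nonneg.2 (hp i).le))
    (fun i hi => lt_min ((hopt.price_nonneg i).lt_of_ne' hi) (sub_pos.2 (hp i)))
  obtain ⟨C, hC, herr⟩ := I.exists_ffError_le
  have hθ0 := I.thetaBar_nonneg I.rate_pos
  set ρ := ⨅ i, I.rate i with hρ
  have hρ0 : 0 < ρ := I.iInf_cap_pos I.rate_pos
  set S := ∑ i, ∑ j, I.bom i j with hS
  have hS0 : 0 ≤ S :=
    Finset.sum_nonneg fun i _ => Finset.sum_nonneg fun j _ => I.bom_nonneg i j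
  have hā := I.aBar_pos
  have hunstopped : ∀ (arr : ℕ → Fin n) (t₁ : ℕ) (L : ℝ) (N : ℕ) (E : ℝ), 0 < L → N ≤ L → √L ≤ E →
      I.GoodRun arr t₁ (fun i => L * I.rate i) L N E → ∀ s ≤ N,
      (∀ t < s, I.Sufficient (I.ffRun arr t₁ (fun i => L * I.rate i) L t).cap) → ∀ j,
      |acc (fun t => arr (t₁ + t)) (I.ffDecision arr t₁ (fun i => L * I.rate i) L) s j
        - s * xs j| ≤ K * C * E := by
    intro arr t₁ L N E hL hN hLE hgood s hsN hs
    have hE := hgood.nonneg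
    have hECE : E ≤ C * E := le_mul_of_one_le_left hE hC
    rw [mul_assoc]
    set x := acc (fun t => arr (t₁ + t)) (I.ffDecision arr t₁ (fun i => L * I.rate i) L) s with hx
    refine hdist x s (C * E) (by positivity) (fun j => I.acc_ff_nonneg _ _ _ _ _ _) (fun j => ?_) ?_
    · have h1 := I.acc_ff_le arr t₁ (fun i => L * I.rate i) L s j
      have h2 := (abs_le.1 (hgood.count s hsN j)).2
      linarith
    -- The corner: price 0 on underused and θ̄ on overused resources makes every resource term at
    -- least its weight times the absolute slack.
    · have h1 := hgood.gap_le hgp hL hopt hsN hs (θ := fun i =>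
        if 0 ≤ s * I.rate i - ∑ j, I.bom i j * x j then 0 else I.thetaBar I.rate)
        (fun i => by split_ifs <;> simp [hθ0])
      have h2 : ∑ i, min (p i) (I.thetaBar I.rate - p i)
          * |s * I.rate i - ∑ j, I.bom i j * x j|
          ≤ ∑ i, (p i - if 0 ≤ s * I.rate i - ∑ j, I.bom i j * x j then 0
            else I.thetaBar I.rate) * (s * I.rate i - ∑ j, I.bom i j * x j) := by
        refine Finset.sum_le_sum fun i _ => ?_
        split_ifs with hi
        · rw [abs_of_nonneg hi, sub_zero]
          exact mul_le_mul_of_nonneg_right (min_le_left _ _) hi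
        · rw [abs_of_neg (not_le.1 hi)]
          have := mul_le_mul_of_nonneg_right (min_le_right (p i) (I.thetaBar I.rate - p i))
            (neg_nonneg.2 (not_le.1 hi).le)
          linarith
      have h3 := herr L s E hL ((Real.sqrt_le_sqrt (by
        have : (s : ℝ) ≤ N := by exact_mod_cast hsN
        linarith)).trans hLE)
      linarith
  refine ⟨K * C + (I.aBar + K * C * S) / ρ, by positivity,
    fun arr t₁ L N E hL hN hLE hE1 hgood s hsN j => ?_⟩
  have hE := hgood.nonneg
  have hR0 : 0 ≤ (I.aBar + K * C * S) / ρ * E := by positivity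
  rw [add_mul]
  rcases I.ff_stopped_cases arr t₁ (fun i => L * I.rate i) L s with
    hs | ⟨τ, hτs, hs, ⟨i, j₁, hij⟩, hacc⟩
  · have := hunstopped arr t₁ L N E hL hN hLE hgood s hsN hs j
    linarith
  -- Up to the stop, consumption exceeds the fluid rate by only O(E), yet the capacity for L periods
  -- is nearly gone. So L - τ = O(E), and the frozen periods add O(E).
  · have hτ := hunstopped arr t₁ L N E hL hN hLE hgood τ (hτs.le.trans hsN) hs
    have h2 := I.ffRun_cap arr t₁ (fun i => L * I.rate i) L τ i
    have h3 := I.bom_le_aBar i j₁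
    have hrow : ∑ j, I.bom i j ≤ S := Finset.single_le_sum (f := fun i => ∑ j, I.bom i j)
      (fun k _ => Finset.sum_nonneg fun j _ => I.bom_nonneg k j) (Finset.mem_univ i)
    have h4 : ∑ j, I.bom i j * acc (fun t => arr (t₁ + t))
        (I.ffDecision arr t₁ (fun i => L * I.rate i) L) τ j ≤ τ * I.rate i + K * C * E * S := by
      calc _ ≤ ∑ j, (τ * (I.bom i j * xs j) + K * C * E * I.bom i j) := by
            refine Finset.sum_le_sum fun j _ => ?_
            have := mul_le_mul_of_nonneg_left
              (show acc (fun t => arr (t₁ + t)) (I.ffDecision arr t₁ (fun i => L * I.rate i) L) τ j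
                ≤ τ * xs j + K * C * E by linarith [(abs_le.1 (hτ j)).2]) (I.bom_nonneg i j)
            linarith
        _ = τ * ∑ j, I.bom i j * xs j + K * C * E * ∑ j, I.bom i j := by
            rw [Finset.sum_add_distrib, Finset.mul_sum, Finset.mul_sum]
        _ ≤ _ := by gcongr; exact hopt.feas i
    have hτL : (τ : ℝ) ≤ L := by
      have : (τ : ℝ) ≤ N := by exact_mod_cast hτs.le.trans hsN
      linarith
    have hsL : (s : ℝ) ≤ L := by
      have : (s : ℝ) ≤ N := by exact_mod_cast hsN
      linarith
    have h5 : (L - τ) * ρ ≤ (I.aBar + K * C * S) * E := by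
      have h6 : (L - τ) * ρ ≤ (L - τ) * I.rate i :=
        mul_le_mul_of_nonneg_left (iInf_cap_le I.rate i) (by linarith)
      have h7 : I.aBar ≤ I.aBar * E := le_mul_of_one_le_right hā.le hE1
      linarith
    have h6 : (s : ℝ) - τ ≤ (I.aBar + K * C * S) / ρ * E := by
      rw [div_mul_eq_mul_div, le_div_iff₀ hρ0]
      have : ((s : ℝ) - τ) * ρ ≤ (L - τ) * ρ := by gcongr
      linarith
    have hsτ : (τ : ℝ) ≤ s := by exact_mod_cast hτs.le
    have h7 : ((s : ℝ) - τ) * xs j ≤ s - τ :=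
      mul_le_of_le_one_right (by linarith) ((hopt.le_lam j).trans (I.lam_le_one j))
    have h8 : 0 ≤ ((s : ℝ) - τ) * xs j := mul_nonneg (by linarith) (hopt.nonneg j)
    have h9 := abs_le.1 (hτ j)
    rw [hacc j, abs_le]
    constructor <;> linarith

/-- The run in the single resource situation: the rejected types are hardly ever accepted, and the
capacity of the elapsed periods is used up by the partly accepted type. -/
lemma SingleResource.exists_acc_bounds {I : NRM m n} {xs : Fin n → ℝ} {p : Fin m → ℝ}
    {i₀ : Fin m} {j₀ : Fin n} (h : I.SingleResource xs p i₀ j₀) (hgp : I.GeneralPosition) :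
    ∃ K > 0, ∀ (arr : ℕ → Fin n) (t₁ : ℕ) (L : ℝ) (N : ℕ) (E : ℝ), 0 < L → N ≤ L → √L ≤ E →
      1 ≤ E → I.GoodRun arr t₁ (fun i => L * I.rate i) L N E → ∀ s ≤ N,
      (∀ j, j ≠ j₀ → acc (fun t => arr (t₁ + t))
        (I.ffDecision arr t₁ (fun i => L * I.rate i) L) s j ≤ K * E) ∧
      s * xs j₀ - K * E ≤ acc (fun t => arr (t₁ + t))
        (I.ffDecision arr t₁ (fun i => L * I.rate i) L) s j₀ := by
  classical
  obtain ⟨C, hC, herr⟩ := I.exists_ffError_le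
  have hā := I.aBar_pos
  have hp0 := h.price_pos
  have hred : ∀ j, I.reduced p j = I.rev j - p i₀ * I.bom i₀ j := fun j => by
    rw [reduced, OptPair.single_sum h.price_eq_zero fun i => I.bom i j]
  have hred0 : I.reduced p j₀ = 0 := by rw [hred, h.rev_eq, sub_self]
  have hredneg : ∀ j, j ≠ j₀ → I.reduced p j < 0 := fun j hj => by
    rw [hred]; linarith [h.rev_lt j hj]
  set K₁ := ∑ j, C / |I.reduced p j| with hK₁
  have hK₁0 : 0 ≤ K₁ := Finset.sum_nonneg fun j _ => by positivity
  set S := ∑ j, I.bom i₀ j with hS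
  have hS0 : 0 ≤ S := Finset.sum_nonneg fun j _ => I.bom_nonneg i₀ j
  set a := I.bom i₀ j₀ with ha
  have ha0 : 0 < a := h.bom_pos
  set K₂ := (C / p i₀ + K₁ * S + I.aBar) / a with hK₂
  have hK₂0 : 0 < K₂ := by positivity
  have hax : a * xs j₀ = I.rate i₀ := h.bom_mul_xs
  refine ⟨K₁ + K₂, by positivity, fun arr t₁ L N E hL hN hLE hE1 hgood s hsN => ?_⟩
  have hE := hgood.nonneg
  set y := I.ffDecision arr t₁ (fun i => L * I.rate i) L with hy
  set k : ℕ → Fin n := fun t => arr (t₁ + t) with hk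
  have hsplit : ∀ s, (∀ j, j ≠ j₀ → acc k y s j ≤ K₁ * E) →
      ∑ j, I.bom i₀ j * acc k y s j ≤ a * acc k y s j₀ + K₁ * S * E := by
    intro s hothers
    rw [← Finset.add_sum_erase _ _ (Finset.mem_univ j₀)]
    refine add_le_add le_rfl ?_
    calc _ ≤ ∑ j ∈ Finset.univ.erase j₀, I.bom i₀ j * (K₁ * E) :=
          Finset.sum_le_sum fun j hj =>
            mul_le_mul_of_nonneg_left (hothers j (Finset.ne_of_mem_erase hj)) (I.bom_nonneg _ _)
      _ ≤ ∑ j, I.bom i₀ j * (K₁ * E) :=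
          Finset.sum_le_sum_of_subset_of_nonneg (Finset.erase_subset _ _) fun j _ _ =>
            mul_nonneg (I.bom_nonneg _ _) (by positivity)
      _ = _ := by rw [← Finset.sum_mul]; ring
  have hlower : ∀ s, (∀ j, j ≠ j₀ → acc k y s j ≤ K₁ * E) → ∀ s' : ℕ,
      s' * I.rate i₀ - ∑ j, I.bom i₀ j * acc k y s j ≤ C / p i₀ * E + I.aBar * E →
      s' * xs j₀ - K₂ * E ≤ acc k y s j₀ := by
    intro s h1 s' h2
    have h3 := hsplit s h1
    have h4 : a * (s' * xs j₀ - K₂ * E) ≤ a * acc k y s j₀ := by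
      have e1 : a * K₂ = C / p i₀ + K₁ * S + I.aBar := mul_div_cancel₀ _ ha0.ne'
      calc a * (s' * xs j₀ - K₂ * E) = s' * (a * xs j₀) - a * K₂ * E := by ring
        _ = s' * I.rate i₀ - (C / p i₀ + K₁ * S + I.aBar) * E := by rw [hax, e1]
        _ ≤ _ := by linarith
    exact le_of_mul_le_mul_left h4 ha0
  have hunstopped : ∀ s ≤ N,
      (∀ t < s, I.Sufficient (I.ffRun arr t₁ (fun i => L * I.rate i) L t).cap) →
      (∀ j, j ≠ j₀ → acc k y s j ≤ K₁ * E) ∧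
      s * I.rate i₀ - ∑ j, I.bom i₀ j * acc k y s j ≤ C / p i₀ * E := by
    intro s hsN hs
    set x := acc k y s with hx
    have hx0 : ∀ j, 0 ≤ x j := fun j => I.acc_ff_nonneg arr t₁ _ L s j
    -- On overused resources θ = p replaces θ̄, so that term vanishes. Only unused capacity and
    -- wrongly accepted types are controlled; the upper bound for j₀ comes from `bom_mul_acc_le`.
    have h1 := hgood.gap_le hgp hL h.opt hsN hs (θ := fun i =>
        if 0 ≤ s * I.rate i - ∑ j, I.bom i j * x j then 0 else p i)
        (fun i => by
          split_ifs
          · exact ⟨le_rfl, I.thetaBar_nonneg I.rate_pos⟩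
          · exact ⟨h.opt.price_nonneg i, (h.opt.price_le i).trans
              ((Finset.single_le_sum (fun k _ => I.alphaBar_nonneg k) (Finset.mem_univ i)).trans
                (I.sum_alphaBar_le_thetaBar I.rate_pos))⟩)
    have h3 := herr L s E hL ((Real.sqrt_le_sqrt (by
      have : (s : ℝ) ≤ N := by exact_mod_cast hsN
      linarith)).trans hLE)
    have hA : ∀ j, 0 ≤ I.reduced p j * (s * xs j - x j) := by
      intro j
      by_cases hj : j = j₀
      · rw [hj, hred0, zero_mul]
      · rw [h.xs_eq_zero hj]
        have h5 := hredneg j hj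
        have h6 := hx0 j
        nlinarith
    have hD : ∀ i, 0 ≤ (p i - if 0 ≤ s * I.rate i - ∑ j, I.bom i j * x j then 0 else p i)
        * (s * I.rate i - ∑ j, I.bom i j * x j) := by
      intro i
      split_ifs with hi
      · rw [sub_zero]; exact mul_nonneg (h.opt.price_nonneg i) hi
      · simp
    have hAsum := fun j => Finset.single_le_sum (fun k _ => hA k) (Finset.mem_univ j)
    have hDsum := Finset.single_le_sum (fun k _ => hD k) (Finset.mem_univ i₀)
    have hA0 := Finset.sum_nonneg fun j (_ : j ∈ Finset.univ) => hA j
    have hD0 := Finset.sum_nonneg fun i (_ : i ∈ Finset.univ) => hD i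
    constructor
    · intro j hj
      have h5 := hredneg j hj
      have h6 : |I.reduced p j| * x j ≤ C * E := by
        have h7 := hAsum j
        rw [h.xs_eq_zero hj, mul_zero, zero_sub, mul_neg] at h7
        rw [abs_of_neg h5]
        linarith
      have h8 : x j ≤ C / |I.reduced p j| * E := by
        rw [div_mul_eq_mul_div, le_div_iff₀ (abs_pos.2 h5.ne)]; linarith
      refine h8.trans (mul_le_mul_of_nonneg_right ?_ hE)
      exact Finset.single_le_sum (f := fun j => C / |I.reduced p j|)
        (fun k _ => by positivity) (Finset.mem_univ j)
    · rw [div_mul_eq_mul_div, le_div_iff₀ hp0]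
      split_ifs at hDsum with hi
      · linarith
      · have : (s * I.rate i₀ - ∑ j, I.bom i₀ j * x j) * p i₀ ≤ 0 :=
          mul_nonpos_of_nonpos_of_nonneg (not_le.1 hi).le hp0.le
        have : 0 ≤ C * E := by positivity
        linarith
  have hgoal : (∀ j, j ≠ j₀ → acc k y s j ≤ K₁ * E) ∧ s * xs j₀ - K₂ * E ≤ acc k y s j₀ := by
    rcases I.ff_stopped_cases arr t₁ (fun i => L * I.rate i) L s with
      hs | ⟨τ, hτs, hs, ⟨i, j₁, hij⟩, hacc⟩
    · obtain ⟨h1, h2⟩ := hunstopped s hsN hs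
      refine ⟨h1, hlower s h1 s ?_⟩
      have : 0 ≤ I.aBar * E := by positivity
      linarith
    · have hacc' : ∀ j, acc k y s j = acc k y τ j := hacc
      obtain ⟨h1, -⟩ := hunstopped τ (hτs.le.trans hsN) hs
      rw [hacc']
      refine ⟨fun j hj => by rw [hacc']; exact h1 j hj, hlower τ h1 s ?_⟩
      -- A resource that no type uses can never run short.
      have hi : i = i₀ := by
        by_contra hne
        rw [h.unused i hne] at hij
        exact hij.not_ge (I.ffRun_cap_nonneg arr t₁ L
          (fun i => (mul_pos hL (I.rate_pos i)).le) τ i)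
      subst hi
      have h2 := I.ffRun_cap arr t₁ (fun i => L * I.rate i) L τ i
      have h3 := I.bom_le_aBar i j₁
      have h4 : I.aBar ≤ I.aBar * E := le_mul_of_one_le_right hā.le hE1
      -- At the stop less than ā is left of L ϱ, and s ≤ L. Hence the consumption bound holds at s
      -- even if the run stopped early.
      have h5 : (s : ℝ) * I.rate i ≤ L * I.rate i := by
        have : (s : ℝ) ≤ N := by exact_mod_cast hsN
        exact mul_le_mul_of_nonneg_right (by linarith) (I.rate_pos i).le
      have h6 : 0 ≤ C / p i * E := by positivity
      linarith
  have e1 : 0 ≤ K₁ * E := by positivity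
  have e2 : 0 ≤ K₂ * E := by positivity
  refine ⟨fun j hj => ?_, ?_⟩
  · have := hgoal.1 j hj
    linarith
  · have := hgoal.2
    linarith

/-- The initial capacity alone bounds the acceptances of j₀, since L x*_j₀ customers of this type
exhaust i₀. This needs no typicality, but it refers to L rather than to the elapsed s. -/
lemma SingleResource.bom_mul_acc_le {I : NRM m n} {xs : Fin n → ℝ} {p : Fin m → ℝ}
    {i₀ : Fin m} {j₀ : Fin n} (h : I.SingleResource xs p i₀ j₀) (arr : ℕ → Fin n) (t₁ : ℕ)
    {L : ℝ} (hL : 0 < L) (s : ℕ) :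
    acc (fun t => arr (t₁ + t)) (I.ffDecision arr t₁ (fun i => L * I.rate i) L) s j₀
      ≤ L * xs j₀ := by
  have h1 := I.ff_consumption_le arr t₁ L
    (fun i => (mul_pos hL (I.rate_pos i)).le) s i₀
  have h2 := (Finset.single_le_sum (f := fun j => I.bom i₀ j * acc (fun t => arr (t₁ + t))
    (I.ffDecision arr t₁ (fun i => L * I.rate i) L) s j)
    (fun j _ => mul_nonneg (I.bom_nonneg i₀ j) (I.acc_ff_nonneg _ _ _ _ _ _))
    (Finset.mem_univ j₀)).trans h1
  rw [← h.bom_mul_xs] at h2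
  refine le_of_mul_le_mul_left ?_ h.bom_pos
  linarith

/-! ### Accounting along a sample path -/

section Accounting

variable (I : NRM m n) (arr : ℕ → Fin n) (T : ℕ) (α β γ : ℝ)

lemma acc_one_add (k : ℕ → Fin n) (s s' : ℕ) (j : Fin n) :
    acc k 1 (s + s') j = acc k 1 s j + acc (fun t => k (s + t)) 1 s' j := by
  simp only [acc, Finset.sum_range_add, Pi.one_apply]

lemma sum_acc_one (k : ℕ → Fin n) (s : ℕ) : ∑ j, acc k 1 s j = s := by
  have := sum_mul_acc k 1 1 s
  simpa using this

lemma acc_one_nonneg (k : ℕ → Fin n) (s : ℕ) (j : Fin n) : 0 ≤ acc k 1 s j :=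
  acc_nonneg (fun _ _ => zero_le_one) j

lemma acc_one_le (k : ℕ → Fin n) (s : ℕ) (j : Fin n) : acc k 1 s j ≤ s := by
  rw [← sum_acc_one k s]
  exact Finset.single_le_sum (fun j _ => acc_one_nonneg k s j) (Finset.mem_univ j)

lemma arrivals_eq_acc (j : Fin n) : (arrivals arr T j : ℝ) = acc (fun t => arr (1 + t)) 1 T j := by
  simp only [acc, Pi.one_apply]
  rw [Finset.range_eq_Ico, Finset.sum_Ico_add (fun t => if arr t = j then (1 : ℝ) else 0) 0 T 1,
    arrivals, Finset.card_filter]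
  push_cast
  refine Finset.sum_congr ?_ fun _ _ => rfl
  ext t
  simp only [Finset.mem_Icc, Finset.mem_Ico]
  omega

lemma cap₁_eq (hT : 0 < T) : I.cap₁ T α = fun i => (len₁ T α : ℝ) * I.rate i := by
  have : (T : ℝ) ≠ 0 := by positivity
  funext i
  rw [cap₁, capacity]
  field_simp

lemma cap₂_eq (hT : 0 < T) : I.cap₂ T α = fun i => ((T : ℝ) - len₁ T α) * I.rate i := by
  have : (T : ℝ) ≠ 0 := by positivity
  funext i
  rw [cap₂, capacity]
  field_simp

/-- Decisions of phase II along the real capacity process. -/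
noncomputable def realDec₂ (s : ℕ) : ℝ := I.dec₂ arr T α γ (I.real₂ arr T α γ s) s

/-- Decisions of phase III along the real capacity process. -/
noncomputable def realDec₃ (s : ℕ) : ℝ := I.dec₃ arr T α β γ (I.real₃ arr T α β γ s) s

/-- Types of the arrivals of phase II (and later), counted from the beginning of phase II. -/
noncomputable def types₂ (t : ℕ) : Fin n := arr (1 + len₁ T α + t)

/-- Types of the arrivals of phase III, counted from its beginning. -/
noncomputable def types₃ (t : ℕ) : Fin n := arr (1 + len₁ T α + len₂ T α β + t)

lemma realDec₂_nonneg (s : ℕ) : 0 ≤ I.realDec₂ arr T α γ s := by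
  simp only [realDec₂, dec₂]
  split_ifs
  exacts [le_rfl, zero_le_one, I.ffDecision_nonneg _ _ _ _ _, le_rfl]

lemma realDec₂_le_one (s : ℕ) : I.realDec₂ arr T α γ s ≤ 1 := by
  simp only [realDec₂, dec₂]
  split_ifs
  exacts [zero_le_one, le_rfl, I.ffDecision_le_one _ _ _ _ _, zero_le_one]

lemma realDec₃_nonneg (s : ℕ) : 0 ≤ I.realDec₃ arr T α β γ s := by
  simp only [realDec₃, dec₃]
  split_ifs
  exacts [I.ffDecision_nonneg _ _ _ _ _, le_rfl]

lemma realDec₃_le_one (s : ℕ) : I.realDec₃ arr T α β γ s ≤ 1 := by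
  simp only [realDec₃, dec₃]
  split_ifs
  exacts [I.ffDecision_le_one _ _ _ _ _, zero_le_one]

lemma real₂_succ (s : ℕ) (i : Fin m) : I.real₂ arr T α γ (s + 1) i = I.real₂ arr T α γ s i
    - I.realDec₂ arr T α γ s * I.bom i (types₂ arr T α s) := rfl

lemma real₃_succ (s : ℕ) (i : Fin m) : I.real₃ arr T α β γ (s + 1) i = I.real₃ arr T α β γ s i
    - I.realDec₃ arr T α β γ s * I.bom i (types₃ arr T α β s) := rfl

lemma real₂_eq (s : ℕ) (i : Fin m) : I.real₂ arr T α γ s i = I.cap₂ T α i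
    - ∑ j, I.bom i j * acc (types₂ arr T α) (I.realDec₂ arr T α γ) s j := by
  rw [sum_mul_acc]
  induction s with
  | zero => simp [real₂]
  | succ s ih => rw [real₂_succ, ih, Finset.sum_range_succ]; ring

lemma real₃_eq (s : ℕ) (i : Fin m) :
    I.real₃ arr T α β γ s i = I.real₂ arr T α γ (len₂ T α β) i
    - ∑ j, I.bom i j * acc (types₃ arr T α β) (I.realDec₃ arr T α β γ) s j := by
  rw [sum_mul_acc]
  induction s with
  | zero => simp [real₃]
  | succ s ih => rw [real₃_succ, ih, Finset.sum_range_succ]; ring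

variable {T} in
lemma real₂_nonneg (hT : 0 < T) (hl : len₁ T α ≤ T) (s : ℕ) (i : Fin m) :
    0 ≤ I.real₂ arr T α γ s i := by
  induction s with
  | zero =>
    have : (len₁ T α : ℝ) ≤ T := by exact_mod_cast hl
    simp only [real₂, cap₂_eq I T α hT]
    exact mul_nonneg (by linarith) (I.rate_pos i).le
  | succ s ih =>
    rw [real₂_succ]
    by_cases h : I.Sufficient (I.real₂ arr T α γ s)
    · have h1 := h (types₂ arr T α s) i
      have h2 := mul_le_of_le_one_left (I.bom_nonneg i (types₂ arr T α s))
        (I.realDec₂_le_one arr T α γ s)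
      linarith
    · have : I.realDec₂ arr T α γ s = 0 := by simp only [realDec₂, dec₂, if_neg h]
      rw [this]; simpa using ih

variable {T} in
lemma real₃_nonneg (hT : 0 < T) (hl : len₁ T α ≤ T) (s : ℕ) (i : Fin m) :
    0 ≤ I.real₃ arr T α β γ s i := by
  induction s with
  | zero => exact I.real₂_nonneg arr α γ hT hl _ i
  | succ s ih =>
    rw [real₃_succ]
    by_cases h : ∀ i, I.bom i (types₃ arr T α β s) ≤ I.real₃ arr T α β γ s i
    · have h2 := mul_le_of_le_one_left (I.bom_nonneg i (types₃ arr T α β s))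
        (I.realDec₃_le_one arr T α β γ s)
      linarith [h i]
    · have : I.realDec₃ arr T α β γ s = 0 := by
        simp only [realDec₃, dec₃]
        exact if_neg h
      rw [this]; simpa using ih

lemma fdRevenue_eq : I.fdRevenue T α β γ arr =
    ∑ j, I.rev j * acc (fun t => arr (1 + t)) (I.dec₁ arr T α) (len₁ T α) j
    + ∑ j, I.rev j * acc (types₂ arr T α) (I.realDec₂ arr T α γ) (len₂ T α β) j
    + ∑ j, I.rev j * acc (types₃ arr T α β) (I.realDec₃ arr T α β γ)
        (T - (len₁ T α + len₂ T α β)) j := by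
  rw [sum_mul_acc, sum_mul_acc, sum_mul_acc]
  rfl

variable {α β T} in
lemma arrivals_split (hl : len₁ T α + len₂ T α β ≤ T) (j : Fin n) :
    (arrivals arr T j : ℝ) = acc (fun t => arr (1 + t)) 1 (len₁ T α) j
      + acc (types₂ arr T α) 1 (T - len₁ T α) j := by
  rw [arrivals_eq_acc]
  conv_lhs => rw [show T = len₁ T α + (T - len₁ T α) by omega]
  rw [acc_one_add]
  congr 2
  funext t
  rw [types₂, add_assoc]

variable {α β T} in
lemma acc_types₂_split (hl : len₁ T α + len₂ T α β ≤ T) (j : Fin n) :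
    acc (types₂ arr T α) 1 (T - len₁ T α) j = acc (types₂ arr T α) 1 (len₂ T α β) j
      + acc (types₃ arr T α β) 1 (T - (len₁ T α + len₂ T α β)) j := by
  conv_lhs => rw [show T - len₁ T α = len₂ T α β + (T - (len₁ T α + len₂ T α β)) by omega]
  rw [acc_one_add]
  congr 2
  funext t
  rw [types₂, types₃, add_assoc, add_assoc, add_assoc]

variable {α β T} in
/-- The algorithm never earns more than the hindsight optimum. -/
lemma pathRegret_nonneg (hT : 0 < T) (hl : len₁ T α + len₂ T α β ≤ T) :
    0 ≤ I.pathRegret T α β γ arr := by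
  rw [pathRegret, fdRevenue_eq, sub_nonneg, ← Finset.sum_add_distrib, ← Finset.sum_add_distrib]
  simp_rw [← mul_add]
  have hl1 : len₁ T α ≤ T := by omega
  have hd₁ : ∀ t, 0 ≤ I.dec₁ arr T α t ∧ I.dec₁ arr T α t ≤ 1 := fun t =>
    ⟨I.ffDecision_nonneg _ _ _ _ _, I.ffDecision_le_one _ _ _ _ _⟩
  refine I.le_hindsight ⟨fun i => ?_, fun j => ⟨?_, ?_⟩⟩
  · have h1 := I.ff_consumption_le arr 1 (B := I.cap₁ T α) (len₁ T α) (fun i => by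
      rw [cap₁_eq I T α hT]; exact mul_nonneg (Nat.cast_nonneg _) (I.rate_pos i).le) (len₁ T α) i
    have h2 := I.real₃_nonneg arr α β γ hT hl1 (T - (len₁ T α + len₂ T α β)) i
    rw [real₃_eq, real₂_eq] at h2
    have h3 : I.cap₁ T α i + I.cap₂ T α i = I.capacity T i := by
      rw [cap₁_eq I T α hT, cap₂_eq I T α hT, capacity]; ring
    simp_rw [mul_add, Finset.sum_add_distrib]
    have h4 : ∑ j, I.bom i j * acc (fun t => arr (1 + t)) (I.dec₁ arr T α) (len₁ T α) j
      ≤ I.cap₁ T α i := h1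
    linarith
  · refine add_nonneg (add_nonneg ?_ ?_) ?_
    · exact acc_nonneg (fun t _ => (hd₁ t).1) j
    · exact acc_nonneg (fun t _ => I.realDec₂_nonneg _ _ _ _ _) j
    · exact acc_nonneg (fun t _ => I.realDec₃_nonneg _ _ _ _ _ _) j
  · beta_reduce
    rw [arrivals_split arr hl, acc_types₂_split arr hl, add_assoc]
    refine add_le_add ?_ (add_le_add ?_ ?_)
    · exact acc_mono (fun t _ => (hd₁ t).2) j
    · exact acc_mono (fun t _ => I.realDec₂_le_one _ _ _ _ _) j
    · exact acc_mono (fun t _ => I.realDec₃_le_one _ _ _ _ _ _) j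

end Accounting

/-! ### Phase III -/

section LastPhase

variable (I : NRM m n) (arr : ℕ → Fin n) {T : ℕ} {α β γ : ℝ}

lemma realDec₃_le_ff (s : ℕ) : I.realDec₃ arr T α β γ s ≤
    I.ffDecision arr (1 + len₁ T α + len₂ T α β) (I.cap₃ arr T α β γ)
      ((T : ℝ) - len₁ T α - len₂ T α β) s := by
  simp only [realDec₃, dec₃]
  split_ifs
  exacts [le_rfl, I.ffDecision_nonneg _ _ _ _ _]

lemma rpow_le_cap₃ (i : Fin m) :
    (T : ℝ) ^ (3 * (1 / 2 + β) / 4) ≤ I.cap₃ arr T α β γ i := le_max_left _ _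

lemma cap₃_pos (hT : 0 < T) (i : Fin m) : 0 < I.cap₃ arr T α β γ i :=
  (Real.rpow_pos_of_pos (by exact_mod_cast hT) _).trans_le (I.rpow_le_cap₃ arr i)

/-- The revenue lost because the real capacity of phase III may be smaller than the virtual one. -/
lemma virtual_revenue_le {κ : ℝ} (hκ : 0 < κ) (hκb : ∀ i j, I.bom i j ≠ 0 → κ ≤ I.bom i j)
    (hT : 0 < T) (hl : len₁ T α ≤ T) (s : ℕ) :
    ∑ j, I.rev j * acc (types₃ arr T α β)
      (I.ffDecision arr (1 + len₁ T α + len₂ T α β) (I.cap₃ arr T α β γ)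
        ((T : ℝ) - len₁ T α - len₂ T α β)) s j
    ≤ ∑ j, I.rev j * acc (types₃ arr T α β) (I.realDec₃ arr T α β γ) s j
      + (∑ j, I.rev j) / κ * (m * (T : ℝ) ^ (3 * (1 / 2 + β) / 4)) := by
  classical
  set t₁ := 1 + len₁ T α + len₂ T α β with ht₁
  set L := (T : ℝ) - len₁ T α - len₂ T α β with hL
  set B := I.cap₃ arr T α β γ with hB
  set y := I.ffDecision arr t₁ B L with hy
  set k := types₃ arr T α β with hk
  set R := ∑ j, I.rev j with hR
  have hB0 : ∀ i, 0 ≤ B i := fun i => (I.cap₃_pos arr hT i).le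
  have hR0 : 0 ≤ R := Finset.sum_nonneg fun j _ => I.rev_nonneg j
  -- The resources whose virtual capacity was raised above the real one.
  let D : Finset (Fin m) := Finset.univ.filter fun i => I.real₂ arr T α γ (len₂ T α β) i < B i
  -- Real acceptances are a subset of the virtual ones, so outside D the real capacity stays above
  -- the virtual capacity throughout.
  have hmargin : ∀ i ∉ D, ∀ t, (I.ffRun arr t₁ B L t).cap i ≤ I.real₃ arr T α β γ t i := by
    intro i hi t
    have h0 : B i ≤ I.real₂ arr T α γ (len₂ T α β) i := by simpa [D] using hi
    rw [ffRun_cap, real₃_eq]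
    have : ∑ j, I.bom i j * acc k (I.realDec₃ arr T α β γ) t j ≤ ∑ j, I.bom i j * acc k y t j :=
      Finset.sum_le_sum fun j _ => mul_le_mul_of_nonneg_left
        (acc_mono (fun t _ => I.realDec₃_le_ff arr t) j) (I.bom_nonneg i j)
    have h1 : ∑ j, I.bom i j * acc (fun t => arr (t₁ + t)) (I.ffDecision arr t₁ B L) t j
      = ∑ j, I.bom i j * acc k y t j := rfl
    rw [h1]
    linarith
  -- A virtual acceptance that does not fit is charged to a resource in D, of which the virtual run
  -- consumes at least κ in that period.
  have hstep : ∀ t, y t ≤ I.realDec₃ arr T α β γ t + ∑ i ∈ D, y t * I.bom i (k t) / κ := by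
    intro t
    have hnn : ∀ i ∈ D, 0 ≤ y t * I.bom i (k t) / κ := fun i _ =>
      div_nonneg (mul_nonneg (I.ffDecision_nonneg _ _ _ _ _) (I.bom_nonneg _ _)) hκ.le
    by_cases hfit : ∀ i, I.bom i (k t) ≤ I.real₃ arr T α β γ t i
    · have h1 : I.realDec₃ arr T α β γ t = y t := by
        simp only [realDec₃, dec₃]
        exact if_pos hfit
      rw [h1]
      linarith [Finset.sum_nonneg hnn]
    · rcases I.ffDecision_eq arr t₁ B L t with h0 | h1
      · have h2 := I.realDec₃_nonneg arr T α β γ t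
        have h3 := Finset.sum_nonneg hnn
        have h4 : y t = 0 := h0
        linarith
      · have hy1 : y t = 1 := h1
        push Not at hfit
        obtain ⟨i, hi⟩ := hfit
        have hsuff : I.Sufficient (I.ffRun arr t₁ B L t).cap := by
          by_contra hns
          rw [I.ffDecision_of_not_sufficient _ _ _ _ hns] at h1
          exact zero_ne_one h1
        have hiD : i ∈ D := by
          by_contra hiD
          exact absurd ((hsuff (k t) i).trans (hmargin i hiD t)) hi.not_ge
        have hb : I.bom i (k t) ≠ 0 := by
          have := I.real₃_nonneg arr α β γ hT hl t i
          exact (this.trans_lt hi).ne'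
        have h3 : 1 ≤ y t * I.bom i (k t) / κ := by
          rw [hy1, one_mul, one_le_div hκ]; exact hκb _ _ hb
        have h4 := Finset.single_le_sum hnn hiD
        have h5 := I.realDec₃_nonneg arr T α β γ t
        linarith
  -- On D the virtual capacity is the floor T^(3b/4), which therefore bounds the total charge per
  -- resource.
  have hdef : ∀ i ∈ D, B i = (T : ℝ) ^ (3 * (1 / 2 + β) / 4) := by
    intro i hi
    have h0 : I.real₂ arr T α γ (len₂ T α β) i < B i := by simpa [D] using hi
    rw [hB, cap₃] at h0 ⊢
    rcases max_choice ((T : ℝ) ^ (3 * (1 / 2 + β) / 4))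
      (min (I.real₂ arr T α γ (len₂ T α β) i) (I.aBar * (T : ℝ) ^ (1 / 2 + β))) with h | h
    · exact h
    · rw [h] at h0
      exact absurd (min_le_left _ _) h0.not_ge
  rw [sum_mul_acc, sum_mul_acc]
  have hQ : 0 ≤ (T : ℝ) ^ (3 * (1 / 2 + β) / 4) := Real.rpow_nonneg (Nat.cast_nonneg _) _
  calc ∑ t ∈ Finset.range s, I.rev (k t) * y t
      ≤ ∑ t ∈ Finset.range s, (I.rev (k t) * I.realDec₃ arr T α β γ t
          + R / κ * ∑ i ∈ D, I.bom i (k t) * y t) := by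
        refine Finset.sum_le_sum fun t _ => ?_
        have h1 := mul_le_mul_of_nonneg_left (hstep t) (I.rev_nonneg (k t))
        have h2 : ∑ i ∈ D, y t * I.bom i (k t) / κ = (∑ i ∈ D, I.bom i (k t) * y t) / κ := by
          rw [Finset.sum_div]; exact Finset.sum_congr rfl fun i _ => by ring
        have h3 : 0 ≤ (∑ i ∈ D, I.bom i (k t) * y t) / κ :=
          div_nonneg (Finset.sum_nonneg fun i _ =>
            mul_nonneg (I.bom_nonneg _ _) (I.ffDecision_nonneg _ _ _ _ _)) hκ.le
        have h4 : I.rev (k t) * ((∑ i ∈ D, I.bom i (k t) * y t) / κ)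
            ≤ R * ((∑ i ∈ D, I.bom i (k t) * y t) / κ) :=
          mul_le_mul_of_nonneg_right
            (Finset.single_le_sum (fun j _ => I.rev_nonneg j) (Finset.mem_univ _)) h3
        rw [h2, mul_add] at h1
        calc _ ≤ _ := h1
          _ ≤ _ := add_le_add le_rfl h4
          _ = _ := by ring
    _ = ∑ t ∈ Finset.range s, I.rev (k t) * I.realDec₃ arr T α β γ t
          + R / κ * ∑ i ∈ D, ∑ t ∈ Finset.range s, I.bom i (k t) * y t := by
        rw [Finset.sum_add_distrib, ← Finset.mul_sum, Finset.sum_comm]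
    _ ≤ ∑ t ∈ Finset.range s, I.rev (k t) * I.realDec₃ arr T α β γ t
          + R / κ * (m * (T : ℝ) ^ (3 * (1 / 2 + β) / 4)) := by
        gcongr
        calc ∑ i ∈ D, ∑ t ∈ Finset.range s, I.bom i (k t) * y t
            ≤ ∑ _i ∈ D, (T : ℝ) ^ (3 * (1 / 2 + β) / 4) := by
              refine Finset.sum_le_sum fun i hi => ?_
              have h1 := I.ff_consumption_le arr t₁ L hB0 s i
              rw [sum_mul_acc, hdef i hi] at h1
              exact h1
          _ ≤ ∑ _i : Fin m, (T : ℝ) ^ (3 * (1 / 2 + β) / 4) :=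
              Finset.sum_le_sum_of_subset_of_nonneg (Finset.subset_univ _) fun _ _ _ => hQ
          _ = _ := by simp

end LastPhase

/-- Phase III earns as much as any packing of its arrivals, up to the error terms. -/
lemma GeneralPosition.exists_lastPhase_le {I : NRM m n} (hgp : I.GeneralPosition) :
    ∃ C > 0, ∀ (arr : ℕ → Fin n) (T : ℕ) (α β γ q l E : ℝ), 0 < T →
      len₁ T α + len₂ T α β ≤ T → 1 ≤ q → 1 ≤ l → (T : ℝ) ^ (1 / 2 + β) = q ^ 4 →
      (T : ℝ) ^ (3 * (1 / 2 + β) / 4) = q ^ 3 →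
      ((T - (len₁ T α + len₂ T α β) : ℕ) : ℝ) ≤ q ^ 4 →
      q ^ 4 / 2 ≤ ((T - (len₁ T α + len₂ T α β) : ℕ) : ℝ) → E ≤ 2 * q ^ 2 * l →
      I.GoodRun arr (1 + len₁ T α + len₂ T α β) (I.cap₃ arr T α β γ)
        ((T - (len₁ T α + len₂ T α β) : ℕ) : ℝ) (T - (len₁ T α + len₂ T α β)) E →
      ∀ u ∈ I.feasible (I.real₂ arr T α γ (len₂ T α β))
        (acc (types₃ arr T α β) 1 (T - (len₁ T α + len₂ T α β))),
      ∑ j, I.rev j * u j ≤ ∑ j, I.rev j * acc (types₃ arr T α β) (I.realDec₃ arr T α β γ)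
        (T - (len₁ T α + len₂ T α β)) j + C * (q ^ 3 * l) := by
  obtain ⟨κ, hκ, hκb⟩ := I.exists_pos_le_bom
  have hā := I.aBar_pos
  set R := ∑ j, I.rev j with hR
  have hR0 : 0 ≤ R := Finset.sum_nonneg fun j _ => I.rev_nonneg j
  set S := ∑ i, ∑ j, I.bom i j with hS
  have hS0 : 0 ≤ S :=
    Finset.sum_nonneg fun i _ => Finset.sum_nonneg fun j _ => I.bom_nonneg i j
  set A := ∑ i, I.alphaBar i with hA
  have hA0 : 0 ≤ A := I.sum_alphaBar_nonneg
  set Θ := (1 + I.aBar) * A with hΘ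
  have hΘ0 : 0 ≤ Θ := by positivity
  set G := 2 * (1 + I.aBar) * √(m : ℝ) + I.aBar * √(m : ℝ) with hG
  have hG0 : 0 ≤ G := by positivity
  refine ⟨2 * m * √(m : ℝ) * (G * Θ) + R * 2 + Θ * 2 * S + Θ * I.aBar + R * 2 + R / κ * m + 1,
    by positivity, ?_⟩
  intro arr T α β γ q l E hT hl hq hl1 hW hQ hN hN' hE hgood u hu
  set N := T - (len₁ T α + len₂ T α β) with hNdef
  have hcast : (T : ℝ) - len₁ T α - len₂ T α β = (N : ℝ) := by
    rw [hNdef, Nat.cast_sub hl]; push_cast; ring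
  have hq0 : 0 < q := by linarith
  have hNpos : 0 < (N : ℝ) := lt_of_lt_of_le (by positivity) hN'
  have hNpos' : 0 < N := by exact_mod_cast hNpos
  set B := I.cap₃ arr T α β γ with hB
  have hBpos : ∀ i, 0 < B i := I.cap₃_pos arr hT
  have hBlow : ∀ i, q ^ 3 ≤ B i := fun i => by
    rw [← hQ]; exact I.rpow_le_cap₃ arr i
  have hq34 : q ^ 3 ≤ q ^ 4 := pow_le_pow_right₀ hq (by norm_num)
  have hBup : ∀ i, B i ≤ (1 + I.aBar) * q ^ 4 := fun i => by
    have h0 : 0 ≤ I.aBar * q ^ 4 := by positivity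
    rw [hB, cap₃, hQ, hW]
    refine max_le (by linarith) ((min_le_right _ _).trans ?_)
    have : 0 ≤ q ^ 4 := by positivity
    linarith
  have := I.nonempty_resources
  have hsup : (⨆ i, B i) ≤ (1 + I.aBar) * q ^ 4 := ciSup_le hBup
  have hinf : q ^ 3 ≤ ⨅ i, B i := le_ciInf hBlow
  have hθ0 := I.thetaBar_nonneg hBpos
  -- The floor q³ and the cap of order q⁴ keep the capacity ratio O(q). Multiplied by √N ≤ q² this
  -- gives q³, the same order as the loss caused by the floor.
  have hθ : I.thetaBar B ≤ Θ * q := by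
    have h1 : (⨆ i, B i) / (⨅ i, B i) ≤ (1 + I.aBar) * q := by
      rw [div_le_iff₀ (lt_of_lt_of_le (by positivity) hinf)]
      calc _ ≤ (1 + I.aBar) * q ^ 4 := hsup
        _ = (1 + I.aBar) * q * q ^ 3 := by ring
        _ ≤ _ := by gcongr
    calc I.thetaBar B ≤ (1 + I.aBar) * q * A := mul_le_mul_of_nonneg_right h1 hA0
      _ = _ := by rw [hΘ]; ring
  have hGB0 := I.gradBound_pos hBpos hNpos
  have hGB : I.gradBound B N ≤ G := by
    have h1 : (⨆ i, B i) / N ≤ 2 * (1 + I.aBar) := by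
      rw [div_le_iff₀ hNpos]
      nlinarith
    rw [gradBound, hG]
    gcongr
  have hsqrt : √(N : ℝ) ≤ q ^ 2 := by
    rw [Real.sqrt_le_left (by positivity)]; linarith [show (q ^ 2) ^ 2 = q ^ 4 by ring]
  have hE0 := hgood.nonneg
  have hq3l : q ^ 3 ≤ q ^ 3 * l := le_mul_of_one_le_right (by positivity) hl1
  have hq2l : q ^ 2 * l ≤ q ^ 3 * l := by
    gcongr
    norm_num
  have hqq : q ≤ q ^ 3 * l := (le_self_pow₀ hq (by norm_num)).trans hq3l
  have herr : I.ffError B N N E ≤ 2 * m * √(m : ℝ) * (G * Θ) * (q ^ 3 * l)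
      + R * 2 * (q ^ 3 * l) + Θ * 2 * S * (q ^ 3 * l) := by
    rw [ffError]
    refine add_le_add (add_le_add ?_ ?_) ?_
    · calc 2 * m * √(m : ℝ) * (I.gradBound B N * I.thetaBar B * √(N : ℝ))
          ≤ 2 * m * √(m : ℝ) * (G * (Θ * q) * q ^ 2) := by gcongr
        _ = 2 * m * √(m : ℝ) * (G * Θ) * q ^ 3 := by ring
        _ ≤ _ := by gcongr
    · calc R * E ≤ R * (2 * q ^ 2 * l) := by gcongr
        _ = R * 2 * (q ^ 2 * l) := by ring
        _ ≤ _ := by gcongr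
    · calc I.thetaBar B * E * S ≤ Θ * q * (2 * q ^ 2 * l) * S := by gcongr
        _ = _ := by ring
  have hpack := hgood.packing_le hgp hBpos hNpos' (u := u) ⟨fun i => ?_, hu.2⟩
  · have hvirt := I.virtual_revenue_le arr (α := α) (β := β) (γ := γ) hκ hκb hT
      (by omega : len₁ T α ≤ T) N
    rw [hcast, hQ] at hvirt
    have hsame : ∑ j, I.rev j * acc (fun t => arr (1 + len₁ T α + len₂ T α β + t))
      (I.ffDecision arr (1 + len₁ T α + len₂ T α β) B N) N j
      = ∑ j, I.rev j * acc (types₃ arr T α β)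
      (I.ffDecision arr (1 + len₁ T α + len₂ T α β) (I.cap₃ arr T α β γ) N) N j := rfl
    rw [hsame] at hpack
    have h1 : I.thetaBar B * I.aBar ≤ Θ * I.aBar * (q ^ 3 * l) := by
      calc _ ≤ Θ * q * I.aBar := by gcongr
        _ = Θ * I.aBar * q := by ring
        _ ≤ _ := by gcongr
    have h2 : R * E ≤ R * 2 * (q ^ 3 * l) := by
      calc R * E ≤ R * (2 * q ^ 2 * l) := by gcongr
        _ = R * 2 * (q ^ 2 * l) := by ring
        _ ≤ _ := by gcongr
    have h3 : R / κ * (m * q ^ 3) ≤ R / κ * m * (q ^ 3 * l) := by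
      calc _ = R / κ * m * q ^ 3 := by ring
        _ ≤ _ := by gcongr
    have h4 : 0 ≤ q ^ 3 * l := by positivity
    linarith
  -- Truncating the real capacity at ā T^b is harmless: at most q⁴ arrivals cannot consume more.
  · have h1 : ∑ j, I.bom i j * u j ≤ I.aBar * q ^ 4 := by
      calc ∑ j, I.bom i j * u j
          ≤ ∑ j, I.aBar * acc (types₃ arr T α β) 1 N j :=
            Finset.sum_le_sum fun j _ =>
              mul_le_mul (I.bom_le_aBar i j) (hu.2 j).2 (hu.2 j).1 hā.le
        _ = I.aBar * N := by rw [← Finset.mul_sum, sum_acc_one]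
        _ ≤ _ := by gcongr
    rw [hB, cap₃, hW]
    exact (le_min (hu.1 i) h1).trans (le_max_right _ _)

/-! ### Phase I -/

/-- Types with positive arrival probability are classified as in the fluid solution. -/
structure Classified (I : NRM m n) (arr : ℕ → Fin n) (T : ℕ) (α γ : ℝ) (xs : Fin n → ℝ) :
    Prop where
  reject : ∀ j, 0 < I.lam j → xs j = 0 → I.InReject arr T α γ j
  accept : ∀ j, 0 < I.lam j → xs j = I.lam j → I.InAccept arr T α γ j
  neither : ∀ j, 0 < xs j → xs j < I.lam j →
    ¬ I.InReject arr T α γ j ∧ ¬ I.InAccept arr T α γ j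

/-- A positive lower bound for the nonzero slacks of a fluid solution. -/
structure SlackBound (I : NRM m n) (xs : Fin n → ℝ) (μ : ℝ) : Prop where
  pos : 0 < μ
  le_one : μ ≤ 1
  lam : ∀ j, 0 < I.lam j → μ ≤ I.lam j
  sol : ∀ j, 0 < xs j → μ ≤ xs j
  slack : ∀ j, xs j < I.lam j → μ ≤ I.lam j - xs j
  rate : ∀ i, μ ≤ I.rate i

lemma exists_slackBound (I : NRM m n) (xs : Fin n → ℝ) : ∃ μ, I.SlackBound xs μ := by
  have key : ∀ a : ℝ, ∀ᶠ μ in 𝓝[>] (0 : ℝ), 0 < a → μ ≤ a := by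
    intro a
    by_cases ha : 0 < a
    · filter_upwards [nhdsWithin_le_nhds (eventually_le_nhds ha)] with μ hμ _ using hμ
    · simp [ha]
  have h1 := eventually_all.2 fun j => key (I.lam j)
  have h2 := eventually_all.2 fun j => key (xs j)
  have h3 := eventually_all.2 fun j => key (I.lam j - xs j)
  have h4 := eventually_all.2 fun i => key (I.rate i)
  obtain ⟨μ, hμ, h0, h1, h2, h3, h4⟩ :=
    ((eventually_mem_nhdsWithin (s := Set.Ioi (0 : ℝ))).and
      ((key 1).and (h1.and (h2.and (h3.and h4))))).exists
  exact ⟨μ, hμ, h0 one_pos, h1, h2, fun j hj => h3 j (sub_pos.2 hj), fun i => h4 i (I.rate_pos i)⟩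

/-- The count error E is below the threshold scale T^c, and T^c is small against T^α times every
nonzero slack. So the thresholds separate fluid values 0, λ_j and those strictly between. -/
lemma SlackBound.classified {I : NRM m n} {xs : Fin n → ℝ} {μ : ℝ} (hμ : I.SlackBound xs μ)
    (hlam : ∀ j, xs j ≤ I.lam j) {arr : ℕ → Fin n} {T : ℕ} {α γ E : ℝ}
    (hE : E < μ * (T : ℝ) ^ (α / 2 + γ))
    (hc : 1 + 2 * (T : ℝ) ^ (α / 2 + γ) ≤ μ * (T : ℝ) ^ α)
    (h : ∀ j, |acc (fun t => arr (1 + t)) (I.dec₁ arr T α) (len₁ T α) j - len₁ T α * xs j| ≤ E) :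
    I.Classified arr T α γ xs := by
  set Tc := (T : ℝ) ^ (α / 2 + γ) with hTc
  set Ta := (T : ℝ) ^ α with hTa
  have hTc0 : 0 ≤ Tc := Real.rpow_nonneg (Nat.cast_nonneg _) _
  have hTa0 : 0 ≤ Ta := Real.rpow_nonneg (Nat.cast_nonneg _) _
  have hlo : Ta ≤ len₁ T α := Nat.le_ceil _
  have hup : (len₁ T α : ℝ) ≤ Ta + 1 := (Nat.ceil_lt_add_one hTa0).le
  have hcount : ∀ j, I.count₁ arr T α j
      = acc (fun t => arr (1 + t)) (I.dec₁ arr T α) (len₁ T α) j := fun j => rfl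
  have hacc : ∀ j, 0 < I.lam j → xs j = I.lam j →
      I.lam j * (Ta - Tc) < I.count₁ arr T α j := by
    intro j hj hx
    have h1 := (abs_le.1 (h j)).1
    rw [hx, ← hcount] at h1
    have h2 : I.lam j * Ta ≤ len₁ T α * I.lam j := by
      rw [mul_comm]; exact mul_le_mul_of_nonneg_right hlo hj.le
    have h3 := mul_le_mul_of_nonneg_right (hμ.lam j hj) hTc0
    linarith
  -- The accept threshold lies above the reject threshold, which matters because rejection has
  -- priority.
  have h2Tc : 2 * Tc ≤ Ta := by
    have := mul_le_of_le_one_left hTa0 hμ.le_one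
    linarith
  refine ⟨fun j hj hx => ?_, fun j hj hx => ⟨?_, hacc j hj hx⟩, fun j hx hx' => ⟨?_, ?_⟩⟩
  · have h1 := (abs_le.1 (h j)).2
    rw [hx, mul_zero, sub_zero, ← hcount] at h1
    have h3 := mul_le_mul_of_nonneg_right (hμ.lam j hj) hTc0
    rw [InReject]
    linarith
  · rw [InReject, not_lt]
    refine le_trans ?_ (hacc j hj hx).le
    exact mul_le_mul_of_nonneg_left (by linarith) hj.le
  · have h1 := (abs_le.1 (h j)).1
    rw [← hcount] at h1
    rw [InReject, not_lt]
    have h2 : xs j * Ta ≤ len₁ T α * xs j := by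
      rw [mul_comm]; exact mul_le_mul_of_nonneg_right hlo hx.le
    have h3 := mul_le_mul_of_nonneg_right (hμ.sol j hx) hTa0
    have h4 : I.lam j * Tc ≤ Tc := mul_le_of_le_one_left hTc0 (I.lam_le_one j)
    have h5 : μ * Tc ≤ Tc := mul_le_of_le_one_left hTc0 hμ.le_one
    linarith
  · rintro ⟨-, hgt⟩
    have h1 := (abs_le.1 (h j)).2
    rw [← hcount] at h1
    have h2 : len₁ T α * xs j ≤ (Ta + 1) * xs j := mul_le_mul_of_nonneg_right hup hx.le
    have h3 := mul_le_mul_of_nonneg_right (hμ.slack j hx') hTa0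
    have h4 : I.lam j * Tc ≤ Tc := mul_le_of_le_one_left hTc0 (I.lam_le_one j)
    have h5 : μ * Tc ≤ Tc := mul_le_of_le_one_left hTc0 hμ.le_one
    have h6 : xs j ≤ 1 := (hlam j).trans (I.lam_le_one j)
    have h7 : I.lam j * (Ta - Tc) = I.lam j * Ta - I.lam j * Tc := by ring
    have h8 : (Ta + 1) * xs j = xs j * Ta + xs j := by ring
    have h9 : (I.lam j - xs j) * Ta = I.lam j * Ta - xs j * Ta := by ring
    linarith [hgt]

/-! ### The hindsight optimum of the last two phases -/

/-- Optimal packings of typical arrivals are close to the fluid solution. -/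
lemma OptPair.exists_optimal_dist_le {I : NRM m n} {xs : Fin n → ℝ} {p : Fin m → ℝ}
    (hopt : I.OptPair xs p) (hgp : I.GeneralPosition) :
    ∃ K > 0, ∀ (L E : ℝ) (N : Fin n → ℝ), 0 ≤ L → 0 ≤ E → (∀ j, 0 ≤ N j) →
      (∀ j, |N j - L * I.lam j| ≤ E) → ∀ z ∈ I.feasible (fun i => L * I.rate i) N,
      (∀ u ∈ I.feasible (fun i => L * I.rate i) N, ∑ j, I.rev j * u j ≤ ∑ j, I.rev j * z j) →
      ∀ j, |z j - L * xs j| ≤ K * E := by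
  -- A packing respects the capacities, so its slacks are nonnegative and the prices themselves
  -- serve as weights; no room below θ̄ is needed.
  obtain ⟨K, hK, hdist⟩ := hopt.exists_dist_le hgp hopt.price_nonneg
    fun i hi => (hopt.price_nonneg i).lt_of_ne' hi
  set R := ∑ j, I.rev j with hR
  have hR0 : 0 ≤ R := Finset.sum_nonneg fun j _ => I.rev_nonneg j
  refine ⟨K * (1 + R), by positivity, fun L E N hL hE hN0 hN z hz hzopt => ?_⟩
  rw [mul_assoc]
  have hEE : E ≤ (1 + R) * E := by nlinarith
  refine hdist z L ((1 + R) * E) (by positivity) (fun j => (hz.2 j).1) (fun j => ?_) ?_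
  · have h1 := (hz.2 j).2
    have h2 := (abs_le.1 (hN j)).2
    linarith
  -- The fluid solution truncated at the arrivals is a packing, so the optimal z earns the fluid
  -- value up to O(E).
  · have h1 := hzopt (fun j => min (L * xs j) (N j)) ⟨fun i => ?_, fun j =>
      ⟨le_min (mul_nonneg hL (hopt.nonneg j)) (hN0 j), min_le_right _ _⟩⟩
    · have h2 : L * ∑ j, I.rev j * xs j - R * E ≤ ∑ j, I.rev j * min (L * xs j) (N j) := by
        rw [Finset.mul_sum, Finset.sum_mul, ← Finset.sum_sub_distrib]
        refine Finset.sum_le_sum fun j _ => ?_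
        have h3 : L * xs j - E ≤ min (L * xs j) (N j) := by
          refine le_min (by linarith) ?_
          have h4 := (abs_le.1 (hN j)).1
          have h5 := mul_le_mul_of_nonneg_left (hopt.le_lam j) hL
          linarith
        have := mul_le_mul_of_nonneg_left h3 (I.rev_nonneg j)
        linarith
      have h3 := hopt.gap_eq L z
      have h4 : ∑ i, p i * |L * I.rate i - ∑ j, I.bom i j * z j|
          = ∑ i, p i * (L * I.rate i - ∑ j, I.bom i j * z j) :=
        Finset.sum_congr rfl fun i _ => by rw [abs_of_nonneg (sub_nonneg.2 (hz.1 i))]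
      rw [h4]
      linarith
    · calc _ ≤ ∑ j, I.bom i j * (L * xs j) := Finset.sum_le_sum fun j _ =>
            mul_le_mul_of_nonneg_left (min_le_left _ _) (I.bom_nonneg i j)
        _ = L * ∑ j, I.bom i j * xs j := by
            rw [Finset.mul_sum]; exact Finset.sum_congr rfl fun j _ => by ring
        _ ≤ _ := mul_le_mul_of_nonneg_left (hopt.feas i) hL

/-- Giving up phase I costs at most its length. -/
lemma hindsight_le_of_optimal (I : NRM m n) {arr : ℕ → Fin n} {T : ℕ} {α β : ℝ} (hT : 0 < T)
    (hl : len₁ T α + len₂ T α β ≤ T) {z : Fin n → ℝ}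
    (hz : ∀ u ∈ I.feasible (fun i => ((T : ℝ) - len₁ T α) * I.rate i)
      (acc (types₂ arr T α) 1 (T - len₁ T α)), ∑ j, I.rev j * u j ≤ ∑ j, I.rev j * z j) :
    I.hindsight T arr ≤ ∑ j, I.rev j * z j + (∑ j, I.rev j) * len₁ T α := by
  have hT0 : (0 : ℝ) < T := by exact_mod_cast hT
  have hlT : (len₁ T α : ℝ) ≤ T := by exact_mod_cast (by omega : len₁ T α ≤ T)
  set c := ((T : ℝ) - len₁ T α) / T with hc
  have hc0 : 0 ≤ c := div_nonneg (by linarith) hT0.le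
  have hcT : c * T = T - len₁ T α := div_mul_cancel₀ _ hT0.ne'
  refine I.hindsight_le fun v hv => ?_
  -- Scaling a packing of the whole horizon by (T - l₁)/T makes it fit the capacity left after phase
  -- I; truncation at the later arrivals also removes at most l₁ per type.
  have h1 := hz (fun j => min (c * v j) (acc (types₂ arr T α) 1 (T - len₁ T α) j))
    ⟨fun i => ?_, fun j => ⟨le_min (mul_nonneg hc0 (hv.2 j).1) (acc_one_nonneg _ _ _),
      min_le_right _ _⟩⟩
  · refine le_trans ?_ (add_le_add h1 le_rfl)
    rw [Finset.sum_mul, ← Finset.sum_add_distrib]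
    refine Finset.sum_le_sum fun j _ => ?_
    rw [← mul_add]
    refine mul_le_mul_of_nonneg_left ?_ (I.rev_nonneg j)
    rw [← sub_le_iff_le_add]
    have h2 : v j ≤ arrivals arr T j := (hv.2 j).2
    have h3 : (arrivals arr T j : ℝ) ≤ T := by rw [arrivals_eq_acc]; exact acc_one_le _ _ _
    refine le_min ?_ ?_
    · have h4 : (1 - c) * v j ≤ (1 - c) * T := by
        refine mul_le_mul_of_nonneg_left (h2.trans h3) ?_
        rw [sub_nonneg, hc, div_le_one hT0]
        have : (0 : ℝ) ≤ len₁ T α := Nat.cast_nonneg _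
        linarith
      linarith
    · rw [arrivals_split arr hl] at h2
      have := acc_one_le (fun t => arr (1 + t)) (len₁ T α) j
      linarith
  · calc _ ≤ ∑ j, I.bom i j * (c * v j) := Finset.sum_le_sum fun j _ =>
          mul_le_mul_of_nonneg_left (min_le_left _ _) (I.bom_nonneg i j)
      _ = c * ∑ j, I.bom i j * v j := by
          rw [Finset.mul_sum]; exact Finset.sum_congr rfl fun j _ => by ring
      _ ≤ c * I.capacity T i := mul_le_mul_of_nonneg_left (hv.1 i) hc0
      _ = _ := by rw [capacity, ← mul_assoc, hcT]

/-! ### Phase II -/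

/-- Decisions of the virtual run of phase II. -/
noncomputable def virtualDec₂ (I : NRM m n) (arr : ℕ → Fin n) (T : ℕ) (α : ℝ) : ℕ → ℝ :=
  I.ffDecision arr (1 + len₁ T α) (fun i => ((T : ℝ) - len₁ T α) * I.rate i) ((T : ℝ) - len₁ T α)

open Classical in
lemma realDec₂_of_sufficient (I : NRM m n) {arr : ℕ → Fin n} {T : ℕ} {α γ : ℝ} (hT : 0 < T)
    {s : ℕ} (h : I.Sufficient (I.real₂ arr T α γ s)) :
    I.realDec₂ arr T α γ s = if I.InReject arr T α γ (types₂ arr T α s) then 0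
      else if I.InAccept arr T α γ (types₂ arr T α s) then 1 else I.virtualDec₂ arr T α s := by
  simp only [realDec₂, dec₂, if_pos h, types₂, virtualDec₂, cap₂_eq I T α hT]
  split_ifs <;> simp_all

lemma realDec₂_of_not_sufficient (I : NRM m n) {arr : ℕ → Fin n} {T : ℕ} {α γ : ℝ}
    {s : ℕ} (h : ¬ I.Sufficient (I.real₂ arr T α γ s)) : I.realDec₂ arr T α γ s = 0 := by
  simp only [realDec₂, dec₂, if_neg h]

/-- Phases II and III together can earn as much as the hindsight optimum of their arrivals: some
packing of the arrivals of phase III makes up for the deficit of phase II. -/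
def Completable (I : NRM m n) (arr : ℕ → Fin n) (T : ℕ) (α β γ : ℝ) : Prop :=
  ∃ u ∈ I.feasible (I.real₂ arr T α γ (len₂ T α β))
      (acc (types₃ arr T α β) 1 (T - (len₁ T α + len₂ T α β))),
    ∀ z ∈ I.feasible (fun i => ((T : ℝ) - len₁ T α) * I.rate i)
      (acc (types₂ arr T α) 1 (T - len₁ T α)), ∑ j, I.rev j * z j ≤
      ∑ j, I.rev j * acc (types₂ arr T α) (I.realDec₂ arr T α γ) (len₂ T α β) j
        + ∑ j, I.rev j * u j

lemma acc_eq_zero_of_lam {I : NRM m n} {k : ℕ → Fin n} {N : ℕ} (h : ∀ t < N, 0 < I.lam (k t))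
    {j : Fin n} (hj : ¬ 0 < I.lam j) (y : ℕ → ℝ) {s : ℕ} (hs : s ≤ N) : acc k y s j = 0 := by
  refine Finset.sum_eq_zero fun t ht => if_neg fun he => hj ?_
  rw [← he]
  exact h t ((Finset.mem_range.1 ht).trans_le hs)

/-- The last phase has N periods with N much larger than all errors. Every nonzero fluid slack times
N absorbs them, so the acceptances of phase II can be completed to an exact optimum z. -/
lemma OptPair.exists_completable {I : NRM m n} {xs : Fin n → ℝ} {p : Fin m → ℝ}
    (hopt : I.OptPair xs p) (hgp : I.GeneralPosition) (hp : ∀ i, p i < I.thetaBar I.rate) {μ : ℝ}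
    (hμ : I.SlackBound xs μ) :
    ∃ M > 0, ∀ (arr : ℕ → Fin n) (T : ℕ) (α β γ E E' : ℝ), 0 < T → len₁ T α + len₂ T α β < T →
      √((T : ℝ) - len₁ T α) ≤ E → 1 ≤ E → 0 ≤ E' →
      M * (E + E') ≤ μ * (T - (len₁ T α + len₂ T α β) : ℕ) →
      I.Classified arr T α γ xs →
      I.GoodRun arr (1 + len₁ T α) (fun i => ((T : ℝ) - len₁ T α) * I.rate i)
        ((T : ℝ) - len₁ T α) (T - len₁ T α) E →
      (∀ j, |acc (types₃ arr T α β) 1 (T - (len₁ T α + len₂ T α β)) j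
        - (T - (len₁ T α + len₂ T α β) : ℕ) * I.lam j| ≤ E') →
      (∀ t < T - len₁ T α, 0 < I.lam (types₂ arr T α t)) →
      I.Completable arr T α β γ := by
  classical
  obtain ⟨K₁, hK₁, hacc⟩ := hopt.exists_acc_dist_le hgp hp
  obtain ⟨K₂, hK₂, hdist⟩ := hopt.exists_optimal_dist_le hgp
  set S := ∑ i, ∑ j, I.bom i j with hS
  have hS0 : 0 ≤ S :=
    Finset.sum_nonneg fun i _ => Finset.sum_nonneg fun j _ => I.bom_nonneg i j
  have hā := I.aBar_pos
  refine ⟨I.aBar + (K₁ + 1) * S + (K₁ + K₂ + 1), by positivity, ?_⟩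
  intro arr T α β γ E E' hT hl hLE hE1 hE' hM hclass hgood hcount₃ htyp
  set l₁ := len₁ T α with hl₁
  set l₂ := len₂ T α β with hl₂
  set N := T - (l₁ + l₂) with hN
  set L := (T : ℝ) - l₁ with hL
  have hE0 : 0 ≤ E := by linarith
  have hLcast : ((T - l₁ : ℕ) : ℝ) = L := by
    rw [Nat.cast_sub (by omega)]
  have hsum : L = l₂ + N := by
    rw [hN, Nat.cast_sub hl.le, hL]; push_cast; ring
  have hNpos : (0 : ℝ) < N := by
    have : 0 < N := by omega
    exact_mod_cast this
  have hLpos : 0 < L := by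
    have : (0 : ℝ) ≤ l₂ := Nat.cast_nonneg _
    linarith
  have hl₂N : l₂ ≤ T - l₁ := by omega
  have hEE' : 0 ≤ E + E' := by linarith
  have hsplitM : I.aBar * (E + E') + (K₁ + 1) * S * (E + E') + (K₁ + K₂ + 1) * (E + E')
      ≤ μ * N := by linarith
  have hp1 : 0 ≤ I.aBar * (E + E') := by positivity
  have hp2 : 0 ≤ (K₁ + 1) * S * (E + E') := by positivity
  have hp3 : 0 ≤ (K₁ + K₂ + 1) * (E + E') := by positivity
  have hp4 : 0 ≤ K₁ * E' := by positivity
  have hp5 : 0 ≤ K₂ * E' := by positivity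
  have hp6 : 0 ≤ K₁ * E := by positivity
  have hp7 : 0 ≤ K₂ * E := by positivity
  have hbig : (K₁ + K₂) * E + E + E' ≤ μ * N := by linarith
  set k := types₂ arr T α with hk
  set y := I.virtualDec₂ arr T α with hy
  set w := acc k (I.realDec₂ arr T α γ) with hw
  have hvirt : ∀ s ≤ T - l₁, ∀ j, |acc k y s j - s * xs j| ≤ K₁ * E :=
    hacc arr (1 + l₁) L (T - l₁) E hLpos hLcast.le hLE hE1 hgood
  have hcount : ∀ s ≤ T - l₁, ∀ j, |acc k 1 s j - s * I.lam j| ≤ E := hgood.count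
  have hreject : ∀ j, 0 < I.lam j → xs j = 0 → ∀ s, w s j = 0 := by
    intro j hj hx s
    refine Finset.sum_eq_zero fun t _ => ?_
    split_ifs with ht
    · by_cases hs : I.Sufficient (I.real₂ arr T α γ t)
      · rw [I.realDec₂_of_sufficient hT hs, if_pos]
        have := hclass.reject j hj hx
        rwa [← ht] at this
      · exact I.realDec₂_of_not_sufficient hs
    · rfl
  have haccept : ∀ j, 0 < I.lam j → xs j = I.lam j → ∀ s,
      (∀ t < s, I.Sufficient (I.real₂ arr T α γ t)) → w s j = acc k 1 s j := by
    intro j hj hx s hs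
    refine acc_congr fun t hts ht => ?_
    have := hclass.accept j hj hx
    rw [← ht] at this
    rw [I.realDec₂_of_sufficient hT (hs t hts), if_neg this.1, if_pos this]
    rfl
  have hneither : ∀ j, 0 < xs j → xs j < I.lam j → ∀ s,
      (∀ t < s, I.Sufficient (I.real₂ arr T α γ t)) → w s j = acc k y s j := by
    intro j hx hx' s hs
    refine acc_congr fun t hts ht => ?_
    have := hclass.neither j hx hx'
    rw [← ht] at this
    rw [I.realDec₂_of_sufficient hT (hs t hts), if_neg this.1, if_neg this.2]
  have hwdist : ∀ s ≤ T - l₁, (∀ t < s, I.Sufficient (I.real₂ arr T α γ t)) → ∀ j,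
      |w s j - s * xs j| ≤ (K₁ + 1) * E := by
    intro s hsN hs j
    have hle : K₁ * E ≤ (K₁ + 1) * E := by linarith
    have hle' : E ≤ (K₁ + 1) * E := by linarith
    by_cases hj : 0 < I.lam j
    · rcases (hopt.nonneg j).eq_or_lt with h0 | h0
      · rw [hreject j hj h0.symm, ← h0, mul_zero, sub_zero, abs_zero]
        linarith
      · rcases (hopt.le_lam j).eq_or_lt with h1 | h1
        · rw [haccept j hj h1 s hs, h1]
          exact (hcount s hsN j).trans hle'
        · rw [hneither j h0 h1 s hs]
          exact (hvirt s hsN j).trans hle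
    · have hx0 : xs j = 0 := le_antisymm ((hopt.le_lam j).trans (not_lt.1 hj)) (hopt.nonneg j)
      rw [hw, acc_eq_zero_of_lam htyp hj _ hsN, hx0, mul_zero, sub_zero, abs_zero]
      linarith
  -- Consumption stays within O(E) of the fluid rate while the capacity for the N last periods is
  -- still in reserve. The induction is needed because the count formulas presuppose sufficiency in
  -- all earlier periods.
  have hsuff : ∀ s ≤ l₂, I.Sufficient (I.real₂ arr T α γ s) := by
    intro s
    induction s using Nat.strong_induction_on with
    | _ s ih =>
      intro hsl j i
      have hs : ∀ t < s, I.Sufficient (I.real₂ arr T α γ t) := fun t ht => ih t ht (by omega)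
      have hd := hwdist s (by omega) hs
      have hrow : ∑ j, I.bom i j ≤ S := Finset.single_le_sum (f := fun i => ∑ j, I.bom i j)
        (fun k _ => Finset.sum_nonneg fun j _ => I.bom_nonneg k j) (Finset.mem_univ i)
      have h1 : ∑ j, I.bom i j * w s j ≤ s * I.rate i + (K₁ + 1) * E * S := by
        calc _ ≤ ∑ j, (s * (I.bom i j * xs j) + (K₁ + 1) * E * I.bom i j) := by
              refine Finset.sum_le_sum fun j _ => ?_
              have := mul_le_mul_of_nonneg_left
                (show w s j ≤ s * xs j + (K₁ + 1) * E by linarith [(abs_le.1 (hd j)).2])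
                (I.bom_nonneg i j)
              linarith
          _ = s * ∑ j, I.bom i j * xs j + (K₁ + 1) * E * ∑ j, I.bom i j := by
              rw [Finset.sum_add_distrib, Finset.mul_sum, Finset.mul_sum]
          _ ≤ _ := by gcongr; exact hopt.feas i
      rw [real₂_eq, cap₂_eq I T α hT]
      have h2 : (s : ℝ) * I.rate i ≤ l₂ * I.rate i := by
        have : (s : ℝ) ≤ l₂ := by exact_mod_cast hsl
        exact mul_le_mul_of_nonneg_right this (I.rate_pos i).le
      have h3 : μ * N ≤ N * I.rate i := by
        rw [mul_comm]; exact mul_le_mul_of_nonneg_left (hμ.rate i) hNpos.le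
      have h4 : L * I.rate i = l₂ * I.rate i + N * I.rate i := by rw [hsum]; ring
      have h5 : I.aBar ≤ I.aBar * E := le_mul_of_one_le_right hā.le hE1
      have h6 : 0 ≤ I.aBar * E' := by positivity
      have h7 : 0 ≤ (K₁ + 1) * S * E' := by positivity
      have h8 := I.bom_le_aBar i j
      have h9 : ∑ j, I.bom i j * acc (types₂ arr T α) (I.realDec₂ arr T α γ) s j
        = ∑ j, I.bom i j * w s j := rfl
      have h10 : ((T : ℝ) - len₁ T α) * I.rate i = L * I.rate i := rfl
      beta_reduce
      rw [h9, h10]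
      linarith
  have hs₂ : ∀ t < l₂, I.Sufficient (I.real₂ arr T α γ t) := fun t ht => hsuff t ht.le
  obtain ⟨z, hz, hzopt⟩ := I.exists_optimal (B := fun i => L * I.rate i)
    (N := acc k 1 (T - l₁)) (fun i => (mul_pos hLpos (I.rate_pos i)).le)
    (fun j => acc_one_nonneg _ _ _)
  have hzdist := hdist L E (acc k 1 (T - l₁)) hLpos.le hE0 (fun j => acc_one_nonneg _ _ _)
    (fun j => by rw [← hLcast]; exact hcount _ le_rfl j) z hz hzopt
  have hsplit : ∀ j, acc k 1 (T - l₁) j = acc k 1 l₂ j + acc (types₃ arr T α β) 1 N j :=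
    acc_types₂_split arr hl.le
  -- Rejected types have w = 0 and z = O(E), which phase III arrivals cover. For accepted types w
  -- counts all arrivals and z is larger by about N λ_j. For the rest, N x*_j and N (λ_j - x*_j)
  -- give room on both sides.
  have hfinal : ∀ j, w l₂ j ≤ z j ∧ z j - w l₂ j ≤ acc (types₃ arr T α β) 1 N j := by
    intro j
    have hz1 := abs_le.1 (hzdist j)
    have hz0 := (hz.2 j).1
    have hzN := (hz.2 j).2
    rw [hsplit] at hzN
    have hc3 := abs_le.1 (hcount₃ j)
    have hc2 := abs_le.1 (hcount l₂ hl₂N j)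
    rw [hsum, add_mul] at hz1
    by_cases hj : 0 < I.lam j
    · have hlamN : μ * N ≤ N * I.lam j := by
        rw [mul_comm]; exact mul_le_mul_of_nonneg_left (hμ.lam j hj) hNpos.le
      rcases (hopt.nonneg j).eq_or_lt with h0 | h0
      · rw [hreject j hj h0.symm]
        rw [← h0] at hz1
        constructor <;> linarith
      · rcases (hopt.le_lam j).eq_or_lt with h1 | h1
        · rw [haccept j hj h1 l₂ hs₂]
          rw [h1] at hz1
          constructor <;> linarith
        · rw [hneither j h0 h1 l₂ hs₂]
          have hv := abs_le.1 (hvirt l₂ hl₂N j)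
          have hsolN : μ * N ≤ N * xs j := by
            rw [mul_comm]; exact mul_le_mul_of_nonneg_left (hμ.sol j h0) hNpos.le
          have hslN : μ * N ≤ N * (I.lam j - xs j) := by
            rw [mul_comm]; exact mul_le_mul_of_nonneg_left (hμ.slack j h1) hNpos.le
          constructor <;> linarith
    · have e1 : w l₂ j = 0 := acc_eq_zero_of_lam htyp hj _ hl₂N
      have e2 : acc k 1 l₂ j = 0 := acc_eq_zero_of_lam htyp hj _ hl₂N
      rw [e2] at hzN
      rw [e1]
      constructor <;> linarith
  refine ⟨fun j => z j - w l₂ j, ⟨fun i => ?_, fun j =>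
    ⟨sub_nonneg.2 (hfinal j).1, (hfinal j).2⟩⟩, fun v hv => ?_⟩
  · rw [real₂_eq, cap₂_eq I T α hT]
    simp_rw [mul_sub, Finset.sum_sub_distrib]
    exact sub_le_sub_right (hz.1 i) _
  · refine (hzopt v hv).trans (le_of_eq ?_)
    rw [← Finset.sum_add_distrib]
    exact Finset.sum_congr rfl fun j _ => by rw [← mul_add, hw]; ring

lemma realDec₂_le_virtual {I : NRM m n} {arr : ℕ → Fin n} {T : ℕ} {α γ : ℝ} (hT : 0 < T) {s : ℕ}
    (h : ¬ I.InAccept arr T α γ (types₂ arr T α s)) :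
    I.realDec₂ arr T α γ s ≤ I.virtualDec₂ arr T α s := by
  have h0 : 0 ≤ I.virtualDec₂ arr T α s := I.ffDecision_nonneg _ _ _ _ _
  by_cases hs : I.Sufficient (I.real₂ arr T α γ s)
  · rw [I.realDec₂_of_sufficient hT hs, if_neg h]
    split_ifs
    exacts [h0, le_rfl]
  · rw [I.realDec₂_of_not_sufficient hs]; exact h0

/-- The hindsight value is at most the dual price of i₀ times its capacity. Phase II spends the
capacity only on j₀, and phase III can spend all the remainder on j₀, which attains this bound. -/
lemma SingleResource.exists_completable {I : NRM m n} {xs : Fin n → ℝ} {p : Fin m → ℝ}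
    {i₀ : Fin m} {j₀ : Fin n} (h : I.SingleResource xs p i₀ j₀) (hgp : I.GeneralPosition) {μ : ℝ}
    (hμ : I.SlackBound xs μ) :
    ∃ M > 0, ∀ (arr : ℕ → Fin n) (T : ℕ) (α β γ E E' : ℝ), 0 < T → len₁ T α + len₂ T α β < T →
      √((T : ℝ) - len₁ T α) ≤ E → 1 ≤ E → 0 ≤ E' →
      M * (E + E') ≤ μ * (T - (len₁ T α + len₂ T α β) : ℕ) →
      I.Classified arr T α γ xs →
      I.GoodRun arr (1 + len₁ T α) (fun i => ((T : ℝ) - len₁ T α) * I.rate i)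
        ((T : ℝ) - len₁ T α) (T - len₁ T α) E →
      (∀ j, |acc (types₃ arr T α β) 1 (T - (len₁ T α + len₂ T α β)) j
        - (T - (len₁ T α + len₂ T α β) : ℕ) * I.lam j| ≤ E') →
      (∀ t < T - len₁ T α, 0 < I.lam (types₂ arr T α t)) →
      I.Completable arr T α β γ := by
  classical
  obtain ⟨K, hK, hacc⟩ := h.exists_acc_bounds hgp
  refine ⟨K + 1, by positivity, ?_⟩
  intro arr T α β γ E E' hT hl hLE hE1 hE' hM hclass hgood hcount₃ htyp
  set l₁ := len₁ T α with hl₁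
  set l₂ := len₂ T α β with hl₂
  set N := T - (l₁ + l₂) with hN
  set L := (T : ℝ) - l₁ with hL
  have hE0 : 0 ≤ E := by linarith
  have hLcast : ((T - l₁ : ℕ) : ℝ) = L := by
    rw [Nat.cast_sub (by omega)]
  have hsum : L = l₂ + N := by
    rw [hN, Nat.cast_sub hl.le, hL]; push_cast; ring
  have hNpos : (0 : ℝ) < N := by
    have : 0 < N := by omega
    exact_mod_cast this
  have hLpos : 0 < L := by
    have : (0 : ℝ) ≤ l₂ := Nat.cast_nonneg _
    linarith
  have hl₂N : l₂ ≤ T - l₁ := by omega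
  set k := types₂ arr T α with hk
  set y := I.virtualDec₂ arr T α with hy
  set w := acc k (I.realDec₂ arr T α γ) with hw
  have hx0 : 0 < xs j₀ := by
    refine (h.opt.nonneg j₀).lt_of_ne' fun h0 => ?_
    have := h.bom_mul_xs
    rw [h0, mul_zero] at this
    exact (I.rate_pos i₀).ne this
  obtain ⟨hnR, hnA⟩ := hclass.neither j₀ hx0 h.partly
  have hR : ∀ t < T - l₁, k t ≠ j₀ → I.InReject arr T α γ (k t) := fun t ht hne =>
    hclass.reject _ (htyp t ht) (h.xs_eq_zero hne)
  have hle : ∀ t < T - l₁, I.realDec₂ arr T α γ t ≤ y t := fun t ht => by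
    refine realDec₂_le_virtual hT fun hA => ?_
    by_cases hkt : k t = j₀
    · rw [← hkt] at hnA; exact hnA hA
    · exact hA.1 (hR t ht hkt)
  -- Types other than j₀ are rejected and j₀ follows the virtual run, so the real copy accepts no
  -- more and keeps at least as much capacity.
  have hcap : ∀ t ≤ T - l₁, ∀ i,
      (I.ffRun arr (1 + l₁) (fun i => L * I.rate i) L t).cap i ≤ I.real₂ arr T α γ t i := by
    intro t ht i
    rw [ffRun_cap, real₂_eq, cap₂_eq I T α hT]
    refine sub_le_sub_left (Finset.sum_le_sum fun j _ =>
      mul_le_mul_of_nonneg_left ?_ (I.bom_nonneg i j)) _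
    exact acc_mono (fun t' ht' => hle t' (by omega)) j
  have hw0 : ∀ j, j ≠ j₀ → w l₂ j = 0 := by
    intro j hj
    refine Finset.sum_eq_zero fun t ht => ?_
    have htN : t < T - l₁ := (Finset.mem_range.1 ht).trans_le hl₂N
    split_ifs with hkt
    · by_cases hs : I.Sufficient (I.real₂ arr T α γ t)
      · rw [I.realDec₂_of_sufficient hT hs, if_pos (hR t htN (by rw [hkt]; exact hj))]
      · exact I.realDec₂_of_not_sufficient hs
    · rfl
  have hwy : w l₂ j₀ = acc k y l₂ j₀ := by
    refine acc_congr fun t ht hkt => ?_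
    have htN : t < T - l₁ := ht.trans_le hl₂N
    by_cases hs : I.Sufficient (I.real₂ arr T α γ t)
    · have hkt' : types₂ arr T α t = j₀ := hkt
      rw [I.realDec₂_of_sufficient hT hs, hkt', if_neg hnR, if_neg hnA]
    -- If the real capacity is insufficient, so is the smaller virtual one, and both decisions are
    -- zero.
    · rw [I.realDec₂_of_not_sufficient hs]
      refine (I.ffDecision_of_not_sufficient _ _ _ _ fun hs' => hs fun j i => ?_).symm
      exact (hs' j i).trans (hcap t htN.le i)
  have hlow : l₂ * xs j₀ - K * E ≤ acc k y l₂ j₀ :=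
    (hacc arr (1 + l₁) L (T - l₁) E hLpos hLcast.le hLE hE1 hgood l₂ hl₂N).2
  have hupp : acc k y l₂ j₀ ≤ L * xs j₀ := h.bom_mul_acc_le arr (1 + l₁) hLpos l₂
  set u : Fin n → ℝ := Pi.single j₀ (L * xs j₀ - w l₂ j₀) with hu
  have hu0 : ∀ j, j ≠ j₀ → u j = 0 := fun j hj => by simp [hu, hj]
  have huj : u j₀ = L * xs j₀ - w l₂ j₀ := by simp [hu]
  have hsingle : ∀ (f v : Fin n → ℝ), (∀ j, j ≠ j₀ → v j = 0) → ∑ j, f j * v j = f j₀ * v j₀ :=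
    fun f v hv => Finset.sum_eq_single j₀ (fun j _ hj => by rw [hv j hj, mul_zero])
      fun hn => absurd (Finset.mem_univ _) hn
  refine ⟨u, ⟨fun i => ?_, fun j => ?_⟩, fun v hv => ?_⟩
  · by_cases hi : i = i₀
    · subst hi
      rw [hsingle _ u hu0, huj, real₂_eq, cap₂_eq I T α hT, hsingle _ (w l₂) hw0, mul_sub,
        mul_left_comm, h.bom_mul_xs]
    · rw [Finset.sum_eq_zero fun j _ => by rw [h.unused i hi j, zero_mul]]
      exact I.real₂_nonneg arr α γ hT (by omega) _ i
  · by_cases hj : j = j₀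
    · subst hj
      rw [huj, hwy]
      refine ⟨by linarith, ?_⟩
      have h1 := (abs_le.1 (hcount₃ j)).1
      have h2 : μ * N ≤ N * (I.lam j - xs j) := by
        rw [mul_comm]; exact mul_le_mul_of_nonneg_left (hμ.slack j h.partly) hNpos.le
      have h3 : L * xs j = l₂ * xs j + N * xs j := by rw [hsum]; ring
      have h4 : 0 ≤ K * E' := by positivity
      linarith
    · rw [hu0 j hj]
      exact ⟨le_rfl, acc_one_nonneg _ _ _⟩
  -- Weak duality at the single positive price; w + u uses i₀ completely, so it earns exactly this
  -- amount.
  · have h1 : ∑ j, I.rev j * v j ≤ p i₀ * (L * I.rate i₀) := by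
      calc ∑ j, I.rev j * v j ≤ ∑ j, p i₀ * I.bom i₀ j * v j := by
            refine Finset.sum_le_sum fun j _ => mul_le_mul_of_nonneg_right ?_ (hv.2 j).1
            by_cases hj : j = j₀
            · rw [hj]; exact h.rev_eq.le
            · exact (h.rev_lt j hj).le
        _ = p i₀ * ∑ j, I.bom i₀ j * v j := by simp_rw [Finset.mul_sum, mul_assoc]
        _ ≤ _ := mul_le_mul_of_nonneg_left (hv.1 i₀) h.price_pos.le
    refine h1.trans (le_of_eq ?_)
    have h2 : ∑ j, I.rev j * acc (types₂ arr T α) (I.realDec₂ arr T α γ) (len₂ T α β) j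
      = I.rev j₀ * w l₂ j₀ := hsingle _ (w l₂) hw0
    rw [h2, hsingle _ u hu0, huj, h.rev_eq, ← h.bom_mul_xs]
    ring

/-- Sample paths that are typical for each of the three phases. -/
structure GoodPath (I : NRM m n) (arr : ℕ → Fin n) (T : ℕ) (α β γ E₁ E₂ E₃ : ℝ) : Prop where
  first : I.GoodRun arr 1 (fun i => (len₁ T α : ℝ) * I.rate i) (len₁ T α) (len₁ T α) E₁
  second : I.GoodRun arr (1 + len₁ T α) (fun i => ((T : ℝ) - len₁ T α) * I.rate i)
    ((T : ℝ) - len₁ T α) (T - len₁ T α) E₂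
  third : I.GoodRun arr (1 + len₁ T α + len₂ T α β) (I.cap₃ arr T α β γ)
    ((T - (len₁ T α + len₂ T α β) : ℕ) : ℝ) (T - (len₁ T α + len₂ T α β)) E₃
  types : ∀ t < T, 0 < I.lam (arr (1 + t))

/-- A two-sided bound only at the end of a run whose capacity is meant for exactly N periods: there
the capacity bound refers to the elapsed time. Phase I is such a run. -/
lemma SingleResource.exists_acc_dist_le {I : NRM m n} {xs : Fin n → ℝ} {p : Fin m → ℝ}
    {i₀ : Fin m} {j₀ : Fin n} (h : I.SingleResource xs p i₀ j₀) (hgp : I.GeneralPosition) :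
    ∃ K > 0, ∀ (arr : ℕ → Fin n) (t₁ N : ℕ) (E : ℝ), 0 < N → √(N : ℝ) ≤ E →
      1 ≤ E → I.GoodRun arr t₁ (fun i => (N : ℝ) * I.rate i) N N E → ∀ j,
      |acc (fun t => arr (t₁ + t)) (I.ffDecision arr t₁ (fun i => (N : ℝ) * I.rate i) N) N j
        - N * xs j| ≤ K * E := by
  obtain ⟨K, hK, hacc⟩ := h.exists_acc_bounds hgp
  refine ⟨K, hK, fun arr t₁ N E hN hNE hE hgood j => ?_⟩
  have hN' : (0 : ℝ) < N := by exact_mod_cast hN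
  obtain ⟨h1, h2⟩ := hacc arr t₁ N N E hN' le_rfl hNE hE hgood N le_rfl
  by_cases hj : j = j₀
  · subst hj
    have h3 := h.bom_mul_acc_le arr t₁ hN' N
    have h4 : 0 ≤ K * E := by positivity
    rw [abs_le]
    constructor <;> linarith
  · rw [h.xs_eq_zero hj, mul_zero, sub_zero, abs_of_nonneg (I.acc_ff_nonneg _ _ _ _ _ _)]
    exact h1 j hj

/-- Both cases offer the same two facts, accurate counts at the end of phase I and completability of
phase II, and are merged here before the scale conditions are imposed. -/
lemma GeneralPosition.exists_completable {I : NRM m n} (hgp : I.GeneralPosition) :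
    ∃ M > 0, ∀ (arr : ℕ → Fin n) (T : ℕ) (α β γ E₁ E₂ E₃ : ℝ), 0 < T →
      len₁ T α + len₂ T α β < T → √(len₁ T α : ℝ) ≤ E₁ → 1 ≤ E₁ →
      √((T : ℝ) - len₁ T α) ≤ E₂ → 1 ≤ E₂ →
      M * E₁ < (T : ℝ) ^ (α / 2 + γ) → M * (1 + (T : ℝ) ^ (α / 2 + γ)) ≤ (T : ℝ) ^ α →
      M * (E₂ + E₃) ≤ (T - (len₁ T α + len₂ T α β) : ℕ) →
      I.GoodPath arr T α β γ E₁ E₂ E₃ → I.Completable arr T α β γ := by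
  obtain ⟨xs, μ, K, M, hlam, hμ, hK, hM, hone, htwo⟩ : ∃ (xs : Fin n → ℝ) (μ K M : ℝ),
      (∀ j, xs j ≤ I.lam j) ∧ I.SlackBound xs μ ∧ 0 < K ∧ 0 < M ∧
      (∀ (arr : ℕ → Fin n) (t₁ N : ℕ) (E : ℝ), 0 < N → √(N : ℝ) ≤ E →
        1 ≤ E → I.GoodRun arr t₁ (fun i => (N : ℝ) * I.rate i) N N E → ∀ j,
        |acc (fun t => arr (t₁ + t)) (I.ffDecision arr t₁ (fun i => (N : ℝ) * I.rate i) N) N j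
          - N * xs j| ≤ K * E) ∧
      ∀ (arr : ℕ → Fin n) (T : ℕ) (α β γ E E' : ℝ), 0 < T → len₁ T α + len₂ T α β < T →
      √((T : ℝ) - len₁ T α) ≤ E → 1 ≤ E → 0 ≤ E' →
      M * (E + E') ≤ μ * (T - (len₁ T α + len₂ T α β) : ℕ) →
      I.Classified arr T α γ xs →
      I.GoodRun arr (1 + len₁ T α) (fun i => ((T : ℝ) - len₁ T α) * I.rate i)
        ((T : ℝ) - len₁ T α) (T - len₁ T α) E →
      (∀ j, |acc (types₃ arr T α β) 1 (T - (len₁ T α + len₂ T α β)) j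
        - (T - (len₁ T α + len₂ T α β) : ℕ) * I.lam j| ≤ E') →
      (∀ t < T - len₁ T α, 0 < I.lam (types₂ arr T α t)) →
      I.Completable arr T α β γ := by
    rcases hgp.exists_optPair_cases with ⟨xs, p, hopt, hp⟩ | ⟨xs, p, i₀, j₀, h⟩
    · obtain ⟨μ, hμ⟩ := I.exists_slackBound xs
      obtain ⟨K, hK, h1⟩ := hopt.exists_acc_dist_le hgp hp
      obtain ⟨M, hM, h2⟩ := hopt.exists_completable hgp hp hμ
      exact ⟨xs, μ, K, M, hopt.le_lam, hμ, hK, hM, fun arr t₁ N E hN hNE hE hgood j =>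
        h1 arr t₁ N N E (by exact_mod_cast hN) le_rfl hNE hE hgood N le_rfl j, h2⟩
    · obtain ⟨μ, hμ⟩ := I.exists_slackBound xs
      obtain ⟨K, hK, h1⟩ := h.exists_acc_dist_le hgp
      obtain ⟨M, hM, h2⟩ := h.exists_completable hgp hμ
      exact ⟨xs, μ, K, M, h.opt.le_lam, hμ, hK, hM, h1, h2⟩
  have hμ0 := hμ.pos
  refine ⟨(K + M + 2) / μ, by positivity, ?_⟩
  intro arr T α β γ E₁ E₂ E₃ hT hl hE₁ hE₁1 hE₂ hE₂1 hc1 hc2 hc3 hgood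
  have hE₃0 := hgood.third.nonneg
  have hTc0 : 0 ≤ (T : ℝ) ^ (α / 2 + γ) := Real.rpow_nonneg (Nat.cast_nonneg _) _
  have hl₁ : 0 < len₁ T α := Nat.ceil_pos.2 (Real.rpow_pos_of_pos (by exact_mod_cast hT) _)
  rw [div_mul_eq_mul_div, div_lt_iff₀ hμ0] at hc1
  rw [div_mul_eq_mul_div, div_le_iff₀ hμ0] at hc2 hc3
  have hp1 : 0 ≤ (M + 2) * E₁ := by positivity
  have hp2 : 0 ≤ (K + 2) * (E₂ + E₃) := by positivity
  have hp3 : 0 ≤ (K + M) * (1 + (T : ℝ) ^ (α / 2 + γ)) := by positivity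
  have hclass : I.Classified arr T α γ xs := by
    refine hμ.classified hlam (E := K * E₁) (by linarith) (by linarith) fun j => ?_
    have h1 := hone arr 1 (len₁ T α) E₁ hl₁ hE₁ hE₁1 hgood.first j
    have h2 : I.dec₁ arr T α = I.ffDecision arr 1 (fun i => (len₁ T α : ℝ) * I.rate i)
        (len₁ T α) := by
      funext s
      rw [dec₁, cap₁_eq I T α hT]
    rw [h2]
    exact h1
  refine htwo arr T α β γ E₂ E₃ hT hl hE₂ hE₂1 hE₃0 (by linarith) hclass hgood.second
    (fun j => hgood.third.count _ le_rfl j) fun t ht => ?_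
  rw [types₂, add_assoc]
  exact hgood.types _ (by omega)

/-- The regret of a typical sample path. -/
lemma GeneralPosition.exists_pathRegret_le {I : NRM m n} (hgp : I.GeneralPosition) :
    ∃ C > 0, ∃ M > 0, ∀ (arr : ℕ → Fin n) (T : ℕ) (α β γ q l E₁ E₂ E₃ : ℝ), 0 < T →
      len₁ T α + len₂ T α β < T → √(len₁ T α : ℝ) ≤ E₁ → 1 ≤ E₁ →
      √((T : ℝ) - len₁ T α) ≤ E₂ → 1 ≤ E₂ → E₃ ≤ 2 * q ^ 2 * l →
      M * E₁ < (T : ℝ) ^ (α / 2 + γ) → M * (1 + (T : ℝ) ^ (α / 2 + γ)) ≤ (T : ℝ) ^ α →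
      M * (E₂ + E₃) ≤ (T - (len₁ T α + len₂ T α β) : ℕ) →
      1 ≤ q → 1 ≤ l → (T : ℝ) ^ (1 / 2 + β) = q ^ 4 →
      (T : ℝ) ^ (3 * (1 / 2 + β) / 4) = q ^ 3 →
      ((T - (len₁ T α + len₂ T α β) : ℕ) : ℝ) ≤ q ^ 4 →
      q ^ 4 / 2 ≤ ((T - (len₁ T α + len₂ T α β) : ℕ) : ℝ) →
      I.GoodPath arr T α β γ E₁ E₂ E₃ →
      I.pathRegret T α β γ arr ≤ C * (len₁ T α + q ^ 3 * l) := by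
  obtain ⟨M, hM, hcomp⟩ := hgp.exists_completable
  obtain ⟨C, hC, hlast⟩ := hgp.exists_lastPhase_le
  set R := ∑ j, I.rev j with hR
  have hR0 : 0 ≤ R := Finset.sum_nonneg fun j _ => I.rev_nonneg j
  refine ⟨R + C, by positivity, M, hM, ?_⟩
  intro arr T α β γ q l E₁ E₂ E₃ hT hl hE₁ hE₁1 hE₂ hE₂1 hE₃ hc1 hc2 hc3 hq hl1 hW hQ hN hN' hgood
  obtain ⟨u, hu, hz⟩ := hcomp arr T α β γ E₁ E₂ E₃ hT hl hE₁ hE₁1 hE₂ hE₂1 hc1 hc2 hc3 hgood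
  have h1 := hlast arr T α β γ q l E₃ hT hl.le hq hl1 hW hQ hN hN' hE₃ hgood.third u hu
  have hL : (0 : ℝ) ≤ (T : ℝ) - len₁ T α := by
    have : (len₁ T α : ℝ) ≤ T := by exact_mod_cast (by omega : len₁ T α ≤ T)
    linarith
  obtain ⟨z, hzf, hzopt⟩ := I.exists_optimal
    (B := fun i => ((T : ℝ) - len₁ T α) * I.rate i) (N := acc (types₂ arr T α) 1 (T - len₁ T α))
    (fun i => mul_nonneg hL (I.rate_pos i).le) (fun j => acc_one_nonneg _ _ _)
  have h2 := I.hindsight_le_of_optimal hT hl.le hzopt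
  have h3 := hz z hzf
  -- The revenue of phase I is discarded: giving up that phase already costs only a multiple of its
  -- length.
  have h4 : 0 ≤ ∑ j, I.rev j * acc (fun t => arr (1 + t)) (I.dec₁ arr T α) (len₁ T α) j :=
    Finset.sum_nonneg fun j _ => mul_nonneg (I.rev_nonneg j)
      (acc_nonneg (fun t _ => I.ffDecision_nonneg _ _ _ _ _) j)
  rw [pathRegret, fdRevenue_eq]
  have h5 : 0 ≤ C * (len₁ T α : ℝ) := by positivity
  have h6 : 0 ≤ R * (q ^ 3 * l) := by positivity
  linarith

/-! ### The algorithm is non-anticipating -/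

section Dependence

variable (I : NRM m n) {arr arr' : ℕ → Fin n} {T : ℕ} {α β γ : ℝ}

lemma ffRun_congr (t₁ : ℕ) (B : Fin m → ℝ) (L : ℝ) (s : ℕ)
    (h : ∀ t < t₁ + s, arr t = arr' t) : I.ffRun arr t₁ B L s = I.ffRun arr' t₁ B L s := by
  induction s with
  | zero => rfl
  | succ s ih =>
    have h1 := ih fun t ht => h t (by omega)
    have h2 := h (t₁ + s) (by omega)
    simp only [ffRun]
    rw [h1, h2]

lemma ffDecision_congr (t₁ : ℕ) (B : Fin m → ℝ) (L : ℝ) (s : ℕ)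
    (h : ∀ t < t₁ + s + 1, arr t = arr' t) :
    I.ffDecision arr t₁ B L s = I.ffDecision arr' t₁ B L s := by
  have h1 := I.ffRun_congr t₁ B L s fun t ht => h t (by omega)
  have h2 := h (t₁ + s) (by omega)
  simp only [ffDecision]
  rw [h1, h2]

lemma dec₁_congr (s : ℕ) (h : ∀ t < 1 + s + 1, arr t = arr' t) :
    I.dec₁ arr T α s = I.dec₁ arr' T α s :=
  I.ffDecision_congr _ _ _ _ h

lemma count₁_congr (h : ∀ t < 1 + len₁ T α, arr t = arr' t) (j : Fin n) :
    I.count₁ arr T α j = I.count₁ arr' T α j := by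
  refine Finset.sum_congr rfl fun s hs => ?_
  have hs' := Finset.mem_range.1 hs
  rw [h (1 + s) (by omega), I.dec₁_congr s fun t ht => h t (by omega)]

lemma dec₂_congr (B : Fin m → ℝ) (s : ℕ) (h : ∀ t < 1 + len₁ T α + s + 1, arr t = arr' t) :
    I.dec₂ arr T α γ B s = I.dec₂ arr' T α γ B s := by
  have h1 : I.count₁ arr T α = I.count₁ arr' T α :=
    funext (I.count₁_congr fun t ht => h t (by omega))
  have h2 := I.ffDecision_congr (1 + len₁ T α) (I.cap₂ T α) ((T : ℝ) - len₁ T α) s h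
  have h3 := h (1 + len₁ T α + s) (by omega)
  have h4 : I.InReject arr T α γ = I.InReject arr' T α γ := by
    funext j; simp only [InReject, h1]
  have h5 : I.InAccept arr T α γ = I.InAccept arr' T α γ := by
    funext j; simp only [InAccept, h1, h4]
  simp only [dec₂]
  rw [h2, h3, h4, h5]

lemma real₂_congr (s : ℕ) (h : ∀ t < 1 + len₁ T α + s, arr t = arr' t) :
    I.real₂ arr T α γ s = I.real₂ arr' T α γ s := by
  induction s with
  | zero => rfl
  | succ s ih =>
    have h1 := ih fun t ht => h t (by omega)
    have h2 := fun B => I.dec₂_congr (γ := γ) B s fun t ht => h t (by omega)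
    have h3 := h (1 + len₁ T α + s) (by omega)
    simp only [real₂, h1, h2, h3]

lemma cap₃_congr (h : ∀ t < 1 + len₁ T α + len₂ T α β, arr t = arr' t) :
    I.cap₃ arr T α β γ = I.cap₃ arr' T α β γ := by
  have h1 := I.real₂_congr (γ := γ) (len₂ T α β) h
  funext i
  simp only [cap₃, h1]

lemma dec₃_congr (B : Fin m → ℝ) (s : ℕ)
    (h : ∀ t < 1 + len₁ T α + len₂ T α β + s + 1, arr t = arr' t) :
    I.dec₃ arr T α β γ B s = I.dec₃ arr' T α β γ B s := by
  have h1 := I.cap₃_congr (T := T) (α := α) (β := β) (γ := γ) fun t ht => h t (by omega)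
  have h2 := I.ffDecision_congr (1 + len₁ T α + len₂ T α β) (I.cap₃ arr' T α β γ)
    ((T : ℝ) - len₁ T α - len₂ T α β) s h
  have h3 := h (1 + len₁ T α + len₂ T α β + s) (by omega)
  simp only [dec₃]
  rw [h1, h2, h3]

lemma real₃_congr (s : ℕ) (h : ∀ t < 1 + len₁ T α + len₂ T α β + s, arr t = arr' t) :
    I.real₃ arr T α β γ s = I.real₃ arr' T α β γ s := by
  induction s with
  | zero => exact I.real₂_congr _ h
  | succ s ih =>
    have h1 := ih fun t ht => h t (by omega)
    have h2 := fun B => I.dec₃_congr (γ := γ) B s fun t ht => h t (by omega)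
    have h3 := h (1 + len₁ T α + len₂ T α β + s) (by omega)
    simp only [real₃, h1, h2, h3]

/-- The crude horizon also covers parameters with l₁ + l₂ > T. Depending on finitely many arrivals
with finitely many values gives measurability and boundedness. -/
lemma dependsOn_pathRegret (T : ℕ) (α β γ : ℝ) :
    DependsOn (I.pathRegret T α β γ) (Set.Iio (1 + len₁ T α + len₂ T α β + T)) := by
  intro arr arr' h
  have h : ∀ t < 1 + len₁ T α + len₂ T α β + T, arr t = arr' t := fun t ht => h t ht
  have hh : I.hindsight T arr = I.hindsight T arr' := by
    have : arrivals arr T = arrivals arr' T := by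
      funext j
      refine congrArg Finset.card (Finset.filter_congr fun t ht => ?_)
      rw [h t (by have := (Finset.mem_Icc.1 ht).2; omega)]
    simp only [hindsight, this]
  have e1 : ∀ s ∈ Finset.range (len₁ T α), I.rev (arr (1 + s)) * I.dec₁ arr T α s
      = I.rev (arr' (1 + s)) * I.dec₁ arr' T α s := fun s hs => by
    have := Finset.mem_range.1 hs
    rw [h (1 + s) (by omega)]
    congr 1
    exact I.dec₁_congr s fun t ht => h t (by omega)
  have e2 : ∀ s ∈ Finset.range (len₂ T α β), I.rev (arr (1 + len₁ T α + s))
      * I.dec₂ arr T α γ (I.real₂ arr T α γ s) s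
      = I.rev (arr' (1 + len₁ T α + s)) * I.dec₂ arr' T α γ (I.real₂ arr' T α γ s) s :=
    fun s hs => by
    have := Finset.mem_range.1 hs
    rw [h (1 + len₁ T α + s) (by omega), I.real₂_congr s fun t ht => h t (by omega),
      I.dec₂_congr _ s fun t ht => h t (by omega)]
  have e3 : ∀ s ∈ Finset.range (T - (len₁ T α + len₂ T α β)),
      I.rev (arr (1 + len₁ T α + len₂ T α β + s))
        * I.dec₃ arr T α β γ (I.real₃ arr T α β γ s) s
      = I.rev (arr' (1 + len₁ T α + len₂ T α β + s))
        * I.dec₃ arr' T α β γ (I.real₃ arr' T α β γ s) s := fun s hs => by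
    have := Finset.mem_range.1 hs
    rw [h (1 + len₁ T α + len₂ T α β + s) (by omega), I.real₃_congr s fun t ht => h t (by omega),
      I.dec₃_congr _ s fun t ht => h t (by omega)]
  rw [pathRegret, pathRegret, hh, fdRevenue, fdRevenue, Finset.sum_congr rfl e1,
    Finset.sum_congr rfl e2, Finset.sum_congr rfl e3]

end Dependence

/-! ### Functions of finitely many independent arrivals -/

section Probability

variable {Ω : Type*} [MeasurableSpace Ω] {P : Measure Ω} {J : ℕ → Ω → Fin n}

/-- A function of the first `N` arrivals factors through the vector of these arrivals. -/
lemma exists_factor {N : ℕ} {F : (ℕ → Fin n) → ℝ} (hF : DependsOn F (Set.Iio N))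
    (hn : Nonempty (Fin n)) : ∃ G : (Finset.range N → Fin n) → ℝ, ∀ arr : ℕ → Fin n,
      F arr = G fun t => arr t := by
  classical
  refine ⟨fun x => F fun t => if h : t ∈ Finset.range N then x ⟨t, h⟩ else Classical.arbitrary _,
    fun arr => hF fun t ht => ?_⟩
  have : t ∈ Finset.range N := Finset.mem_range.2 ht
  simp [Finset.mem_range.1 this]

lemma measurable_comp_arrivals {N : ℕ} {F : (ℕ → Fin n) → ℝ} (hF : DependsOn F (Set.Iio N))
    (hJ : ∀ t, Measurable (J t)) (hn : Nonempty (Fin n)) :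
    Measurable fun ω => F fun t => J t ω := by
  obtain ⟨G, hG⟩ := exists_factor hF hn
  simp_rw [hG]
  exact (Measurable.of_discrete (f := G)).comp (measurable_pi_lambda _ fun t => hJ t)

lemma exists_bound_of_dependsOn {N : ℕ} {F : (ℕ → Fin n) → ℝ} (hF : DependsOn F (Set.Iio N))
    (hn : Nonempty (Fin n)) : ∃ C, ∀ arr, ‖F arr‖ ≤ C := by
  obtain ⟨G, hG⟩ := exists_factor hF hn
  obtain ⟨C, hC⟩ := (Set.finite_range fun x => ‖G x‖).bddAbove
  exact ⟨C, fun arr => by rw [hG]; exact hC ⟨_, rfl⟩⟩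

lemma integrable_comp_arrivals [IsFiniteMeasure P] {N : ℕ} {F : (ℕ → Fin n) → ℝ}
    (hF : DependsOn F (Set.Iio N)) (hJ : ∀ t, Measurable (J t)) (hn : Nonempty (Fin n)) :
    Integrable (fun ω => F fun t => J t ω) P := by
  obtain ⟨C, hC⟩ := exists_bound_of_dependsOn hF hn
  exact Integrable.of_bound (measurable_comp_arrivals hF hJ hn).aestronglyMeasurable C
    (ae_of_all _ fun ω => hC _)

lemma integral_mul_next [IsProbabilityMeasure P] {N : ℕ} {F : (ℕ → Fin n) → ℝ}
    (hF : DependsOn F (Set.Iio N)) (hJ : ∀ t, Measurable (J t)) (hindep : iIndepFun J P)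
    (hn : Nonempty (Fin n)) (φ : Fin n → ℝ) :
    ∫ ω, (F fun t => J t ω) * φ (J N ω) ∂P
      = (∫ ω, (F fun t => J t ω) ∂P) * ∫ ω, φ (J N ω) ∂P := by
  obtain ⟨G, hG⟩ := exists_factor hF hn
  have h1 := hindep.indepFun_finset (Finset.range N) {N} (by simp) hJ
  have h2 : IndepFun (fun ω => F fun t => J t ω) (fun ω => φ (J N ω)) P := by
    have h3 := h1.comp (φ := G)
      (ψ := fun x => φ (x ⟨N, Finset.mem_singleton_self N⟩))
      Measurable.of_discrete Measurable.of_discrete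
    have h4 : (fun ω => F fun t => J t ω)
        = G ∘ fun ω (t : Finset.range N) => J t ω := funext fun ω => hG _
    rw [h4]
    exact h3
  exact h2.integral_fun_mul_eq_mul_integral
    (measurable_comp_arrivals hF hJ hn).aestronglyMeasurable
    ((Measurable.of_discrete (f := φ)).comp (hJ N)).aestronglyMeasurable

/-- Convexity: on [-1, 1] the exponential lies below its chord. The bound is affine in x, so the
linear part vanishes for a martingale difference. -/
lemma exp_mul_le_cosh_add {c x : ℝ} (h1 : -1 ≤ x) (h2 : x ≤ 1) :
    Real.exp (c * x) ≤ Real.cosh c + x * Real.sinh c := by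
  have h := convexOn_exp.2 (Set.mem_univ c) (Set.mem_univ (-c))
    (show 0 ≤ (1 + x) / 2 by linarith) (show 0 ≤ (1 - x) / 2 by linarith) (by ring)
  simp only [smul_eq_mul] at h
  rw [Real.cosh_eq, Real.sinh_eq]
  calc Real.exp (c * x) = Real.exp ((1 + x) / 2 * c + (1 - x) / 2 * -c) := by ring_nf
    _ ≤ _ := h
    _ = _ := by ring

/-- Sums of the centered indicators of type `j` with predictable weights. -/
noncomputable def weightedDev (I : NRM m n) (h : ℕ → (ℕ → Fin n) → ℝ) (t₁ : ℕ) (j : Fin n) (s : ℕ)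
    (arr : ℕ → Fin n) : ℝ :=
  ∑ t ∈ Finset.range s, h t arr * ((if arr (t₁ + t) = j then 1 else 0) - I.lam j)

lemma dependsOn_weightedDev (I : NRM m n) {h : ℕ → (ℕ → Fin n) → ℝ} {t₁ : ℕ}
    (hdep : ∀ t, DependsOn (h t) (Set.Iio (t₁ + t))) (j : Fin n) (s : ℕ) :
    DependsOn (I.weightedDev h t₁ j s) (Set.Iio (t₁ + s)) := by
  intro arr arr' harr
  refine Finset.sum_congr rfl fun t ht => ?_
  have ht' := Finset.mem_range.1 ht
  rw [harr (t₁ + t) (by simp only [Set.mem_Iio]; omega)]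
  congr 1
  exact hdep t fun i hi => harr i (by simp only [Set.mem_Iio] at hi ⊢; omega)

/-- Exponential moments of a sum of bounded martingale differences. -/
lemma integral_exp_weightedDev_le (I : NRM m n) [IsProbabilityMeasure P]
    (hJ : ∀ t, Measurable (J t)) (hindep : iIndepFun J P)
    (hlaw : ∀ t j, P.real {ω | J t ω = j} = I.lam j) {h : ℕ → (ℕ → Fin n) → ℝ} {t₁ : ℕ}
    (hdep : ∀ t, DependsOn (h t) (Set.Iio (t₁ + t))) (hbd : ∀ t arr, |h t arr| ≤ 1)
    (j : Fin n) (c : ℝ) (s : ℕ) :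
    ∫ ω, Real.exp (c * I.weightedDev h t₁ j s fun t => J t ω) ∂P ≤ Real.exp (c ^ 2 / 2 * s) := by
  have hn := I.nonempty_types
  have hdepexp : ∀ s, DependsOn (fun arr => Real.exp (c * I.weightedDev h t₁ j s arr))
      (Set.Iio (t₁ + s)) := fun s arr arr' harr => by
    simp only [I.dependsOn_weightedDev hdep j s harr]
  induction s with
  | zero => simp [weightedDev]
  | succ s ih =>
    have hint := integrable_comp_arrivals (P := P) (hdepexp s) hJ hn
    have hdep2 : DependsOn (fun arr => Real.exp (c * I.weightedDev h t₁ j s arr)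
        * (h s arr * Real.sinh c)) (Set.Iio (t₁ + s)) := fun arr arr' harr => by
      simp only [I.dependsOn_weightedDev hdep j s harr, hdep s harr]
    have hdep3 : DependsOn (fun arr => Real.exp (c * I.weightedDev h t₁ j s arr)
        * (h s arr * Real.sinh c) * ((if arr (t₁ + s) = j then 1 else 0) - I.lam j))
        (Set.Iio (t₁ + s + 1)) := fun arr arr' harr => by
      have e1 := hdep2 (fun i hi => harr i (by simp only [Set.mem_Iio] at hi ⊢; omega))
      have e2 := harr (t₁ + s) (by simp)
      simp only at e1 ⊢
      rw [e1, e2]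
    have hzero : ∫ ω, ((if J (t₁ + s) ω = j then (1 : ℝ) else 0) - I.lam j) ∂P = 0 := by
      have hset : MeasurableSet {ω | J (t₁ + s) ω = j} := hJ _ (measurableSet_singleton j)
      have h1 : (fun ω => if J (t₁ + s) ω = j then (1 : ℝ) else 0)
          = {ω | J (t₁ + s) ω = j}.indicator 1 := by
        funext ω; simp [Set.indicator_apply]
      have h2 : Integrable (fun ω => if J (t₁ + s) ω = j then (1 : ℝ) else 0) P := by
        rw [h1]; exact (integrable_const 1).indicator hset
      rw [integral_sub h2 (integrable_const _), h1, integral_indicator_one hset, hlaw]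
      simp
    -- The last summand is a function of the past times the centred indicator of the next arrival,
    -- so it integrates to zero; `cosh c` ≤ e^(c²/2) then closes the induction.
    have hpt : ∀ arr : ℕ → Fin n, Real.exp (c * I.weightedDev h t₁ j (s + 1) arr)
        ≤ Real.cosh c * Real.exp (c * I.weightedDev h t₁ j s arr)
          + Real.exp (c * I.weightedDev h t₁ j s arr) * (h s arr * Real.sinh c)
            * ((if arr (t₁ + s) = j then 1 else 0) - I.lam j) := by
      intro arr
      set x := h s arr * ((if arr (t₁ + s) = j then 1 else 0) - I.lam j) with hx
      have hx1 : |x| ≤ 1 := by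
        have h0 := I.lam_nonneg j
        have h1 := I.lam_le_one j
        rw [hx, abs_mul]
        refine mul_le_one₀ (hbd s arr) (abs_nonneg _) ?_
        rw [abs_le]
        split_ifs <;> constructor <;> linarith
      have hsucc : I.weightedDev h t₁ j (s + 1) arr = I.weightedDev h t₁ j s arr + x := by
        rw [weightedDev, Finset.sum_range_succ, ← weightedDev]
      have h2 := exp_mul_le_cosh_add (c := c) (abs_le.1 hx1).1 (abs_le.1 hx1).2
      rw [hsucc, mul_add, Real.exp_add]
      calc _ ≤ Real.exp (c * I.weightedDev h t₁ j s arr)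
            * (Real.cosh c + x * Real.sinh c) := by gcongr
        _ = _ := by rw [hx]; ring
    calc ∫ ω, Real.exp (c * I.weightedDev h t₁ j (s + 1) fun t => J t ω) ∂P
        ≤ ∫ ω, (Real.cosh c * Real.exp (c * I.weightedDev h t₁ j s fun t => J t ω)
          + Real.exp (c * I.weightedDev h t₁ j s fun t => J t ω)
            * (h s (fun t => J t ω) * Real.sinh c)
            * ((if J (t₁ + s) ω = j then 1 else 0) - I.lam j)) ∂P := by
          refine integral_mono (integrable_comp_arrivals (hdepexp (s + 1)) hJ hn)
            ((hint.const_mul _).add (integrable_comp_arrivals hdep3 hJ hn)) fun ω => hpt _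
      _ = Real.cosh c * ∫ ω, Real.exp (c * I.weightedDev h t₁ j s fun t => J t ω) ∂P := by
          rw [integral_add (hint.const_mul _) (integrable_comp_arrivals hdep3 hJ hn),
            integral_const_mul,
            integral_mul_next hdep2 hJ hindep hn fun k => (if k = j then 1 else 0) - I.lam j,
            hzero, mul_zero, add_zero]
      _ ≤ Real.exp (c ^ 2 / 2) * Real.exp (c ^ 2 / 2 * s) :=
          mul_le_mul (Real.cosh_le_exp_half_sq c) ih
            (integral_nonneg fun ω => (Real.exp_pos _).le) (Real.exp_pos _).le
      _ = _ := by rw [← Real.exp_add]; push_cast; ring_nf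

/-- Chernoff's bound with the optimal exponent c = x/N for N summands; it serves all s ≤ N at once.
-/
lemma measureReal_weightedDev_ge_le (I : NRM m n) [IsProbabilityMeasure P]
    (hJ : ∀ t, Measurable (J t)) (hindep : iIndepFun J P)
    (hlaw : ∀ t j, P.real {ω | J t ω = j} = I.lam j) {h : ℕ → (ℕ → Fin n) → ℝ} {t₁ : ℕ}
    (hdep : ∀ t, DependsOn (h t) (Set.Iio (t₁ + t))) (hbd : ∀ t arr, |h t arr| ≤ 1)
    (j : Fin n) {s N : ℕ} (hN : 0 < N) (hs : s ≤ N) {x : ℝ} (hx : 0 ≤ x) :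
    P.real {ω | x ≤ I.weightedDev h t₁ j s fun t => J t ω} ≤ Real.exp (-(x ^ 2 / (2 * N))) := by
  have hn := I.nonempty_types
  have hN' : (0 : ℝ) < N := by exact_mod_cast hN
  have hs' : (s : ℝ) ≤ N := by exact_mod_cast hs
  have hint : Integrable (fun ω => Real.exp (x / N * I.weightedDev h t₁ j s fun t => J t ω)) P :=
    integrable_comp_arrivals (N := t₁ + s) (F := fun arr => Real.exp (x / N * I.weightedDev h t₁ j s arr))
      (fun arr arr' harr => by simp only [I.dependsOn_weightedDev hdep j s harr]) hJ hn
  refine (measure_ge_le_exp_mul_mgf x (div_nonneg hx hN'.le) hint).trans ?_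
  calc _ ≤ Real.exp (-(x / N) * x) * Real.exp ((x / N) ^ 2 / 2 * s) := by
        gcongr
        exact I.integral_exp_weightedDev_le hJ hindep hlaw hdep hbd j _ s
    _ ≤ Real.exp (-(x / N) * x) * Real.exp ((x / N) ^ 2 / 2 * N) := by gcongr
    _ = _ := by
        rw [← Real.exp_add]
        congr 1
        field_simp
        ring

lemma measureReal_abs_weightedDev_gt_le (I : NRM m n) [IsProbabilityMeasure P]
    (hJ : ∀ t, Measurable (J t)) (hindep : iIndepFun J P)
    (hlaw : ∀ t j, P.real {ω | J t ω = j} = I.lam j) {h : ℕ → (ℕ → Fin n) → ℝ} {t₁ : ℕ}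
    (hdep : ∀ t, DependsOn (h t) (Set.Iio (t₁ + t))) (hbd : ∀ t arr, |h t arr| ≤ 1)
    (j : Fin n) {s N : ℕ} (hN : 0 < N) (hs : s ≤ N) {x : ℝ} (hx : 0 ≤ x) :
    P.real {ω | x < |I.weightedDev h t₁ j s fun t => J t ω|}
      ≤ 2 * Real.exp (-(x ^ 2 / (2 * N))) := by
  have h1 := I.measureReal_weightedDev_ge_le hJ hindep hlaw hdep hbd j hN hs hx
  -- The lower tail is the upper tail for the negated weights.
  have h2 := I.measureReal_weightedDev_ge_le hJ hindep hlaw (t₁ := t₁) (h := fun t arr => -h t arr)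
    (fun t arr arr' harr => by simp only [hdep t harr]) (fun t arr => by rw [abs_neg]; exact hbd t arr)
    j hN hs hx
  have hsub : {ω | x < |I.weightedDev h t₁ j s fun t => J t ω|}
      ⊆ {ω | x ≤ I.weightedDev h t₁ j s fun t => J t ω}
        ∪ {ω | x ≤ I.weightedDev (fun t arr => -h t arr) t₁ j s fun t => J t ω} := by
    intro ω hω
    rw [Set.mem_ofPred_eq] at hω
    rcases lt_abs.1 hω with h3 | h3
    · exact Or.inl h3.le
    · refine Or.inr ?_
      rw [Set.mem_ofPred_eq]
      refine le_of_lt ?_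
      simpa [weightedDev] using h3
  have h3 := (measureReal_mono (μ := P) hsub).trans (measureReal_union_le _ _)
  linarith

end Probability

/-! ### Typical sample paths have probability 1 - O(1/T) -/

section GoodEvents

variable {Ω : Type*} [MeasurableSpace Ω] {P : Measure Ω} {J : ℕ → Ω → Fin n}

lemma weightedDev_one (I : NRM m n) (t₁ : ℕ) (j : Fin n) (s : ℕ) (arr : ℕ → Fin n) :
    I.weightedDev (fun _ _ => 1) t₁ j s arr
      = acc (fun t => arr (t₁ + t)) 1 s j - s * I.lam j := by
  simp only [weightedDev, one_mul, Finset.sum_sub_distrib, acc, Finset.sum_const,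
    Finset.card_range, nsmul_eq_mul, Pi.one_apply]

/-- The radius 2√(N log T) makes each tail T⁻², which leaves O(1/T) after a union over at most T + 1
times. -/
lemma exp_neg_sq_two_sqrt {N T : ℕ} (hN : 0 < N) (hT : 0 < T) :
    Real.exp (-((2 * √((N : ℝ) * Real.log T)) ^ 2 / (2 * N))) = ((T : ℝ) ^ 2)⁻¹ := by
  have hN' : (0 : ℝ) < N := by exact_mod_cast hN
  have hT' : (0 : ℝ) < T := by exact_mod_cast hT
  have hlog : 0 ≤ Real.log T := Real.log_natCast_nonneg T
  rw [mul_pow, Real.sq_sqrt (by positivity)]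
  have : -((2 : ℝ) ^ 2 * (N * Real.log T) / (2 * N)) = -((2 : ℕ) * Real.log T) := by
    field_simp; push_cast; ring
  rw [this, Real.exp_neg, ← Real.log_pow, Real.exp_log (by positivity)]

/-- A run of the subroutine is typical with high probability. The initial capacity may depend on
the arrivals before the run. -/
lemma measureReal_not_goodRun_le (I : NRM m n) (hgp : I.GeneralPosition) [IsProbabilityMeasure P]
    (hJ : ∀ t, Measurable (J t)) (hindep : iIndepFun J P)
    (hlaw : ∀ t j, P.real {ω | J t ω = j} = I.lam j) {t₁ : ℕ}
    {B : (ℕ → Fin n) → Fin m → ℝ} (hB : ∀ arr i, 0 < B arr i)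
    (hBdep : DependsOn B (Set.Iio t₁)) (L : ℝ) {N T : ℕ} (hN : 0 < N) (hNT : N ≤ T) :
    P.real {ω | ¬ I.GoodRun (fun t => J t ω) t₁ (B fun t => J t ω) L N
      (2 * √((N : ℝ) * Real.log T))} ≤ 4 * (n + m * n) / T := by
  have hT : 0 < T := by omega
  have hT' : (0 : ℝ) < T := by exact_mod_cast hT
  set E := 2 * √((N : ℝ) * Real.log T) with hE
  have hE0 : 0 ≤ E := by positivity
  -- Prices divided by the length of their interval are predictable weights in [0, 1], even when
  -- that interval depends on earlier arrivals.
  let w : Fin m → ℕ → (ℕ → Fin n) → ℝ := fun i t arr =>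
    (I.ffRun arr t₁ (B arr) L t).price i / I.thetaBar (B arr)
  have hθ : ∀ arr, 0 < I.thetaBar (B arr) := fun arr => hgp.thetaBar_pos (hB arr)
  have hwdep : ∀ i t, DependsOn (w i t) (Set.Iio (t₁ + t)) := by
    intro i t arr arr' harr
    have h1 : B arr = B arr' := hBdep fun k hk => harr k (by
      simp only [Set.mem_Iio] at hk ⊢; omega)
    simp only [w, h1, I.ffRun_congr t₁ (B arr') L t fun k hk => harr k hk]
  have hwbd : ∀ i t arr, |w i t arr| ≤ 1 := by
    intro i t arr
    obtain ⟨h1, h2⟩ := I.ffRun_price_mem arr t₁ L (hB arr) t i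
    rw [abs_of_nonneg (div_nonneg h1 (hθ arr).le)]
    exact div_le_one_of_le₀ h2 (hθ arr).le
  let S₁ : Finset (ℕ × Fin n) := Finset.range (N + 1) ×ˢ Finset.univ
  let S₂ : Finset (ℕ × Fin m × Fin n) := Finset.range (N + 1) ×ˢ Finset.univ
  let A₁ : ℕ × Fin n → Set Ω := fun k =>
    {ω | E < |I.weightedDev (fun _ _ => 1) t₁ k.2 k.1 fun t => J t ω|}
  let A₂ : ℕ × Fin m × Fin n → Set Ω := fun k =>
    {ω | E < |I.weightedDev (w k.2.1) t₁ k.2.2 k.1 fun t => J t ω|}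
  have hsub : {ω | ¬ I.GoodRun (fun t => J t ω) t₁ (B fun t => J t ω) L N E}
      ⊆ (⋃ k ∈ S₁, A₁ k) ∪ ⋃ k ∈ S₂, A₂ k := by
    intro ω hω
    by_contra hcon
    refine hω ⟨fun s hs j => ?_, fun s hs i j => ?_⟩
    · by_contra hlt
      refine hcon (Or.inl (Set.mem_biUnion (x := (s, j)) (by simp [S₁]; omega) ?_))
      show E < |I.weightedDev (fun _ _ => 1) t₁ j s fun t => J t ω|
      rw [weightedDev_one]
      exact not_le.1 hlt
    · by_contra hlt
      refine hcon (Or.inr (Set.mem_biUnion (x := (s, i, j)) (by simp [S₂]; omega) ?_))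
      show E < |I.weightedDev (w i) t₁ j s fun t => J t ω|
      have h1 := hθ fun t => J t ω
      have h2 : I.weightedDev (w i) t₁ j s (fun t => J t ω)
          = (∑ t ∈ Finset.range s, (I.ffRun (fun t => J t ω) t₁ (B fun t => J t ω) L t).price i
            * ((if J (t₁ + t) ω = j then 1 else 0) - I.lam j)) / I.thetaBar (B fun t => J t ω) := by
        rw [weightedDev, Finset.sum_div]
        exact Finset.sum_congr rfl fun t _ => by simp only [w]; ring
      rw [h2, abs_div, abs_of_pos h1, lt_div_iff₀ h1, mul_comm]
      exact not_le.1 hlt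
  have hA₁ : ∀ k ∈ S₁, P.real (A₁ k) ≤ 2 * ((T : ℝ) ^ 2)⁻¹ := fun k hk => by
    rw [← exp_neg_sq_two_sqrt hN hT]
    refine I.measureReal_abs_weightedDev_gt_le hJ hindep hlaw (fun t arr arr' _ => rfl)
      (fun t arr => by simp) k.2 hN ?_ hE0
    have := (Finset.mem_product.1 hk).1
    have := Finset.mem_range.1 this
    omega
  have hA₂ : ∀ k ∈ S₂, P.real (A₂ k) ≤ 2 * ((T : ℝ) ^ 2)⁻¹ := fun k hk => by
    rw [← exp_neg_sq_two_sqrt hN hT]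
    refine I.measureReal_abs_weightedDev_gt_le hJ hindep hlaw (hwdep k.2.1)
      (hwbd k.2.1) k.2.2 hN ?_ hE0
    have := (Finset.mem_product.1 hk).1
    have := Finset.mem_range.1 this
    omega
  have h1 : P.real (⋃ k ∈ S₁, A₁ k) ≤ (N + 1) * n * (2 * ((T : ℝ) ^ 2)⁻¹) := by
    refine (measureReal_biUnion_finset_le S₁ A₁).trans ((Finset.sum_le_sum hA₁).trans_eq ?_)
    simp [S₁]
  have h2 : P.real (⋃ k ∈ S₂, A₂ k) ≤ (N + 1) * (m * n) * (2 * ((T : ℝ) ^ 2)⁻¹) := by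
    refine (measureReal_biUnion_finset_le S₂ A₂).trans ((Finset.sum_le_sum hA₂).trans_eq ?_)
    simp [S₂]
  have h3 : ((N : ℝ) + 1) ≤ 2 * T := by
    have : (N : ℝ) ≤ T := by exact_mod_cast hNT
    have : (1 : ℝ) ≤ T := by exact_mod_cast hT
    linarith
  calc _ ≤ P.real ((⋃ k ∈ S₁, A₁ k) ∪ ⋃ k ∈ S₂, A₂ k) := measureReal_mono hsub
    _ ≤ P.real (⋃ k ∈ S₁, A₁ k) + P.real (⋃ k ∈ S₂, A₂ k) := measureReal_union_le _ _
    _ ≤ (N + 1) * n * (2 * ((T : ℝ) ^ 2)⁻¹) + (N + 1) * (m * n) * (2 * ((T : ℝ) ^ 2)⁻¹) :=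
        add_le_add h1 h2
    _ = (N + 1) * ((n + m * n) * (2 * ((T : ℝ) ^ 2)⁻¹)) := by ring
    _ ≤ 2 * T * ((n + m * n) * (2 * ((T : ℝ) ^ 2)⁻¹)) := by gcongr
    _ = _ := by field_simp; ring

/-- The thresholds of phase I degenerate for λ_j = 0 and say nothing about such types, so their
absence has to be part of typicality. -/
lemma measureReal_exists_lam_eq_zero (I : NRM m n)
    (hlaw : ∀ t j, P.real {ω | J t ω = j} = I.lam j) [IsFiniteMeasure P] (T : ℕ) :
    P.real {ω | ¬ ∀ t < T, 0 < I.lam (J (1 + t) ω)} = 0 := by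
  let S : Finset (ℕ × Fin n) := (Finset.range T ×ˢ Finset.univ).filter fun k => I.lam k.2 = 0
  have hsub : {ω | ¬ ∀ t < T, 0 < I.lam (J (1 + t) ω)} ⊆ ⋃ k ∈ S, {ω | J (1 + k.1) ω = k.2} := by
    intro ω hω
    rw [Set.mem_ofPred_eq] at hω
    push Not at hω
    obtain ⟨t, ht, h0⟩ := hω
    refine Set.mem_biUnion (x := (t, J (1 + t) ω)) ?_ rfl
    have := le_antisymm h0 (I.lam_nonneg _)
    simp [S, ht, this]
  refine le_antisymm ((measureReal_mono (μ := P) hsub (measure_ne_top _ _)).trans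
    ((measureReal_biUnion_finset_le S _).trans (Finset.sum_nonpos fun k hk => ?_))) measureReal_nonneg
  rw [hlaw, (Finset.mem_filter.1 hk).2]

/-- Sample paths are typical with high probability. -/
lemma measureReal_not_goodPath_le (I : NRM m n) (hgp : I.GeneralPosition) [IsProbabilityMeasure P]
    (hJ : ∀ t, Measurable (J t)) (hindep : iIndepFun J P)
    (hlaw : ∀ t j, P.real {ω | J t ω = j} = I.lam j) {T : ℕ} {α β γ : ℝ}
    (hl : len₁ T α + len₂ T α β < T) :
    P.real {ω | ¬ I.GoodPath (fun t => J t ω) T α β γ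
      (2 * √((len₁ T α : ℝ) * Real.log T))
      (2 * √(((T - len₁ T α : ℕ) : ℝ) * Real.log T))
      (2 * √(((T - (len₁ T α + len₂ T α β) : ℕ) : ℝ) * Real.log T))}
      ≤ 12 * (n + m * n) / T := by
  have hT : 0 < T := by omega
  have hl₁ : 0 < len₁ T α := Nat.ceil_pos.2 (Real.rpow_pos_of_pos (by exact_mod_cast hT) _)
  have hlT : (len₁ T α : ℝ) < T := by exact_mod_cast (by omega : len₁ T α < T)
  have h1 := I.measureReal_not_goodRun_le hgp hJ hindep hlaw (t₁ := 1)
    (B := fun _ i => (len₁ T α : ℝ) * I.rate i)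
    (fun _ i => mul_pos (by exact_mod_cast hl₁) (I.rate_pos i)) (fun _ _ _ => rfl)
    (len₁ T α) hl₁ (T := T) (by omega)
  have h2 := I.measureReal_not_goodRun_le hgp hJ hindep hlaw (t₁ := 1 + len₁ T α)
    (B := fun _ i => ((T : ℝ) - len₁ T α) * I.rate i)
    (fun _ i => mul_pos (by linarith) (I.rate_pos i)) (fun _ _ _ => rfl)
    ((T : ℝ) - len₁ T α) (N := T - len₁ T α) (by omega) (T := T) (by omega)
  have h3 := I.measureReal_not_goodRun_le hgp hJ hindep hlaw (t₁ := 1 + len₁ T α + len₂ T α β)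
    (B := fun arr => I.cap₃ arr T α β γ) (fun arr i => I.cap₃_pos arr hT i)
    (fun arr arr' h => I.cap₃_congr fun t ht => h t ht)
    ((T - (len₁ T α + len₂ T α β) : ℕ) : ℝ) (N := T - (len₁ T α + len₂ T α β)) (by omega)
    (T := T) (by omega)
  have h4 := I.measureReal_exists_lam_eq_zero (P := P) hlaw T
  refine (measureReal_mono (μ := P) (fun ω hω => ?_)).trans
    ((measureReal_union_le _ _).trans (add_le_add (measureReal_union_le _ _)
      (measureReal_union_le _ _))) |>.trans ((add_le_add (add_le_add h1 h2)
      (add_le_add h3 h4.le)).trans_eq (by ring))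
  by_contra hcon
  simp only [Set.mem_union, Set.mem_ofPred_eq, not_or, not_not] at hcon
  exact hω ⟨hcon.1.1, hcon.1.2, hcon.2.1, hcon.2.2⟩

end GoodEvents

/-! ### The expected regret -/

section Expectation

variable {Ω : Type*} [MeasurableSpace Ω] {P : Measure Ω} {J : ℕ → Ω → Fin n}

lemma integrable_pathRegret (I : NRM m n) [IsFiniteMeasure P] (hJ : ∀ t, Measurable (J t))
    (T : ℕ) (α β γ : ℝ) :
    Integrable (fun ω => I.pathRegret T α β γ fun t => J t ω) P :=
  integrable_comp_arrivals (I.dependsOn_pathRegret T α β γ) hJ I.nonempty_types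

lemma fdRevenue_nonneg (I : NRM m n) (T : ℕ) (α β γ : ℝ) (arr : ℕ → Fin n) :
    0 ≤ I.fdRevenue T α β γ arr := by
  refine add_nonneg (add_nonneg ?_ ?_) ?_ <;>
    refine Finset.sum_nonneg fun s _ => mul_nonneg (I.rev_nonneg _) ?_
  exacts [I.ffDecision_nonneg _ _ _ _ _, I.realDec₂_nonneg arr T α γ s, I.realDec₃_nonneg arr T α β γ s]

lemma pathRegret_le_sum_rev (I : NRM m n) (T : ℕ) (α β γ : ℝ) (arr : ℕ → Fin n) :
    I.pathRegret T α β γ arr ≤ (∑ j, I.rev j) * T := by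
  have h1 := I.fdRevenue_nonneg T α β γ arr
  have h2 : I.hindsight T arr ≤ (∑ j, I.rev j) * T := by
    refine I.hindsight_le fun z hz => ?_
    rw [Finset.sum_mul]
    refine Finset.sum_le_sum fun j _ => mul_le_mul_of_nonneg_left ?_ (I.rev_nonneg j)
    refine (hz.2 j).2.trans ?_
    have h3 := Finset.card_filter_le (Finset.Icc 1 T) fun t => arr t = j
    rw [Nat.card_Icc, Nat.add_sub_cancel] at h3
    show ((arrivals arr T j : ℕ) : ℝ) ≤ T
    exact_mod_cast h3
  rw [pathRegret]
  linarith

/-- An integrable variable that is bounded by `a` outside a set and by `b` on it. -/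
lemma integral_le_add_mul_measureReal [IsProbabilityMeasure P] {X : Ω → ℝ} (hX : Integrable X P)
    {S : Set Ω} {a b : ℝ} (ha : 0 ≤ a) (h1 : ∀ ω ∉ S, X ω ≤ a) (h2 : ∀ ω, X ω ≤ b) :
    ∫ ω, X ω ∂P ≤ a + b * P.real S := by
  -- The bad event has not been shown measurable; its measurable hull has the same measure.
  have hS := measurableSet_toMeasurable P S
  calc ∫ ω, X ω ∂P ≤ ∫ ω, (a + (toMeasurable P S).indicator (fun _ => b) ω) ∂P := by
        refine integral_mono hX ((integrable_const a).add ((integrable_const b).indicator hS))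
          fun ω => ?_
        by_cases h : ω ∈ toMeasurable P S
        · simp only [Set.indicator_of_mem h]
          linarith [h2 ω]
        · simp only [Set.indicator_of_notMem h, add_zero]
          exact h1 ω fun h' => h (subset_toMeasurable P S h')
    _ = a + b * P.real S := by
        rw [integral_add (integrable_const a) ((integrable_const b).indicator hS),
          integral_indicator_const b hS, integral_const]
        simp [Measure.real, measure_toMeasurable, mul_comm]

/-- Path regret is nonnegative and at most a multiple of T, so atypical paths of probability O(1/T)
add a constant. All size requirements stay explicit, which allows exponents that vary with T. -/
lemma GeneralPosition.exists_abs_regret_le {I : NRM m n} (hgp : I.GeneralPosition)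
    [IsProbabilityMeasure P] (hJ : ∀ t, Measurable (J t)) (hindep : iIndepFun J P)
    (hlaw : ∀ t j, P.real {ω | J t ω = j} = I.lam j) :
    ∃ C > 0, ∃ M > 0, ∀ (T : ℕ) (α β γ q l E₁ E₂ E₃ : ℝ),
      E₁ = 2 * √((len₁ T α : ℝ) * Real.log T) →
      E₂ = 2 * √(((T - len₁ T α : ℕ) : ℝ) * Real.log T) →
      E₃ = 2 * √(((T - (len₁ T α + len₂ T α β) : ℕ) : ℝ) * Real.log T) →
      len₁ T α + len₂ T α β < T → √(len₁ T α : ℝ) ≤ E₁ → 1 ≤ E₁ →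
      √((T : ℝ) - len₁ T α) ≤ E₂ → 1 ≤ E₂ → E₃ ≤ 2 * q ^ 2 * l →
      M * E₁ < (T : ℝ) ^ (α / 2 + γ) → M * (1 + (T : ℝ) ^ (α / 2 + γ)) ≤ (T : ℝ) ^ α →
      M * (E₂ + E₃) ≤ (T - (len₁ T α + len₂ T α β) : ℕ) →
      1 ≤ q → 1 ≤ l → (T : ℝ) ^ (1 / 2 + β) = q ^ 4 →
      (T : ℝ) ^ (3 * (1 / 2 + β) / 4) = q ^ 3 →
      ((T - (len₁ T α + len₂ T α β) : ℕ) : ℝ) ≤ q ^ 4 →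
      q ^ 4 / 2 ≤ ((T - (len₁ T α + len₂ T α β) : ℕ) : ℝ) →
      |I.regret P J T α β γ| ≤ C * (len₁ T α + q ^ 3 * l) := by
  obtain ⟨C, hC, M, hM, hpath⟩ := hgp.exists_pathRegret_le
  set R := ∑ j, I.rev j with hR
  have hR0 : 0 ≤ R := Finset.sum_nonneg fun j _ => I.rev_nonneg j
  refine ⟨C + R * (12 * (n + m * n)), by positivity, M, hM, ?_⟩
  intro T α β γ q l E₁ E₂ E₃ hE₁d hE₂d hE₃d hl hE₁ hE₁1 hE₂ hE₂1 hE₃ hc1 hc2 hc3 hq hl1 hW hQ hN hN'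
  have hT : 0 < T := by omega
  have hT' : (0 : ℝ) < T := by exact_mod_cast hT
  have hq1 : 1 ≤ q ^ 3 * l := one_le_mul_of_one_le_of_one_le (one_le_pow₀ hq) hl1
  have hbad := I.measureReal_not_goodPath_le (γ := γ) hgp hJ hindep hlaw hl
  rw [← hE₁d, ← hE₂d, ← hE₃d] at hbad
  rw [regret, abs_of_nonneg (integral_nonneg fun ω => I.pathRegret_nonneg _ _ hT hl.le)]
  have h1 := integral_le_add_mul_measureReal (I.integrable_pathRegret (P := P) hJ T α β γ)
    (S := {ω | ¬ I.GoodPath (fun t => J t ω) T α β γ E₁ E₂ E₃})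
    (a := C * (len₁ T α + q ^ 3 * l)) (b := R * T) (by positivity)
    (fun ω hω => hpath _ T α β γ q l E₁ E₂ E₃ hT hl hE₁ hE₁1 hE₂ hE₂1 hE₃ hc1 hc2 hc3 hq hl1 hW hQ
      hN hN' (not_not.1 hω)) (fun ω => I.pathRegret_le_sum_rev T α β γ _)
  have h2 : R * T * P.real {ω | ¬ I.GoodPath (fun t => J t ω) T α β γ E₁ E₂ E₃}
      ≤ R * (12 * (n + m * n)) := by
    calc _ ≤ R * T * (12 * (n + m * n) / T) := by gcongr
      _ = _ := by field_simp
  have h3 : R * (12 * (n + m * n)) ≤ R * (12 * (n + m * n)) * (len₁ T α + q ^ 3 * l) := by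
    refine le_mul_of_one_le_right (by positivity) ?_
    have : (0 : ℝ) ≤ len₁ T α := Nat.cast_nonneg _
    linarith
  linarith

end Expectation

end NRM

/-! ### Asymptotics of powers and logarithms -/

lemma eventually_mul_le_of_isLittleO {f g : ℕ → ℝ} (h : f =o[atTop] g) (hf : ∀ T, 0 ≤ f T)
    (hg : ∀ T, 0 ≤ g T) {K : ℝ} (hK : 0 < K) : ∀ᶠ T in atTop, K * f T ≤ g T := by
  filter_upwards [h.def (inv_pos.2 hK)] with T hT
  rw [Real.norm_of_nonneg (hf T), Real.norm_of_nonneg (hg T)] at hT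
  calc K * f T ≤ K * (K⁻¹ * g T) := by gcongr
    _ = g T := by field_simp

lemma eventually_one_le_log_natCast : ∀ᶠ T : ℕ in atTop, 1 ≤ Real.log T :=
  (Real.tendsto_log_atTop.comp tendsto_natCast_atTop_atTop).eventually_ge_atTop 1

lemma isLittleO_rpow_rpow_atTop {a b : ℝ} (h : a < b) :
    (fun x : ℝ => x ^ a) =o[atTop] fun x : ℝ => x ^ b := by
  refine ((isBigO_refl (fun x : ℝ => x ^ a) atTop).mul_isLittleO
    (isLittleO_log_rpow_rpow_atTop 0 (sub_pos.2 h))).congr' ?_ ?_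
  · exact Eventually.of_forall fun x => by simp
  · filter_upwards [eventually_gt_atTop 0] with x hx
    rw [← Real.rpow_add hx, add_sub_cancel]

lemma isLittleO_log_rpow_natCast_rpow (r : ℝ) {s : ℝ} (hs : 0 < s) :
    (fun T : ℕ => Real.log T ^ r) =o[atTop] fun T : ℕ => (T : ℝ) ^ s :=
  (isLittleO_log_rpow_rpow_atTop r hs).comp_tendsto tendsto_natCast_atTop_atTop

lemma isLittleO_sqrt_log_natCast_rpow {s : ℝ} (hs : 0 < s) :
    (fun T : ℕ => √(Real.log T)) =o[atTop] fun T : ℕ => (T : ℝ) ^ s := by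
  simp_rw [Real.sqrt_eq_rpow]
  exact isLittleO_log_rpow_natCast_rpow _ hs

lemma le_two_mul_sqrt_mul {x y : ℝ} (hx : 1 ≤ x) (hy : 1 ≤ y) :
    √x ≤ 2 * √(x * y) ∧ 1 ≤ 2 * √(x * y) := by
  have h1 : x ≤ x * y := le_mul_of_one_le_right (by linarith) hy
  have h2 := Real.sqrt_le_sqrt h1
  have h3 := Real.one_le_sqrt.2 (hx.trans h1)
  constructor <;> linarith

/-- Since T^ε = log T, exponents that are multiples of ε are powers of the logarithm. -/
lemma rpow_mul_epsScale {T : ℕ} (hT : 1 ≤ Real.log T) (c : ℝ) :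
    (T : ℝ) ^ (c * epsScale T) = Real.log T ^ c := by
  have hl : 0 < Real.log T := by linarith
  have hT0 : (0 : ℝ) < T := by
    rcases Nat.eq_zero_or_pos T with rfl | h
    · simp at hl
    · exact_mod_cast h
  rw [Real.rpow_def_of_pos hT0, Real.rpow_def_of_pos hl, epsScale]
  congr 1
  field_simp

lemma alphaStar_eq (T : ℕ) : alphaStar T = 3 / 2 * epsScale T := by
  rw [alphaStar, epsScale, mul_div_mul_comm]

lemma betaStar_eq (T : ℕ) : betaStar T = 1 * epsScale T := by
  rw [betaStar, epsScale, one_mul]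

lemma gammaStar_eq (T : ℕ) : gammaStar T = 2 / 3 * epsScale T := by
  rw [gammaStar, epsScale, mul_div_mul_comm]

lemma tendsto_epsScale : Tendsto epsScale atTop (𝓝 0) := by
  have h : Tendsto (fun x : ℝ => Real.log x / x) atTop (𝓝 0) :=
    Real.isLittleO_log_id_atTop.tendsto_div_nhds_zero
  exact h.comp (Real.tendsto_log_atTop.comp tendsto_natCast_atTop_atTop)

lemma eventually_epsScale_pos : ∀ᶠ T : ℕ in atTop, 0 < epsScale T := by
  filter_upwards [(Real.tendsto_log_atTop.comp tendsto_natCast_atTop_atTop).eventually_gt_atTop 1]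
    with T hT
  exact div_pos (Real.log_pos hT) (zero_lt_one.trans hT)

namespace NRM

variable {m n : ℕ}

/-! ### Rates of the expected regret -/

section Rate

variable {Ω : Type*} [MeasurableSpace Ω] {P : Measure Ω} {J : ℕ → Ω → Fin n}

set_option maxHeartbeats 1000000 in
/-- The regret when the exponents vary slowly with the horizon. -/
lemma GeneralPosition.isBigO_regret {I : NRM m n} (hgp : I.GeneralPosition)
    [IsProbabilityMeasure P] (hJ : ∀ t, Measurable (J t)) (hindep : iIndepFun J P)
    (hlaw : ∀ t j, P.real {ω | J t ω = j} = I.lam j) {α β γ : ℕ → ℝ}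
    (hα : ∀ᶠ T in atTop, α T ≤ 1 / 2)
    (hγ : (fun T : ℕ => √(Real.log T)) =o[atTop] fun T : ℕ => (T : ℝ) ^ γ T)
    (hαγ : Tendsto (fun T : ℕ => (T : ℝ) ^ (α T / 2 - γ T)) atTop atTop)
    (hβ : (fun T : ℕ => √(Real.log T)) =o[atTop] fun T : ℕ => (T : ℝ) ^ β T)
    (hβ' : (fun T : ℕ => (T : ℝ) ^ β T) =o[atTop] fun T : ℕ => (T : ℝ) ^ (1 / 2 : ℝ)) :
    (fun T : ℕ => I.regret P J T (α T) (β T) (γ T)) =O[atTop]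
      fun T : ℕ => (T : ℝ) ^ α T + (T : ℝ) ^ (3 / 8 + 3 / 4 * β T) * √(Real.log T) := by
  obtain ⟨C, hC, M, hM, hreg⟩ := hgp.exists_abs_regret_le hJ hindep hlaw
  have hrp : ∀ (x : ℕ → ℝ) (T : ℕ), 0 ≤ (T : ℝ) ^ x T := fun x T =>
    Real.rpow_nonneg (Nat.cast_nonneg _) _
  refine IsBigO.of_bound (C * 2) ?_
  -- With l = √(log T): g ≥ (4M+1) l beats the phase I error, d ≥ 2M separates T^c from T^α, w ≥
  -- (8M+4) l makes phase III long against the error of phase II and gives w ≥ 4, and r ≥ 4w keeps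
  -- phase III short against T.
  filter_upwards [hα, eventually_mul_le_of_isLittleO hγ (fun _ => Real.sqrt_nonneg _) (hrp γ)
      (show 0 < 4 * M + 1 by positivity), hαγ.eventually_ge_atTop (2 * M),
    hαγ.eventually_ge_atTop 1,
    eventually_mul_le_of_isLittleO hβ (fun _ => Real.sqrt_nonneg _) (hrp β)
      (show 0 < 8 * M + 4 by positivity),
    eventually_mul_le_of_isLittleO hβ' (hrp β) (hrp fun _ => 1 / 2) (show (0 : ℝ) < 4 by norm_num),
    eventually_one_le_log_natCast, eventually_ge_atTop 16]
    with T hα hγ hαγ hαγ1 hβ hβ' hlog hT16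
  have hT16' : (16 : ℝ) ≤ T := by exact_mod_cast hT16
  have hT : (0 : ℝ) < T := by linarith
  set l := √(Real.log T) with hl
  have hl1 : 1 ≤ l := Real.one_le_sqrt.2 hlog
  set g := (T : ℝ) ^ γ T with hg
  set d := (T : ℝ) ^ (α T / 2 - γ T) with hd
  set w := (T : ℝ) ^ β T with hw
  set r := (T : ℝ) ^ (1 / 2 : ℝ) with hr
  have hr0 : 0 ≤ r := Real.rpow_nonneg hT.le _
  have hrr : r * r = T := by rw [hr, ← Real.rpow_add hT]; norm_num
  have hr4 : 4 ≤ r := by nlinarith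
  have hg1 : 1 ≤ g := by nlinarith
  have hw4 : 4 ≤ w := by nlinarith
  have hU : (T : ℝ) ^ (α T / 2 + γ T) = g * d * g := by
    rw [hg, hd, ← Real.rpow_add hT, ← Real.rpow_add hT]; ring_nf
  have hA : (T : ℝ) ^ α T = (g * d) ^ 2 := by
    rw [hg, hd, ← Real.rpow_add hT, ← Real.rpow_natCast, ← Real.rpow_mul hT.le]
    push_cast; ring_nf
  have hW : (T : ℝ) ^ (1 / 2 + β T) = r * w := Real.rpow_add hT _ _
  have hgd : 1 ≤ g * d := one_le_mul_of_one_le_of_one_le hg1 hαγ1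
  have hA1 : 1 ≤ (T : ℝ) ^ α T := by rw [hA]; exact one_le_pow₀ hgd
  have hAr : (T : ℝ) ^ α T ≤ r := Real.rpow_le_rpow_of_exponent_le (by linarith) hα
  have hAT : (T : ℝ) ^ α T + r * w ≤ T := by
    have h1 : r * w ≤ r * (r / 4) := mul_le_mul_of_nonneg_left (by linarith) hr0
    nlinarith
  have h1A : (T : ℝ) ^ α T ≤ len₁ T (α T) := Nat.le_ceil _
  have h1B : (len₁ T (α T) : ℝ) < (T : ℝ) ^ α T + 1 := Nat.ceil_lt_add_one (by linarith)
  have h2A : (T : ℝ) - (T : ℝ) ^ α T - r * w ≤ len₂ T (α T) (β T) := by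
    rw [← hW]; exact Nat.le_ceil _
  have h2B : (len₂ T (α T) (β T) : ℝ) < (T : ℝ) - (T : ℝ) ^ α T - r * w + 1 := by
    rw [← hW]; exact Nat.ceil_lt_add_one (by rw [hW]; linarith)
  have hrw : 16 ≤ r * w := by nlinarith
  have hlt : len₁ T (α T) + len₂ T (α T) (β T) < T := by
    have : ((len₁ T (α T) + len₂ T (α T) (β T) : ℕ) : ℝ) < T := by push_cast; linarith
    exact_mod_cast this
  have h3 : ((T - (len₁ T (α T) + len₂ T (α T) (β T)) : ℕ) : ℝ)
      = T - (len₁ T (α T) + len₂ T (α T) (β T)) := by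
    rw [Nat.cast_sub hlt.le]; push_cast; ring
  have h4 : ((T - len₁ T (α T) : ℕ) : ℝ) = T - len₁ T (α T) := Nat.cast_sub (by omega)
  have h5 : (1 : ℝ) ≤ ((T - len₁ T (α T) : ℕ) : ℝ) :=
    Nat.one_le_cast.2 (Nat.le_sub_of_add_le (by omega))
  set N₁ := (len₁ T (α T) : ℝ) with hN₁
  set N₂ : ℝ := ((T - len₁ T (α T) : ℕ) : ℝ) with hN₂
  set N₃ : ℝ := ((T - (len₁ T (α T) + len₂ T (α T) (β T)) : ℕ) : ℝ) with hN₃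
  have hN₁0 : 1 ≤ N₁ := hA1.trans h1A
  have hN₂0 : 1 ≤ N₂ := h5
  have hsqrt : ∀ x : ℝ, 0 ≤ x → √(x * Real.log T) = √x * l := fun x hx => Real.sqrt_mul hx _
  have hle : ∀ x : ℝ, 1 ≤ x → √x ≤ 2 * √(x * Real.log T) ∧ 1 ≤ 2 * √(x * Real.log T) :=
    fun x hx => le_two_mul_sqrt_mul hx hlog
  -- Fourth root of the target length T^b of phase III.
  set q := (T : ℝ) ^ ((1 / 2 + β T) / 4) with hq
  have hqpow : ∀ k : ℕ, q ^ k = (T : ℝ) ^ ((1 / 2 + β T) / 4 * k) := fun k => by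
    rw [hq, Real.rpow_mul hT.le, Real.rpow_natCast]
  have hq4 : (T : ℝ) ^ (1 / 2 + β T) = q ^ 4 := by rw [hqpow]; push_cast; ring_nf
  have hq3 : (T : ℝ) ^ (3 * (1 / 2 + β T) / 4) = q ^ 3 := by rw [hqpow]; push_cast; ring_nf
  have hq3' : (T : ℝ) ^ (3 / 8 + 3 / 4 * β T) = q ^ 3 := by rw [hqpow]; push_cast; ring_nf
  have hq0 : 0 < q := Real.rpow_pos_of_pos hT _
  have hrwq : r * w = q ^ 4 := by rw [← hW, hq4]
  have hq1 : 1 ≤ q := by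
    by_contra hcon
    have := pow_le_one₀ (n := 4) hq0.le (not_le.1 hcon).le
    linarith
  have hN₃le : N₃ ≤ q ^ 4 := by rw [h3, ← hrwq]; linarith
  have hN₃0 : 0 ≤ N₃ := Nat.cast_nonneg _
  have hE₃ : 2 * √(N₃ * Real.log T) ≤ 2 * q ^ 2 * l := by
    rw [hsqrt _ hN₃0, mul_assoc]
    have : √N₃ ≤ q ^ 2 := Real.sqrt_le_iff.2 ⟨by positivity, by rw [← pow_mul]; exact hN₃le⟩
    gcongr
  have hrT : ∀ x : ℝ, 0 ≤ x → x ≤ T → √(x * Real.log T) ≤ r * l := fun x hx hxT => by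
    rw [hsqrt x hx, hr, ← Real.sqrt_eq_rpow]
    gcongr
  have key := hreg T (α T) (β T) (γ T) q l _ _ _ rfl rfl rfl hlt (hle N₁ hN₁0).1 (hle N₁ hN₁0).2
    (by rw [← h4]; exact (hle N₂ hN₂0).1) (hle N₂ hN₂0).2 hE₃ ?_ ?_ ?_ hq1 hl1 hq4 hq3 hN₃le ?_
  · rw [Real.norm_eq_abs, Real.norm_of_nonneg (by positivity), hq3', mul_assoc]
    refine key.trans (mul_le_mul_of_nonneg_left ?_ hC.le)
    have : 0 ≤ q ^ 3 * l := by positivity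
    linarith
  · rw [hsqrt _ (by linarith), hU]
    have h5 : √N₁ ≤ 2 * (g * d) := by
      refine Real.sqrt_le_iff.2 ⟨by positivity, ?_⟩
      rw [mul_pow, ← hA]; linarith
    calc M * (2 * (√N₁ * l)) ≤ M * (2 * (2 * (g * d) * l)) := by gcongr
      _ = g * d * (4 * M * l) := by ring
      _ < g * d * g := by
        refine mul_lt_mul_of_pos_left ?_ (by linarith)
        linarith
  · rw [hU, hA]
    have h5 : 1 ≤ g * d * g := one_le_mul_of_one_le_of_one_le hgd hg1
    calc M * (1 + g * d * g) ≤ M * (g * d * g + g * d * g) := by gcongr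
      _ = g * d * g * (2 * M) := by ring
      _ ≤ g * d * g * d := by gcongr
      _ = _ := by ring
  · have h5 := hrT N₂ (by linarith) (by rw [h4]; linarith)
    have h6 := hrT N₃ hN₃0 (by rw [h3]; linarith [Nat.cast_nonneg (α := ℝ) (len₂ T (α T) (β T))])
    calc M * (2 * √(N₂ * Real.log T) + 2 * √(N₃ * Real.log T)) ≤ M * (2 * (r * l) + 2 * (r * l)) := by
          gcongr
      _ = r * (8 * M * l) / 2 := by ring
      _ ≤ r * w / 2 := by
          have : 8 * M * l ≤ w := by linarith
          gcongr
      _ ≤ N₃ := by rw [h3]; linarith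
  -- The two ceilings shorten phase III by less than 2, and r w ≥ 16, so at least half of q⁴
  -- remains.
  · refine le_trans ?_ h3.ge
    rw [← hrwq]; linarith

/-- The rate for fixed exponents. -/
lemma GeneralPosition.isBigO_regret_const {I : NRM m n} (hgp : I.GeneralPosition)
    [IsProbabilityMeasure P] (hJ : ∀ t, Measurable (J t)) (hindep : iIndepFun J P)
    (hlaw : ∀ t j, P.real {ω | J t ω = j} = I.lam j) {α β γ : ℝ} (hα' : α < 1 / 2)
    (hβ : α / 2 ≤ β) (hβ' : β < 1 / 2) (hγ : 0 < γ) (hγ' : γ < α / 2) :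
    (fun T : ℕ => I.regret P J T α β γ) =O[atTop]
      fun T : ℕ => (T : ℝ) ^ α + T * Real.exp (-(T : ℝ) ^ epsScale T)
        + (T : ℝ) ^ (3 / 8 + 3 / 4 * β + 1 / 2 * epsScale T) := by
  refine (hgp.isBigO_regret hJ hindep hlaw (α := fun _ => α) (β := fun _ => β) (γ := fun _ => γ)
    (Eventually.of_forall fun _ => hα'.le) (isLittleO_sqrt_log_natCast_rpow hγ)
    ((tendsto_rpow_atTop (by linarith)).comp tendsto_natCast_atTop_atTop)
    (isLittleO_sqrt_log_natCast_rpow (by linarith))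
    ((isLittleO_rpow_rpow_atTop hβ').comp_tendsto tendsto_natCast_atTop_atTop)).trans ?_
  refine IsBigO.of_bound 1 ?_
  filter_upwards [eventually_one_le_log_natCast, eventually_gt_atTop 0] with T hlog hT
  have hT' : (0 : ℝ) < T := by exact_mod_cast hT
  have h1 : (T : ℝ) ^ (3 / 8 + 3 / 4 * β + 1 / 2 * epsScale T)
      = (T : ℝ) ^ (3 / 8 + 3 / 4 * β) * √(Real.log T) := by
    rw [Real.rpow_add hT', rpow_mul_epsScale hlog, Real.sqrt_eq_rpow]
  rw [h1, one_mul, Real.norm_of_nonneg (by positivity), Real.norm_of_nonneg (by positivity)]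
  -- The exponential term is pure slack: the other two already dominate the regret.
  have h2 : 0 ≤ T * Real.exp (-(T : ℝ) ^ epsScale T) := by positivity
  linarith

lemma eventually_star_admissible : ∀ᶠ T : ℕ in atTop, 0 < alphaStar T ∧ alphaStar T < 1 / 2 ∧
    alphaStar T / 2 ≤ betaStar T ∧ betaStar T < 1 / 2 ∧
    0 < gammaStar T ∧ gammaStar T < alphaStar T / 2 := by
  filter_upwards [eventually_epsScale_pos,
    tendsto_epsScale.eventually_lt_const (show (0 : ℝ) < 1 / 3 by norm_num)] with T h1 h2
  rw [alphaStar_eq, betaStar_eq, gammaStar_eq]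
  refine ⟨?_, ?_, ?_, ?_, ?_, ?_⟩ <;> linarith

/-- The rate for the special exponents. -/
lemma GeneralPosition.isBigO_regret_star {I : NRM m n} (hgp : I.GeneralPosition)
    [IsProbabilityMeasure P] (hJ : ∀ t, Measurable (J t)) (hindep : iIndepFun J P)
    (hlaw : ∀ t j, P.real {ω | J t ω = j} = I.lam j) :
    (fun T : ℕ => I.regret P J T (alphaStar T) (betaStar T) (gammaStar T)) =O[atTop]
      fun T : ℕ => (T : ℝ) ^ (3 / 8 : ℝ) * Real.log T ^ (5 / 4 : ℝ) := by
  have hlogT : Tendsto (fun T : ℕ => Real.log T) atTop atTop :=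
    Real.tendsto_log_atTop.comp tendsto_natCast_atTop_atTop
  have hpow : ∀ c : ℝ, (fun T : ℕ => Real.log T ^ c)
      =ᶠ[atTop] fun T : ℕ => (T : ℝ) ^ (c * epsScale T) := fun c => by
    filter_upwards [eventually_one_le_log_natCast] with T hT
    rw [rpow_mul_epsScale hT]
  have hsqrt : ∀ c : ℝ, 1 / 2 < c → (fun T : ℕ => √(Real.log T))
      =o[atTop] fun T : ℕ => (T : ℝ) ^ (c * epsScale T) := fun c hc => by
    refine IsLittleO.trans_eventuallyEq ?_ (hpow c)
    simp_rw [Real.sqrt_eq_rpow]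
    exact (isLittleO_rpow_rpow_atTop hc).comp_tendsto hlogT
  refine (hgp.isBigO_regret hJ hindep hlaw ?_ ?_ ?_ ?_ ?_).trans ?_
  · filter_upwards [eventually_star_admissible] with T hT using hT.2.1.le
  · simp_rw [gammaStar_eq]
    exact hsqrt _ (by norm_num)
  · simp_rw [alphaStar_eq, gammaStar_eq]
    -- α/2 - γ = (3/4 - 2/3) ε = ε/12, so this power of T is (log T)^(1/12).
    refine Tendsto.congr' ?_ ((tendsto_rpow_atTop (show (0 : ℝ) < 1 / 12 by norm_num)).comp hlogT)
    filter_upwards [hpow (1 / 12)] with T hT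
    rw [Function.comp_apply, hT]
    ring_nf
  · simp_rw [betaStar_eq]
    exact hsqrt _ (by norm_num)
  · simp_rw [betaStar_eq]
    exact (isLittleO_log_rpow_natCast_rpow 1 (by norm_num)).congr' (hpow 1) EventuallyEq.rfl
  · refine IsBigO.of_bound 2 ?_
    filter_upwards [eventually_one_le_log_natCast, eventually_gt_atTop 0,
      eventually_mul_le_of_isLittleO (isLittleO_log_rpow_natCast_rpow (3 / 2)
        (show (0 : ℝ) < 3 / 8 by norm_num)) (fun T => Real.rpow_nonneg (Real.log_natCast_nonneg T) _)
        (fun T => Real.rpow_nonneg (Nat.cast_nonneg T) _) one_pos] with T hlog hT hlt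
    have hT' : (0 : ℝ) < T := by exact_mod_cast hT
    have hl0 : 0 < Real.log T := by linarith
    -- T^(3β/4) contributes (log T)^(3/4) and the sampling error (log T)^(1/2), whence the exponent
    -- 5/4. The phase I cost (log T)^(3/2) is negligible.
    have h1 : (T : ℝ) ^ (3 / 8 + 3 / 4 * betaStar T) * √(Real.log T)
        = (T : ℝ) ^ (3 / 8 : ℝ) * Real.log T ^ (5 / 4 : ℝ) := by
      rw [betaStar_eq, one_mul, Real.rpow_add hT', rpow_mul_epsScale hlog, Real.sqrt_eq_rpow,
        mul_assoc, ← Real.rpow_add hl0]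
      norm_num
    have h2 : 1 ≤ Real.log T ^ (5 / 4 : ℝ) := Real.one_le_rpow hlog (by norm_num)
    rw [h1, alphaStar_eq, rpow_mul_epsScale hlog, Real.norm_of_nonneg (by positivity),
      Real.norm_of_nonneg (by positivity)]
    have h3 : (T : ℝ) ^ (3 / 8 : ℝ) ≤ (T : ℝ) ^ (3 / 8 : ℝ) * Real.log T ^ (5 / 4 : ℝ) :=
      le_mul_of_one_le_right (by positivity) h2
    linarith

lemma GeneralPosition.tendsto_regret_star_div_sqrt {I : NRM m n} (hgp : I.GeneralPosition)
    [IsProbabilityMeasure P] (hJ : ∀ t, Measurable (J t)) (hindep : iIndepFun J P)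
    (hlaw : ∀ t j, P.real {ω | J t ω = j} = I.lam j) {T₀ : ℕ} (hT₀ : 0 < T₀) :
    Tendsto (fun k : ℕ => I.regret P J (k * T₀) (alphaStar (k * T₀)) (betaStar (k * T₀))
      (gammaStar (k * T₀)) / √(k : ℝ)) atTop (𝓝 0) := by
  have h1 : (fun T : ℕ => (T : ℝ) ^ (3 / 8 : ℝ) * Real.log T ^ (5 / 4 : ℝ))
      =o[atTop] fun T : ℕ => √(T : ℝ) := by
    refine ((isBigO_refl (fun T : ℕ => (T : ℝ) ^ (3 / 8 : ℝ)) atTop).mul_isLittleO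
      (isLittleO_log_rpow_natCast_rpow (5 / 4) (show (0 : ℝ) < 1 / 8 by norm_num))).congr'
      EventuallyEq.rfl ?_
    filter_upwards [eventually_gt_atTop 0] with T hT
    rw [← Real.rpow_add (by exact_mod_cast hT), Real.sqrt_eq_rpow]
    norm_num
  have hk : Tendsto (fun k : ℕ => k * T₀) atTop atTop := tendsto_id.atTop_mul_const' hT₀
  have h2 := ((hgp.isBigO_regret_star hJ hindep hlaw).trans_isLittleO h1).comp_tendsto hk
  refine (h2.trans_isBigO ?_).tendsto_div_nhds_zero
  refine IsBigO.of_bound (√(T₀ : ℝ)) (Eventually.of_forall fun k => ?_)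
  rw [Function.comp_apply, Real.norm_of_nonneg (Real.sqrt_nonneg _),
    Real.norm_of_nonneg (Real.sqrt_nonneg _), Nat.cast_mul, Real.sqrt_mul (Nat.cast_nonneg _),
    mul_comm]

end Rate

end NRM

theorem theorem2 {m n : ℕ} (I : NRM m n) (hgp : I.GeneralPosition)
    {Ω : Type*} [MeasurableSpace Ω] (P : Measure Ω) [IsProbabilityMeasure P]
    (J : ℕ → Ω → Fin n) (hJ : ∀ t, Measurable (J t)) (hindep : iIndepFun J P)
    (hlaw : ∀ t j, P.real {ω | J t ω = j} = I.lam j) :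
    -- the expectations below are expectations of integrable random variables
    (∀ (T : ℕ) (α β γ : ℝ), Integrable (fun ω => I.pathRegret T α β γ (fun t => J t ω)) P) ∧
    -- general parameters
    (∀ α β γ : ℝ, 0 < α → α < 1 / 2 → α / 2 ≤ β → β < 1 / 2 → 0 < γ → γ < α / 2 →
      (fun T : ℕ => I.regret P J T α β γ) =O[atTop]
        (fun T : ℕ => (T : ℝ) ^ α + T * Real.exp (-(T : ℝ) ^ epsScale T)
          + (T : ℝ) ^ (3 / 8 + 3 / 4 * β + 1 / 2 * epsScale T))) ∧
    -- the special parameters are admissible for large horizons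
    (∀ᶠ T : ℕ in atTop, 0 < alphaStar T ∧ alphaStar T < 1 / 2 ∧
      alphaStar T / 2 ≤ betaStar T ∧ betaStar T < 1 / 2 ∧
      0 < gammaStar T ∧ gammaStar T < alphaStar T / 2) ∧
    -- the rate for the special parameters
    ((fun T : ℕ => I.regret P J T (alphaStar T) (betaStar T) (gammaStar T)) =O[atTop]
        (fun T : ℕ => (T : ℝ) ^ (3 / 8 : ℝ) * Real.log T ^ (5 / 4 : ℝ))) ∧
    -- optimality on the diffusion scale, for horizons `T = k * T₀` with scaling factor `k`
    (∀ T₀ : ℕ, 0 < T₀ →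
      Tendsto (fun k : ℕ => I.regret P J (k * T₀) (alphaStar (k * T₀)) (betaStar (k * T₀))
        (gammaStar (k * T₀)) / √(k : ℝ)) atTop (𝓝 0)) := by
  exact ⟨I.integrable_pathRegret hJ,
    fun α β γ _ hα' hβ hβ' hγ hγ' => hgp.isBigO_regret_const hJ hindep hlaw hα' hβ hβ' hγ hγ',
    NRM.eventually_star_admissible, hgp.isBigO_regret_star hJ hindep hlaw,
    fun _ hT₀ => hgp.tendsto_regret_star_div_sqrt hJ hindep hlaw hT₀⟩
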